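/- Let $C>0$, $0\le\gamma\le1$ and $B(|v-v_*|,\theta)=C|v-v_*|^{\gamma}\sin\theta\cos\theta$. For $v,v_*\in\mathbb R^3$ put $\omega=\cos\theta\,\frac{v_*-v}{|v_*-v|}+\sin\theta\cos\phi\,e_2+\sin\theta\sin\phi\,e_3$, where $\{\frac{v_*-v}{|v_*-v|},e_2,e_3\}$ is any orthonormal basis of $\mathbb R^3$, $v'=v+((v_*-v)\cdot\omega)\omega$, $v_*'=v_*-((v_*-v)\cdot\omega)\omega$, and $$Q(F,G)(v)=\int_{\mathbb R^3}\int_0^{2\pi}\int_0^{\pi/2}[F(v')G(v_*')-F(v)G(v_*)]\,B(|v-v_*|,\theta)\,d\theta\,d\phi\,dv_*.$$ Let $M(v)=\pi^{-3/2}e^{-|v|^2}$, $\Gamma(h_1,h_2)=M^{-1/2}Q(M^{1/2}h_1,M^{1/2}h_2)$ (with $x$ as a parameter), and let $\nu(v)=\int_{\mathbb R^3}\int_0^{2\pi}\int_0^{\pi/2}M(v_*)B(|v-v_*|,\theta)\,d\theta\,d\phi\,dv_*$ be the collision frequency. Let $\Omega\subset\mathbb R^3$ be a bounded domain with $C^2$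 boundary of positive Gaussian curvature and outward unit normal $n$. A number $R>0$ is a uniform circumscribed radius of $\Omega$ if for every $x\in\partial\Omega$ there is a ball $B_R$ of radius $R$ with $x\in\partial B_R$ and $\overline\Omega\subset\overline{B_R}$; a number $r>0$ is a uniform interior radius if for every $x\in\partial\Omega$ there is a ball $B_r$ of radius $r$ with $x\in\partial B_r$ and $\overline{B_r}\subset\overline\Omega$. For $x\in\Omega$ and $v\ne0$ let $\tau_{x,v}=\inf\{s\ge0: x-sv\notin\Omega\}$, $q(x,v)=x-\tau_{x,v}v$, $N(x,v)=-n(q(x,v))\cdot\frac{v}{|v|}$, $w(x,v)=\frac{|v|}{|v|+1}N(x,v)$, and $$S_\Omega h(x,v)=\int_0^{\tau_{x,v}}e^{-\nu(v)s}h(x-sv,v)\,ds.$$ For $\alpha\ge0$ put $|f|_{\infty,\alpha}=\operatorname{ess\,sup}_{(x,v)\in\Omega\times\mathbb R^3}e^{\alpha|v|^2}|f(x,v)|$ and $$\|f\|_{\infty,\alpha}=|f|_{\infty,\alpha}+|w\nabla_xf|_{\infty,\alpha}+|w\nabla_vf|_{\infty,\alpha},$$ with weak gradients on $\Omega\times\mathbb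 R^3$ (the norm being $\infty$ if they do not exist), and let $\hat L^\infty_\alpha=\{f:\|f\|_{\infty,\alpha}<\infty\}$. Let $0\le\rho<1$ and $0\le\alpha<(1-\rho)/2$. Then there is a constant $K\ge0$, depending only on $C,\gamma,\rho,\alpha$, such that for every bounded domain $\Omega\subset\mathbb R^3$ with $C^2$ boundary of positive Gaussian curvature, every uniform circumscribed radius $R$ and every uniform interior radius $r$ of $\Omega$, and all $h_1,h_2\in\hat L^\infty_\alpha$, $$\|S_\Omega\Gamma(h_1,h_2)\|_{\infty,\alpha}\le K\left(1+\operatorname{diam}(\Omega)+(Rr)^{1/2}\left(1+\frac Rr\right)\right)\|h_1\|_{\infty,\alpha}\,\|h_2\|_{\infty,\alpha}.$$ In particular $S_\Omega\Gamma(h_1,h_2)$ is weakly differentiable in $x$ and $v$ and belongs to $\hat L^\infty_\alpha$. -/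

import Mathlib

open MeasureTheory Set
open scoped ENNReal Topology

namespace StationaryBoltzmann

noncomputable section

/-- Three-dimensional Euclidean space, used both for positions and for velocities. -/
abbrev V3 := EuclideanSpace ℝ (Fin 3)

/-! ### Geometry of the space domain -/

/-- `φ` is a `C²` defining function of `Ω` near the boundary point `p`: it is `C²` near `p`, its
gradient does not vanish at `p`, and near `p` the set `Ω` is `{φ < 0}`. -/
structure IsDefiningFunction (Ω : Set V3) (p : V3) (φ : V3 → ℝ) : Prop where
  contDiffAt : ContDiffAt ℝ 2 φ p
  gradient_ne_zero : gradient φ p ≠ 0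
  apply_eq_zero : φ p = 0
  mem_iff : ∀ᶠ y in 𝓝 p, (y ∈ Ω ↔ φ y < 0)

/-- The second fundamental form at `p` of the level surface of `φ` through `p`, with respect to the
unit normal `-∇φ/|∇φ|`: the Hessian of `φ` divided by `|∇φ|`, on tangent vectors `X`, `Y`. -/
def secondFundamentalForm (φ : V3 → ℝ) (p X Y : V3) : ℝ :=
  fderiv ℝ (fderiv ℝ φ) p X Y / ‖gradient φ p‖

/-- The Gaussian curvature at `p` of the level surface of `φ` through `p` (the determinant of the
second fundamental form in an orthonormal basis of the tangent plane) is positive. -/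
def HasPosGaussianCurvature (φ : V3 → ℝ) (p : V3) : Prop :=
  ∀ X Y : V3, Orthonormal ℝ ![X, Y] → inner ℝ X (gradient φ p) = 0 →
    inner ℝ Y (gradient φ p) = 0 →
    0 < secondFundamentalForm φ p X X * secondFundamentalForm φ p Y Y
      - secondFundamentalForm φ p X Y ^ 2

/-- Bounded domains with `C²` boundary of positive Gaussian curvature. -/
structure AssumptionOmega (Ω : Set V3) : Prop where
  isOpen : IsOpen Ω
  isConnected : IsConnected Ω
  isBounded : Bornology.IsBounded Ω
  boundary : ∀ p ∈ frontier Ω, ∃ φ : V3 → ℝ,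
    IsDefiningFunction Ω p φ ∧ HasPosGaussianCurvature φ p

/-- `R` is a uniform circumscribed radius of `Ω`. -/
def IsCircumscribedRadius (Ω : Set V3) (R : ℝ) : Prop :=
  0 < R ∧ ∀ x ∈ frontier Ω, ∃ c : V3,
    x ∈ Metric.sphere c R ∧ closure Ω ⊆ Metric.closedBall c R

/-- `r` is a uniform interior radius of `Ω`. -/
def IsInteriorRadius (Ω : Set V3) (r : ℝ) : Prop :=
  0 < r ∧ ∀ x ∈ frontier Ω, ∃ c : V3,
    x ∈ Metric.sphere c r ∧ Metric.closedBall c r ⊆ closure Ω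

/-- `n` is the outward unit normal of `∂Ω` at `p`. -/
def IsOutwardUnitNormal (Ω : Set V3) (p n : V3) : Prop :=
  ∃ φ : V3 → ℝ, IsDefiningFunction Ω p φ ∧ n = ‖gradient φ p‖⁻¹ • gradient φ p

/-- The outward unit normal `n(p)` of `∂Ω` at `p` (it is unique where it exists). -/
def outwardNormal (Ω : Set V3) (p : V3) : V3 :=
  Classical.epsilon (IsOutwardUnitNormal Ω p)

/-- The backward exit time `τ_{x,v}`. For `v = 0` and `x ∈ Ω` the set is empty and the value is
`0` instead of `∞`; these `(x, v)` form a null set. -/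
def exitTime (Ω : Set V3) (x v : V3) : ℝ :=
  sInf {s : ℝ | 0 ≤ s ∧ x - s • v ∈ Ωᶜ}

/-- The backward exit point `q(x,v)`. -/
def exitPoint (Ω : Set V3) (x v : V3) : V3 :=
  x - exitTime Ω x v • v

/-- `N(x,v) = -n(q(x,v)) · v/|v|`. -/
def exitCosine (Ω : Set V3) (x v : V3) : ℝ :=
  -inner ℝ (outwardNormal Ω (exitPoint Ω x v)) (‖v‖⁻¹ • v)

/-- The weight `w(x,v) = |v|/(|v|+1) N(x,v)`. -/
def weight (Ω : Set V3) (z : V3 × V3) : ℝ :=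
  ‖z.2‖ / (‖z.2‖ + 1) * exitCosine Ω z.1 z.2

/-! ### Weak derivatives and the weighted norms -/

/-- The phase space `Ω × ℝ³`. -/
def phaseSpace (Ω : Set V3) : Set (V3 × V3) := Ω ×ˢ univ

/-- Test functions on `Ω × ℝ³`. -/
structure IsTestFunction (Ω : Set V3) (ψ : V3 × V3 → ℝ) : Prop where
  contDiff : ContDiff ℝ (⊤ : ℕ∞) ψ
  hasCompactSupport : HasCompactSupport ψ
  tsupport_subset : tsupport ψ ⊆ phaseSpace Ω

/-- `G` is the weak gradient of `f` in the `x` variable on `Ω × ℝ³`. -/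
structure IsWeakGradX (Ω : Set V3) (f : V3 × V3 → ℝ) (G : V3 × V3 → V3) : Prop where
  locallyIntegrableOn : LocallyIntegrableOn f (phaseSpace Ω) volume
  locallyIntegrableOn_grad : LocallyIntegrableOn G (phaseSpace Ω) volume
  integral_eq : ∀ ψ : V3 × V3 → ℝ, IsTestFunction Ω ψ → ∀ e : V3,
    ∫ z in phaseSpace Ω, f z * fderiv ℝ ψ z (e, 0)
      = -∫ z in phaseSpace Ω, inner ℝ (G z) e * ψ z

/-- `G` is the weak gradient of `f` in the `v` variable on `Ω × ℝ³`. -/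
structure IsWeakGradV (Ω : Set V3) (f : V3 × V3 → ℝ) (G : V3 × V3 → V3) : Prop where
  locallyIntegrableOn : LocallyIntegrableOn f (phaseSpace Ω) volume
  locallyIntegrableOn_grad : LocallyIntegrableOn G (phaseSpace Ω) volume
  integral_eq : ∀ ψ : V3 × V3 → ℝ, IsTestFunction Ω ψ → ∀ e : V3,
    ∫ z in phaseSpace Ω, f z * fderiv ℝ ψ z (0, e)
      = -∫ z in phaseSpace Ω, inner ℝ (G z) e * ψ z

/-- `|f|_{∞,α}`, the essential supremum of `e^{α|v|²} |f(x,v)|` over `Ω × ℝ³`. -/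
def supNorm {E : Type*} [NormedAddCommGroup E] (Ω : Set V3) (α : ℝ) (f : V3 × V3 → E) : ℝ≥0∞ :=
  essSup (fun z => ENNReal.ofReal (Real.exp (α * ‖z.2‖ ^ 2)) * ‖f z‖ₑ)
    (volume.restrict (phaseSpace Ω))

/-- `|f|_{∞,α,w} = |w f|_{∞,α}`. -/
def weightedSupNorm (Ω : Set V3) (α : ℝ) (f : V3 × V3 → V3) : ℝ≥0∞ :=
  supNorm Ω α (fun z => weight Ω z • f z)

/-- `|∇ₓ f|_{∞,α,w}`; weak gradients are unique almost everywhere, so that the infimum is over a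
single value, and it is `∞` if there is no weak gradient. -/
def gradXNorm (Ω : Set V3) (α : ℝ) (f : V3 × V3 → ℝ) : ℝ≥0∞ :=
  ⨅ (G : V3 × V3 → V3) (_ : IsWeakGradX Ω f G), weightedSupNorm Ω α G

/-- `|∇ᵥ f|_{∞,α,w}`, with the same convention. -/
def gradVNorm (Ω : Set V3) (α : ℝ) (f : V3 × V3 → ℝ) : ℝ≥0∞ :=
  ⨅ (G : V3 × V3 → V3) (_ : IsWeakGradV Ω f G), weightedSupNorm Ω α G

/-- `‖f‖_{∞,α} = |f|_{∞,α} + |∇ₓ f|_{∞,α,w} + |∇ᵥ f|_{∞,α,w}`. -/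
def hatNorm (Ω : Set V3) (α : ℝ) (f : V3 × V3 → ℝ) : ℝ≥0∞ :=
  supNorm Ω α f + gradXNorm Ω α f + gradVNorm Ω α f

/-- The space `\hat L^∞_α`. Measurability on `Ω × ℝ³` is part of the existence of weak
gradients. -/
def hatL (Ω : Set V3) (α : ℝ) : Set (V3 × V3 → ℝ) := {f | hatNorm Ω α f < ∞}

/-! ### The collision operator -/

/-- The cross section `B(ϱ,θ) = C ϱ^γ sin θ cos θ`. -/
def crossSection (C γ ϱ θ : ℝ) : ℝ := C * ϱ ^ γ * Real.sin θ * Real.cos θ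

/-- A choice, for every `u ≠ 0`, of an orthonormal basis `{u/|u|, e₂, e₃}` of `ℝ³`. -/
def IsCollisionFrame (e : V3 → OrthonormalBasis (Fin 3) ℝ V3) : Prop :=
  ∀ u : V3, u ≠ 0 → e u 0 = ‖u‖⁻¹ • u

/-- `ω = cos θ (v⋆-v)/|v⋆-v| + sin θ cos ϕ e₂ + sin θ sin ϕ e₃`. -/
def collisionDirection (e : V3 → OrthonormalBasis (Fin 3) ℝ V3) (v vs : V3) (ϕ θ : ℝ) : V3 :=
  Real.cos θ • (‖vs - v‖⁻¹ • (vs - v)) + (Real.sin θ * Real.cos ϕ) • e (vs - v) 1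
    + (Real.sin θ * Real.sin ϕ) • e (vs - v) 2

/-- `v' = v + ((v⋆ - v)·ω) ω`. -/
def postVelocity (v vs ω : V3) : V3 := v + inner ℝ (vs - v) ω • ω

/-- `v⋆' = v⋆ - ((v⋆ - v)·ω) ω`. -/
def postVelocityStar (v vs ω : V3) : V3 := vs - inner ℝ (vs - v) ω • ω

/-- The collision operator `Q(F,G)(v)`. -/
def collisionQ (C γ : ℝ) (e : V3 → OrthonormalBasis (Fin 3) ℝ V3) (F G : V3 → ℝ) (v : V3) : ℝ :=
  ∫ vs : V3, ∫ ϕ in (0 : ℝ)..(2 * Real.pi), ∫ θ in (0 : ℝ)..(Real.pi / 2),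
    (F (postVelocity v vs (collisionDirection e v vs ϕ θ))
        * G (postVelocityStar v vs (collisionDirection e v vs ϕ θ))
      - F v * G vs) * crossSection C γ ‖v - vs‖ θ

/-- The Maxwellian `M(v) = π^{-3/2} e^{-|v|²}`. -/
def maxwellian (v : V3) : ℝ := Real.pi ^ (-(3 / 2) : ℝ) * Real.exp (-‖v‖ ^ 2)

/-- `Γ(h₁,h₂) = M^{-1/2} Q(M^{1/2} h₁, M^{1/2} h₂)`. -/
def collisionGamma (C γ : ℝ) (e : V3 → OrthonormalBasis (Fin 3) ℝ V3)
    (h₁ h₂ : V3 × V3 → ℝ) (z : V3 × V3) : ℝ :=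
  (Real.sqrt (maxwellian z.2))⁻¹ *
    collisionQ C γ e (fun u => Real.sqrt (maxwellian u) * h₁ (z.1, u))
      (fun u => Real.sqrt (maxwellian u) * h₂ (z.1, u)) z.2

/-- The collision frequency `ν(v) = ∫∫∫ M(v⋆) B(|v-v⋆|,θ) dθ dϕ dv⋆`, i.e. the multiplication
part of the linearized operator `L = -ν + K`. -/
def collisionFrequency (C γ : ℝ) (v : V3) : ℝ :=
  ∫ vs : V3, ∫ _ϕ in (0 : ℝ)..(2 * Real.pi), ∫ θ in (0 : ℝ)..(Real.pi / 2),
    maxwellian vs * crossSection C γ ‖v - vs‖ θ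

/-- `S_Ω h(x,v) = ∫₀^{τ_{x,v}} e^{-ν(v)s} h(x - s v, v) ds`. -/
def transportS (C γ : ℝ) (Ω : Set V3) (h : V3 × V3 → ℝ) (z : V3 × V3) : ℝ :=
  ∫ s in (0 : ℝ)..(exitTime Ω z.1 z.2),
    Real.exp (-(collisionFrequency C γ z.2) * s) * h (z.1 - s • z.2, z.2)

end

end StationaryBoltzmann

open StationaryBoltzmann

/-! Write Γ for Γ(h₁,h₂) and d(x) for the distance from x to the complement of Ω. The plan is to
prove local Lipschitz bounds for S_Ω Γ on Ω × (ℝ³ ∖ {0}) with constants of size e^{-α|v|²}/w, and to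
read off the weak gradients from them (`hatNorm_le_of_locallyLipschitz`). The set v = 0 does no
harm, because 1/|v| is locally integrable in three dimensions.

Geometry. The two uniform balls give, at each boundary point, a supporting half-space with a
quadratic gain R and a tangent interior ball. It follows that Ω is convex, that N and w are constant
along characteristics, that d(x) ≤ 2R N(x,v)² for every direction v, and that d(x - sv) ≥ s(τ -
s)|v|²/(2R). So 1/N(x,v) is dominated by √(2R/d(x)), uniformly in v, and the integral of this factor
along any chord is O(R/|v|) (`UniformlyRound.integral_chord_le`).

Collisions. Each hᵢ has a representative that is locally Lipschitz with constant e^{-α|v|²}/w. The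
gain term and the multiplier of the loss term average over velocities, so their increments see 1/w
only through √(2R/d(x)) (1 + 1/|v'|), and 1/|v'| is integrable against the collision kernel: the
mean of 1/|y| over a sphere is at most a multiple of the inverse radius. Conservation of energy
keeps the decay e^{-α|v|²}. The only factor that is not averaged is h₁(x,v) in front of the loss
multiplier; its singularity 1/w is constant along the characteristic, and for this reason its
increment is kept apart (`exists_abs_reducedGamma_sub_le`).

Transport. The collision frequency is at least c₀(1+|v|)^γ, which compensates the growth of Γ in v.
In the increment of S_Ω Γ the unaveraged part contributes 1/w, the averaged part contributes
(1+|v|)^γ R/|v|, which is at most a multiple of R/w because γ ≤ 1, and the change of the exit time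
contributes (1+|v|)^γ/(|v|N), again at most a multiple of 1/w. The exponential absorbs every power
of the travel time. The total constant is a multiple of 1 + R, and R ≤ √(Rr)(1 + R/r) since r ≤ R.

Two points of rigour remain. Passing to representatives changes the hᵢ on null sets, and Fubini
shows that this changes S_Ω Γ only on a null set. The orthonormal frame may depend on v⋆ - v without
any measurability, which is harmless because the angular measure on the sphere is the same in every
frame (`map_sphereVec`). -/

namespace StationaryBoltzmann

noncomputable section

/-! ### Supporting half-spaces, convexity and the backward exit time. -/

section

/-- A bounded open convex set whose boundary points have a circumscribed ball of radius `R` and an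
interior ball of radius `r`, both with outward unit normal `n p` at the boundary point `p`. -/
structure UniformlyRound (Ω : Set V3) (n : V3 → V3) (R r : ℝ) : Prop where
  isOpen : IsOpen Ω
  nonempty : Ω.Nonempty
  isBounded : Bornology.IsBounded Ω
  pos_R : 0 < R
  pos_r : 0 < r
  norm_normal : ∀ p ∈ frontier Ω, ‖n p‖ = 1
  outer : ∀ p ∈ frontier Ω, ∀ z ∈ closure Ω, ‖z - p‖ ^ 2 ≤ 2 * R * inner ℝ (n p) (p - z)
  inner_ball : ∀ p ∈ frontier Ω, Metric.closedBall (p - r • n p) r ⊆ closure Ω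

/-- The derivative of φ along the ray is negative at the boundary point, where φ vanishes, so φ is
negative shortly afterwards. -/
theorem IsDefiningFunction.mem_of_inner_neg {Ω : Set V3} {p : V3} {φ : V3 → ℝ}
    (h : IsDefiningFunction Ω p φ) {u : V3} (hu : inner ℝ (gradient φ p) u < 0) :
    ∀ᶠ t : ℝ in 𝓝[>] 0, p + t • u ∈ Ω := by
  have hd : HasDerivAt (fun t : ℝ => φ (p + t • u)) (inner ℝ (gradient φ p) u) 0 := by
    have h1 : HasGradientAt φ (gradient φ p) p :=
      (h.contDiffAt.differentiableAt (by norm_num)).hasGradientAt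
    have h2 : HasDerivAt (fun t : ℝ => p + t • u) u 0 := by
      simpa using ((hasDerivAt_id (0 : ℝ)).smul_const u).const_add p
    have h3 : HasFDerivAt φ (InnerProductSpace.toDual ℝ V3 (gradient φ p)) (p + (0 : ℝ) • u) := by
      simpa using h1.hasFDerivAt
    have h4 := h3.comp_hasDerivAt (0 : ℝ) h2
    rwa [InnerProductSpace.toDual_apply_apply] at h4
  have hlim := (hasDerivAt_iff_tendsto_slope.1 hd)
  have hneg : ∀ᶠ t in 𝓝[≠] (0 : ℝ), slope (fun t : ℝ => φ (p + t • u)) 0 t < 0 :=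
    hlim.eventually (gt_mem_nhds hu)
  have hneg' := nhdsWithin_mono (0 : ℝ) (fun t (ht : t ∈ Ioi (0 : ℝ)) => (ne_of_gt ht : t ≠ 0)) hneg
  have hc : Filter.Tendsto (fun t : ℝ => p + t • u) (𝓝[>] 0) (𝓝 p) := by
    have : ContinuousAt (fun t : ℝ => p + t • u) 0 := by fun_prop
    simpa [ContinuousAt] using this.tendsto.mono_left (nhdsWithin_le_nhds (s := Ioi 0))
  filter_upwards [hneg', hc.eventually h.mem_iff, self_mem_nhdsWithin] with t h1 h2 (h3 : 0 < t)
  rw [h2]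
  simp only [slope_def_field, zero_smul, add_zero, h.apply_eq_zero, sub_zero] at h1
  by_contra h4
  exact absurd h1 (not_lt.2 (div_nonneg (not_lt.1 h4) h3.le))

/-- The normal of a defining function is the normal of every circumscribed ball. -/
theorem IsDefiningFunction.normal_eq {Ω : Set V3} {p : V3} {φ : V3 → ℝ} {c : V3} {R : ℝ}
    (h : IsDefiningFunction Ω p φ) (hR : 0 < R) (hp : p ∈ Metric.sphere c R)
    (hc : closure Ω ⊆ Metric.closedBall c R) :
    ‖gradient φ p‖⁻¹ • gradient φ p = R⁻¹ • (p - c) := by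
  set g := gradient φ p with hg
  have hg0 : g ≠ 0 := h.gradient_ne_zero
  have hgn : 0 < ‖g‖ := norm_pos_iff.2 hg0
  have hpc : ‖p - c‖ = R := by simpa [dist_eq_norm] using hp
  -- Directions entering Ω also enter the ball, so the open half-space of g lies in the closed
  -- half-space of p - c; two unit normals related in this way coincide.
  have key : ∀ u : V3, inner ℝ g u < 0 → inner ℝ (p - c) u ≤ 0 := by
    intro u hu
    have h1 : ∀ᶠ t : ℝ in 𝓝[>] 0, 2 * inner ℝ (p - c) u + t * ‖u‖ ^ 2 ≤ 0 := by
      filter_upwards [h.mem_of_inner_neg hu, self_mem_nhdsWithin] with t ht (h0 : 0 < t)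
      have h2 := hc (subset_closure ht)
      rw [mem_closedBall_iff_norm] at h2
      have h3 : ‖p - c + t • u‖ ^ 2 ≤ R ^ 2 := by
        have : p + t • u - c = p - c + t • u := by abel
        rw [this] at h2
        gcongr
      rw [norm_add_sq_real, hpc, inner_smul_right, norm_smul, Real.norm_of_nonneg h0.le] at h3
      have : t * (2 * inner ℝ (p - c) u + t * ‖u‖ ^ 2) ≤ 0 := by nlinarith
      exact nonpos_of_mul_nonpos_right this h0
    have h2 : Filter.Tendsto (fun t : ℝ => 2 * inner ℝ (p - c) u + t * ‖u‖ ^ 2) (𝓝[>] 0)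
        (𝓝 (2 * inner ℝ (p - c) u + 0 * ‖u‖ ^ 2)) := by
      have : Continuous (fun t : ℝ => 2 * inner ℝ (p - c) u + t * ‖u‖ ^ 2) := by fun_prop
      exact (this.tendsto 0).mono_left nhdsWithin_le_nhds
    have := le_of_tendsto h2 h1
    linarith
  set a := ‖g‖⁻¹ • g with ha
  set b := R⁻¹ • (p - c) with hb
  have han : ‖a‖ = 1 := by rw [ha, norm_smul, norm_inv, norm_norm]; field_simp
  have hbn : ‖b‖ = 1 := by
    rw [hb, norm_smul, norm_inv, hpc, Real.norm_of_nonneg hR.le]; field_simp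
  have key' : ∀ u : V3, inner ℝ a u < 0 → inner ℝ b u ≤ 0 := by
    intro u hu
    rw [ha, real_inner_smul_left] at hu
    rw [hb, real_inner_smul_left]
    have : inner ℝ g u < 0 := by
      by_contra h4
      exact absurd hu (not_lt.2 (mul_nonneg (inv_nonneg.2 hgn.le) (not_lt.1 h4)))
    exact mul_nonpos_of_nonneg_of_nonpos (inv_nonneg.2 hR.le) (key u this)
  have hle : inner ℝ a b ≤ 1 := by
    have := real_inner_le_norm a b
    rwa [han, hbn, one_mul] at this
  rcases hle.eq_or_lt with h1 | h1
  · exact (inner_eq_one_iff_of_norm_eq_one han hbn).1 h1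
  · exfalso
    -- For distinct unit vectors a and b, the test vector b - a has negative product with a and
    -- positive product with b.
    have h2 := key' (b - a) (by
      rw [inner_sub_right, real_inner_self_eq_norm_sq, han]; linarith)
    rw [inner_sub_right, real_inner_self_eq_norm_sq, hbn, real_inner_comm] at h2
    linarith

/-- The circumscribed ball pins down the normal of every defining function, so the chosen outward
normal is the radial direction of that ball. All later geometry uses only the resulting structure.
-/
theorem AssumptionOmega.uniformlyRound {Ω : Set V3} {R r : ℝ} (hΩ : AssumptionOmega Ω)
    (hR : IsCircumscribedRadius Ω R) (hr : IsInteriorRadius Ω r) :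
    UniformlyRound Ω (outwardNormal Ω) R r := by
  have hn : ∀ p ∈ frontier Ω, ∃ c, p ∈ Metric.sphere c R ∧ closure Ω ⊆ Metric.closedBall c R ∧
      outwardNormal Ω p = R⁻¹ • (p - c) := by
    intro p hp
    obtain ⟨c, hc1, hc2⟩ := hR.2 p hp
    refine ⟨c, hc1, hc2, ?_⟩
    obtain ⟨φ, hφ, -⟩ := hΩ.boundary p hp
    have : IsOutwardUnitNormal Ω p (outwardNormal Ω p) :=
      Classical.epsilon_spec (p := IsOutwardUnitNormal Ω p) ⟨_, φ, hφ, rfl⟩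
    obtain ⟨χ, hχ, h⟩ := this
    rw [h]
    exact hχ.normal_eq hR.1 hc1 hc2
  have hnorm : ∀ p ∈ frontier Ω, ‖outwardNormal Ω p‖ = 1 := by
    intro p hp
    obtain ⟨c, hc1, -, hc3⟩ := hn p hp
    have hpc : ‖p - c‖ = R := by simpa [dist_eq_norm] using hc1
    rw [hc3, norm_smul, norm_inv, hpc, Real.norm_of_nonneg hR.1.le]
    exact inv_mul_cancel₀ hR.1.ne'
  have houter : ∀ p ∈ frontier Ω, ∀ z ∈ closure Ω,
      ‖z - p‖ ^ 2 ≤ 2 * R * inner ℝ (outwardNormal Ω p) (p - z) := by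
    intro p hp z hz
    obtain ⟨c, hc1, hc2, hc3⟩ := hn p hp
    have hpc : ‖p - c‖ = R := by simpa [dist_eq_norm] using hc1
    have h2 := hc2 hz
    rw [mem_closedBall_iff_norm] at h2
    have h3 : ‖(p - c) - (p - z)‖ ^ 2 ≤ R ^ 2 := by
      have : (p - c) - (p - z) = z - c := by abel
      rw [this]; gcongr
    rw [norm_sub_sq_real, hpc] at h3
    have h4 : 2 * R * inner ℝ (outwardNormal Ω p) (p - z) = 2 * inner ℝ (p - c) (p - z) := by
      rw [hc3, real_inner_smul_left]; field_simp [hR.1.ne']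
    rw [h4, norm_sub_rev]
    linarith
  refine ⟨hΩ.isOpen, hΩ.isConnected.nonempty, hΩ.isBounded, hR.1, hr.1, hnorm, houter, ?_⟩
  intro p hp
  obtain ⟨c, hc1, hc2⟩ := hr.2 p hp
  have hpc : ‖p - c‖ = r := by simpa [dist_eq_norm] using hc1
  set n := outwardNormal Ω p
  have hn1 : ‖n‖ = 1 := hnorm p hp
  -- The point of the interior ball that is extreme in the direction n must stay in the supporting
  -- half-space at p. As ‖p - c‖ = r, this forces p - c = r n.
  have h1 : c + r • n ∈ closure Ω := hc2 (by
    simp [norm_smul, hn1, abs_of_pos hr.1])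
  have h2 := houter p hp _ h1
  have h3 : 0 ≤ inner ℝ n (p - (c + r • n)) := by
    by_contra h4
    have := mul_neg_of_pos_of_neg (mul_pos two_pos hR.1) (not_le.1 h4)
    nlinarith [sq_nonneg ‖c + r • n - p‖]
  have h4 : p - (c + r • n) = (p - c) - r • n := by abel
  rw [h4, inner_sub_right, inner_smul_right, real_inner_self_eq_norm_sq, hn1] at h3
  have h5 : ‖(p - c) - r • n‖ ^ 2 ≤ 0 := by
    rw [norm_sub_sq_real, hpc, inner_smul_right, norm_smul, hn1, Real.norm_of_nonneg hr.1.le,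
      real_inner_comm]
    nlinarith [hr.1]
  have h6 : (p - c) - r • n = 0 := by
    have : ‖(p - c) - r • n‖ = 0 := by nlinarith [norm_nonneg ((p - c) - r • n)]
    exact norm_eq_zero.1 this
  have h7 : p - r • n = c := by
    have := sub_eq_zero.1 h6
    rw [← this]; abel
  rw [h7]; exact hc2

namespace UniformlyRound

variable {Ω : Set V3} {n : V3 → V3} {R r : ℝ}

theorem inner_nonneg (h : UniformlyRound Ω n R r) {p z : V3} (hp : p ∈ frontier Ω)
    (hz : z ∈ closure Ω) : 0 ≤ inner ℝ (n p) (p - z) := by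
  have h1 := h.outer p hp z hz
  by_contra h2
  have := mul_neg_of_pos_of_neg (mul_pos two_pos h.pos_R) (not_le.1 h2)
  nlinarith [sq_nonneg ‖z - p‖]

theorem inner_pos (h : UniformlyRound Ω n R r) {p z : V3} (hp : p ∈ frontier Ω)
    (hz : z ∈ Ω) : 0 < inner ℝ (n p) (p - z) := by
  have h1 := h.outer p hp z (subset_closure hz)
  have h3 : z - p ≠ 0 := by
    intro h0
    have h4 : z = p := sub_eq_zero.1 h0
    rw [h.isOpen.frontier_eq] at hp
    exact hp.2 (h4 ▸ hz)
  have h5 : 0 < ‖z - p‖ ^ 2 := by positivity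
  have h6 := h.pos_R
  by_contra h2
  nlinarith

/-- A segment from a point of `Ω` to a point outside `Ω` meets the boundary: the first exit. -/
theorem exists_exit (h : UniformlyRound Ω n R r) {x v : V3} (hx : x ∈ Ω)
    (hv : ∃ s : ℝ, 0 ≤ s ∧ x - s • v ∉ Ω) :
    0 < exitTime Ω x v ∧ exitPoint Ω x v ∈ frontier Ω ∧
      (∀ s, 0 ≤ s → s < exitTime Ω x v → x - s • v ∈ Ω) := by
  set S := {s : ℝ | 0 ≤ s ∧ x - s • v ∈ Ωᶜ} with hS
  have hclosed : IsClosed S := by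
    have h1 : IsClosed {s : ℝ | x - s • v ∈ Ωᶜ} :=
      h.isOpen.isClosed_compl.preimage (f := fun s : ℝ => x - s • v) (by fun_prop)
    exact isClosed_Ici.inter h1
  have hne : S.Nonempty := hv
  have hbdd : BddBelow S := ⟨0, fun s hs => hs.1⟩
  have hmem : exitTime Ω x v ∈ S := hclosed.csInf_mem hne hbdd
  have hlt : ∀ s, 0 ≤ s → s < exitTime Ω x v → x - s • v ∈ Ω := by
    intro s hs0 hs
    by_contra hcon
    exact absurd (csInf_le hbdd (⟨hs0, hcon⟩ : s ∈ S)) (not_le.2 hs)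
  have hpos : 0 < exitTime Ω x v := by
    rcases hmem.1.eq_or_lt with h0 | h0
    · exfalso
      have := hmem.2
      rw [← h0] at this
      simp at this
      exact this hx
    · exact h0
  refine ⟨hpos, ?_, hlt⟩
  rw [h.isOpen.frontier_eq]
  refine ⟨?_, hmem.2⟩
  have hc : Filter.Tendsto (fun s : ℝ => x - s • v) (𝓝[<] (exitTime Ω x v))
      (𝓝 (x - exitTime Ω x v • v)) := by
    have : Continuous (fun s : ℝ => x - s • v) := by fun_prop
    exact (this.tendsto _).mono_left nhdsWithin_le_nhds
  refine mem_closure_of_tendsto hc ?_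
  filter_upwards [Ioo_mem_nhdsLT hpos] with s hs using hlt s hs.1.le hs.2

/-- If a segment from x to y left Ω, its first exit point p would be a convex combination of x and
y, although both lie strictly inside the supporting half-space at p. -/
theorem convex (h : UniformlyRound Ω n R r) : Convex ℝ Ω := by
  rw [convex_iff_segment_subset]
  intro x hx y hy z hz
  by_contra hcon
  rw [segment_eq_image_lineMap] at hz
  obtain ⟨t, ht, rfl⟩ := hz
  have e1 : AffineMap.lineMap x y t = x - t • (x - y) := by
    rw [AffineMap.lineMap_apply_module']
    rw [← neg_sub x y, smul_neg]; abel
  obtain ⟨h1, h2, h3⟩ := h.exists_exit (v := x - y) hx ⟨t, ht.1, by rwa [← e1]⟩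
  set τ := exitTime Ω x (x - y)
  have hτ : τ < 1 ∨ τ = 1 ∨ 1 < τ := lt_trichotomy _ _
  have hτ' : τ ≤ t := by
    by_contra h4
    exact hcon (e1 ▸ h3 t ht.1 (not_le.1 h4))
  have hτ1 : τ ≤ 1 := hτ'.trans ht.2
  have ix := h.inner_pos h2 hx
  have iy := h.inner_pos h2 hy
  set p := exitPoint Ω x (x - y) with hp
  have hp' : p = x - τ • (x - y) := rfl
  have : (1 - τ) * inner ℝ (n p) (p - x) + τ * inner ℝ (n p) (p - y) = 0 := by
    rw [← inner_smul_right, ← inner_smul_right, ← inner_add_right]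
    have : (1 - τ) • (p - x) + τ • (p - y) = 0 := by
      rw [hp']; module
    rw [this, inner_zero_right]
  nlinarith

theorem compl_nonempty (h : UniformlyRound Ω n R r) : Ωᶜ.Nonempty := by
  by_contra h1
  rw [not_nonempty_iff_eq_empty, compl_empty_iff] at h1
  have := h.isBounded
  rw [h1] at this
  exact NormedSpace.unbounded_univ ℝ V3 this

theorem exits (h : UniformlyRound Ω n R r) (x : V3) {v : V3} (hv : v ≠ 0) :
    ∃ s : ℝ, 0 ≤ s ∧ x - s • v ∉ Ω := by
  obtain ⟨D, hD⟩ := h.isBounded.subset_closedBall x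
  refine ⟨(|D| + 1) / ‖v‖, by positivity, fun hcon => ?_⟩
  have h1 := hD hcon
  rw [mem_closedBall_iff_norm] at h1
  have h2 : ‖x - ((|D| + 1) / ‖v‖) • v - x‖ = |D| + 1 := by
    rw [sub_sub_cancel_left, norm_neg, norm_smul, Real.norm_of_nonneg (by positivity)]
    field_simp
  rw [h2] at h1
  linarith [le_abs_self D]

theorem exitTime_pos (h : UniformlyRound Ω n R r) {x v : V3} (hx : x ∈ Ω) (hv : v ≠ 0) :
    0 < exitTime Ω x v := (h.exists_exit hx (h.exits x hv)).1

theorem exitPoint_mem (h : UniformlyRound Ω n R r) {x v : V3} (hx : x ∈ Ω) (hv : v ≠ 0) :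
    exitPoint Ω x v ∈ frontier Ω := (h.exists_exit hx (h.exits x hv)).2.1

theorem sub_smul_mem (h : UniformlyRound Ω n R r) {x v : V3} (hx : x ∈ Ω) (hv : v ≠ 0) {s : ℝ}
    (hs : 0 ≤ s) (hs' : s < exitTime Ω x v) : x - s • v ∈ Ω :=
  (h.exists_exit hx (h.exits x hv)).2.2 s hs hs'

theorem inner_exit {x v : V3} (hv : v ≠ 0) (t : ℝ) :
    inner ℝ (outwardNormal Ω (exitPoint Ω x v)) (-(t • v)) = t * (‖v‖ * exitCosine Ω x v) := by
  have hv' : ‖v‖ ≠ 0 := norm_ne_zero_iff.2 hv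
  rw [exitCosine, inner_neg_right, inner_smul_right, inner_smul_right]
  field_simp

theorem exitCosine_pos (h : UniformlyRound Ω (outwardNormal Ω) R r) {x v : V3} (hx : x ∈ Ω)
    (hv : v ≠ 0) : 0 < exitCosine Ω x v := by
  have h1 := h.inner_pos (h.exitPoint_mem hx hv) hx
  have h2 : exitPoint Ω x v - x = -(exitTime Ω x v • v) := by rw [exitPoint]; abel
  rw [h2, inner_exit hv] at h1
  have h3 := h.exitTime_pos hx hv
  have h4 := norm_pos_iff.2 hv
  exact (pos_iff_pos_of_mul_pos ((pos_iff_pos_of_mul_pos h1).1 h3)).1 h4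

theorem exitCosine_le_one (h : UniformlyRound Ω (outwardNormal Ω) R r) {x v : V3} (hx : x ∈ Ω)
    (hv : v ≠ 0) : exitCosine Ω x v ≤ 1 := by
  rw [exitCosine, ← inner_neg_right]
  refine (real_inner_le_norm _ _).trans ?_
  rw [h.norm_normal _ (h.exitPoint_mem hx hv), norm_neg, norm_smul, norm_inv, norm_norm,
    inv_mul_cancel₀ (norm_ne_zero_iff.2 hv), one_mul]

/-- The circumscribed ball at the exit point cuts the line in a chord of length 2R N. -/
theorem exitTime_mul_norm_le (h : UniformlyRound Ω (outwardNormal Ω) R r) {x v : V3} (hx : x ∈ Ω)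
    (hv : v ≠ 0) : exitTime Ω x v * ‖v‖ ≤ 2 * R * exitCosine Ω x v := by
  have h1 := h.outer _ (h.exitPoint_mem hx hv) x (subset_closure hx)
  have h2 : exitPoint Ω x v - x = -(exitTime Ω x v • v) := by rw [exitPoint]; abel
  have h3 := h.exitTime_pos hx hv
  have h4 := norm_pos_iff.2 hv
  rw [norm_sub_rev, h2, inner_exit hv, norm_neg, norm_smul, Real.norm_of_nonneg h3.le] at h1
  have h5 : 0 < exitTime Ω x v * ‖v‖ := by positivity
  nlinarith

theorem infDist_pos (h : UniformlyRound Ω n R r) {x : V3} (hx : x ∈ Ω) :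
    0 < Metric.infDist x Ωᶜ :=
  (h.isOpen.isClosed_compl.notMem_iff_infDist_pos h.compl_nonempty).1 (by simpa using hx)

/-- The projection of x onto the supporting plane at the exit point is outside Ω, at distance τ|v|N
from x; one factor N comes from this projection and the other from the chord length. -/
theorem infDist_le (h : UniformlyRound Ω (outwardNormal Ω) R r) {x v : V3} (hx : x ∈ Ω)
    (hv : v ≠ 0) : Metric.infDist x Ωᶜ ≤ 2 * R * exitCosine Ω x v ^ 2 := by
  have hp := h.exitPoint_mem hx hv
  have h0 := h.inner_pos hp hx
  have hn1 := h.norm_normal _ hp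
  have h2 : exitPoint Ω x v - x = -(exitTime Ω x v • v) := by rw [exitPoint]; abel
  have h3 := inner_exit (Ω := Ω) (x := x) hv (exitTime Ω x v)
  set p := exitPoint Ω x v with hpdef
  set m := outwardNormal Ω p with hm
  rw [← h2] at h3
  set a := inner ℝ m (p - x) with ha
  have hnot : x + a • m ∈ Ωᶜ := by
    intro hcon
    have h4 := h.inner_pos hp hcon
    have h5 : p - (x + a • m) = (p - x) - a • m := by abel
    rw [h5, inner_sub_right, inner_smul_right, real_inner_self_eq_norm_sq, hn1] at h4
    linarith
  have h6 := Metric.infDist_le_dist_of_mem (x := x) hnot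
  have h7 : dist x (x + a • m) = a := by
    rw [dist_eq_norm, sub_add_cancel_left, norm_neg, norm_smul, hn1, Real.norm_of_nonneg h0.le,
      mul_one]
  have h8 := h.exitTime_mul_norm_le hx hv
  have h9 := h.exitCosine_pos hx hv
  rw [h7, h3] at h6
  nlinarith

/-- The backward exit time is locally Lipschitz. -/
theorem exitTime_sub_le (h : UniformlyRound Ω (outwardNormal Ω) R r) {x v x' v' : V3}
    (hx : x ∈ Ω) (hv : v ≠ 0) (hx' : x' ∈ Ω) (hv' : v' ≠ 0) :
    (exitTime Ω x' v' - exitTime Ω x v) * (‖v‖ * exitCosine Ω x v) ≤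
      ‖x' - x‖ + exitTime Ω x' v' * ‖v' - v‖ := by
  have hp := h.exitPoint_mem hx hv
  have hp' := h.exitPoint_mem hx' hv'
  -- The exit point of the second trajectory lies in the supporting half-space at the exit point of
  -- the first. Expanding this single inequality gives the bound.
  have h1 := h.inner_nonneg hp (frontier_subset_closure hp')
  have hτ := (h.exitTime_pos hx' hv').le
  have h2 : exitPoint Ω x v - exitPoint Ω x' v'
      = -((x' - x) - exitTime Ω x' v' • (v' - v))
        - (-((exitTime Ω x' v' - exitTime Ω x v) • v)) := by
    rw [exitPoint, exitPoint]; module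
  rw [h2, inner_sub_right, inner_exit hv] at h1
  have h3 := real_inner_le_norm (outwardNormal Ω (exitPoint Ω x v))
    (-((x' - x) - exitTime Ω x' v' • (v' - v)))
  rw [h.norm_normal _ hp, one_mul, norm_neg] at h3
  have h4 := norm_sub_le (x' - x) (exitTime Ω x' v' • (v' - v))
  rw [norm_smul, Real.norm_of_nonneg hτ] at h4
  linarith

theorem exitTime_le (h : UniformlyRound Ω (outwardNormal Ω) R r) {x v : V3} (hx : x ∈ Ω)
    (hv : v ≠ 0) : exitTime Ω x v ≤ 2 * R / ‖v‖ := by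
  rw [le_div_iff₀ (norm_pos_iff.2 hv)]
  have h1 := h.exitTime_mul_norm_le hx hv
  have h2 := h.exitCosine_le_one hx hv
  nlinarith [h.pos_R]

/-- Bound of `1 / N` by the distance to the boundary. -/
theorem inv_exitCosine_le (h : UniformlyRound Ω (outwardNormal Ω) R r) {x v : V3} (hx : x ∈ Ω)
    (hv : v ≠ 0) : (exitCosine Ω x v)⁻¹ ≤ √(2 * R / Metric.infDist x Ωᶜ) := by
  apply Real.le_sqrt_of_sq_le
  have h1 := h.infDist_le hx hv
  have h2 := h.infDist_pos hx
  have h3 := h.exitCosine_pos hx hv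
  rw [le_div_iff₀ h2, inv_pow, inv_mul_le_iff₀ (by positivity)]
  linarith

/-- The interior ball at p contains the point p - r n(p) + r n(q), which must lie in the supporting
half-space at q. This Hölder bound of exponent 1/2 suffices for the continuity of the weight. -/
theorem normal_sub_sq_le (h : UniformlyRound Ω n R r) {p q : V3} (hp : p ∈ frontier Ω)
    (hq : q ∈ frontier Ω) : ‖n p - n q‖ ^ 2 ≤ 2 / r * ‖p - q‖ := by
  have hr := h.pos_r
  have np := h.norm_normal p hp
  have nq := h.norm_normal q hq
  have h1 : p - r • n p + r • n q ∈ closure Ω := by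
    apply h.inner_ball p hp
    rw [mem_closedBall_iff_norm, add_sub_cancel_left, norm_smul, nq, Real.norm_of_nonneg hr.le,
      mul_one]
  have h2 := h.inner_nonneg hq h1
  have h3 : q - (p - r • n p + r • n q) = -(p - q) + r • n p - r • n q := by abel
  rw [h3, inner_sub_right, inner_add_right, inner_smul_right, inner_smul_right,
    real_inner_self_eq_norm_sq, nq] at h2
  have h4 := real_inner_le_norm (n q) (-(p - q))
  rw [nq, one_mul, norm_neg] at h4
  rw [norm_sub_sq_real, np, nq, real_inner_comm, div_mul_eq_mul_div, le_div_iff₀ hr]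
  nlinarith

end UniformlyRound

end

/-! ### Continuity of exit time and weight; distance to the boundary along chords. -/

section

namespace UniformlyRound

variable {Ω : Set V3} {n : V3 → V3} {R r : ℝ}

theorem isOpen_prod (h : UniformlyRound Ω n R r) : IsOpen (Ω ×ˢ ({0}ᶜ : Set V3)) :=
  h.isOpen.prod isOpen_compl_singleton

theorem continuousOn_exitTime (h : UniformlyRound Ω (outwardNormal Ω) R r) :
    ContinuousOn (fun z : V3 × V3 => exitTime Ω z.1 z.2) (Ω ×ˢ {0}ᶜ) := by
  rintro ⟨x, v⟩ ⟨hx, hv⟩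
  have hx : x ∈ Ω := hx
  have hv : v ≠ 0 := hv
  have hnv := norm_pos_iff.2 hv
  apply ContinuousAt.continuousWithinAt
  have hN := h.exitCosine_pos hx hv
  have hd := h.infDist_pos hx
  -- The sum of the bounds for the two signs of the difference. In the second, 1/N at the moving
  -- point is replaced by its bound in terms of the distance to the boundary, which is already known
  -- to be continuous.
  set g : V3 × V3 → ℝ := fun z => (‖z.1 - x‖ + 2 * R / ‖z.2‖ * ‖z.2 - v‖) /
      (‖v‖ * exitCosine Ω x v) + (‖x - z.1‖ + exitTime Ω x v * ‖v - z.2‖) *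
        (‖z.2‖⁻¹ * √(2 * R / Metric.infDist z.1 Ωᶜ)) with hg
  have hgc : ContinuousAt g (x, v) := by
    have hc : Continuous fun z : V3 × V3 => Metric.infDist z.1 Ωᶜ :=
      (Metric.continuous_infDist_pt Ωᶜ).comp continuous_fst
    have h1 : ContinuousAt (fun z : V3 × V3 => 2 * R / Metric.infDist z.1 Ωᶜ) (x, v) :=
      continuousAt_const.div hc.continuousAt hd.ne'
    have h2 : ContinuousAt (fun z : V3 × V3 => ‖z.2‖⁻¹) (x, v) :=
      (continuous_snd.norm.continuousAt).inv₀ hnv.ne'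
    have h3 : ContinuousAt (fun z : V3 × V3 => 2 * R / ‖z.2‖) (x, v) :=
      continuousAt_const.div continuous_snd.norm.continuousAt hnv.ne'
    exact ((by fun_prop : ContinuousAt (fun z : V3 × V3 => ‖z.1 - x‖) (x, v)).add
      (h3.mul (by fun_prop))).div_const _ |>.add ((by fun_prop : ContinuousAt
        (fun z : V3 × V3 => ‖x - z.1‖ + exitTime Ω x v * ‖v - z.2‖) (x, v)).mul
        (h2.mul (Real.continuous_sqrt.continuousAt.comp h1)))
  have hg0 : g (x, v) = 0 := by simp [hg]
  have hlim : Filter.Tendsto g (𝓝 (x, v)) (𝓝 0) := hg0 ▸ hgc.tendsto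
  rw [ContinuousAt, tendsto_iff_dist_tendsto_zero]
  refine squeeze_zero' (Filter.Eventually.of_forall fun _ => dist_nonneg) ?_ hlim
  filter_upwards [h.isOpen_prod.mem_nhds (⟨hx, hv⟩ : (x, v) ∈ Ω ×ˢ ({0}ᶜ : Set V3))]
    with ⟨x', v'⟩ ⟨hx', hv'⟩
  have hx' : x' ∈ Ω := hx'
  have hv' : v' ≠ 0 := hv'
  have hnv' := norm_pos_iff.2 hv'
  have hN' := h.exitCosine_pos hx' hv'
  have a1 := h.exitTime_sub_le hx hv hx' hv'
  have a2 := h.exitTime_sub_le hx' hv' hx hv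
  have a3 := h.exitTime_le hx' hv'
  have a4 := h.inv_exitCosine_le hx' hv'
  have hR := h.pos_R
  have hτ := h.exitTime_pos hx hv
  have b1 : exitTime Ω x' v' - exitTime Ω x v ≤ (‖x' - x‖ + 2 * R / ‖v'‖ * ‖v' - v‖) /
      (‖v‖ * exitCosine Ω x v) := by
    rw [le_div_iff₀ (by positivity)]
    refine a1.trans ?_
    gcongr
  have b2 : exitTime Ω x v - exitTime Ω x' v' ≤ (‖x - x'‖ + exitTime Ω x v * ‖v - v'‖) *
        (‖v'‖⁻¹ * √(2 * R / Metric.infDist x' Ωᶜ)) := by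
    refine le_trans ?_ (mul_le_mul_of_nonneg_left (mul_le_mul_of_nonneg_left a4
      (inv_nonneg.2 (norm_nonneg v'))) (by positivity))
    rw [← mul_inv, ← div_eq_mul_inv, le_div_iff₀ (by positivity)]
    exact a2
  have c1 : 0 ≤ (‖x' - x‖ + 2 * R / ‖v'‖ * ‖v' - v‖) / (‖v‖ * exitCosine Ω x v) := by positivity
  have c2 : 0 ≤ (‖x - x'‖ + exitTime Ω x v * ‖v - v'‖) *
        (‖v'‖⁻¹ * √(2 * R / Metric.infDist x' Ωᶜ)) := by positivity
  rw [Real.dist_eq, abs_le]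
  constructor <;> simp only [hg] <;> linarith

theorem continuousOn_normal (h : UniformlyRound Ω n R r) : ContinuousOn n (frontier Ω) := by
  intro p hp
  rw [ContinuousWithinAt, tendsto_iff_norm_sub_tendsto_zero]
  have h1 : Filter.Tendsto (fun q => √(2 / r * ‖q - p‖)) (𝓝[frontier Ω] p) (𝓝 0) := by
    have : Continuous fun q : V3 => √(2 / r * ‖q - p‖) := by fun_prop
    have h2 := (this.tendsto p).mono_left (nhdsWithin_le_nhds (s := frontier Ω))
    simpa using h2
  refine squeeze_zero' (Filter.Eventually.of_forall fun _ => norm_nonneg _) ?_ h1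
  filter_upwards [self_mem_nhdsWithin] with q hq
  exact Real.le_sqrt_of_sq_le (h.normal_sub_sq_le hq hp)

theorem continuousOn_exitCosine (h : UniformlyRound Ω (outwardNormal Ω) R r) :
    ContinuousOn (fun z : V3 × V3 => exitCosine Ω z.1 z.2) (Ω ×ˢ {0}ᶜ) := by
  have h1 : ContinuousOn (fun z : V3 × V3 => exitPoint Ω z.1 z.2) (Ω ×ˢ {0}ᶜ) :=
    continuousOn_fst.sub (h.continuousOn_exitTime.smul continuousOn_snd)
  have h2 : ContinuousOn (fun z : V3 × V3 => outwardNormal Ω (exitPoint Ω z.1 z.2)) (Ω ×ˢ {0}ᶜ) :=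
    h.continuousOn_normal.comp h1 fun z hz => h.exitPoint_mem hz.1 hz.2
  have h3 : ContinuousOn (fun z : V3 × V3 => ‖z.2‖⁻¹ • z.2) (Ω ×ˢ ({0}ᶜ : Set V3)) :=
    (continuousOn_snd.norm.inv₀ fun z hz => norm_ne_zero_iff.2 hz.2).smul continuousOn_snd
  exact (h2.inner h3).neg

theorem continuousOn_weight (h : UniformlyRound Ω (outwardNormal Ω) R r) :
    ContinuousOn (weight Ω) (Ω ×ˢ {0}ᶜ) :=
  (continuousOn_snd.norm.div (continuousOn_snd.norm.add continuousOn_const)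
    fun z _ => (by positivity : ‖z.2‖ + 1 ≠ 0)).mul h.continuousOn_exitCosine

theorem weight_pos (h : UniformlyRound Ω (outwardNormal Ω) R r) {z : V3 × V3}
    (hz : z ∈ Ω ×ˢ ({0}ᶜ : Set V3)) : 0 < weight Ω z := by
  have h1 := h.exitCosine_pos hz.1 hz.2
  have h2 : 0 < ‖z.2‖ := norm_pos_iff.2 hz.2
  rw [weight]
  positivity

theorem inv_weight_le (h : UniformlyRound Ω (outwardNormal Ω) R r) {z : V3 × V3}
    (hz : z ∈ Ω ×ˢ ({0}ᶜ : Set V3)) :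
    (weight Ω z)⁻¹ ≤ (1 + ‖z.2‖⁻¹) * √(2 * R / Metric.infDist z.1 Ωᶜ) := by
  have h1 := h.inv_exitCosine_le hz.1 hz.2
  have h2 : 0 < ‖z.2‖ := norm_pos_iff.2 hz.2
  rw [weight, mul_inv, inv_div]
  have : (‖z.2‖ + 1) / ‖z.2‖ = 1 + ‖z.2‖⁻¹ := by field_simp
  rw [this]
  gcongr

theorem exitTime_sub_smul (h : UniformlyRound Ω n R r) {x v : V3} (hx : x ∈ Ω)
    (hv : v ≠ 0) {s : ℝ} (hs : 0 ≤ s) (hs' : s < exitTime Ω x v) :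
    exitTime Ω (x - s • v) v = exitTime Ω x v - s := by
  have hy := h.sub_smul_mem hx hv hs hs'
  have e : ∀ t : ℝ, x - s • v - t • v = x - (s + t) • v := fun t => by module
  have hp := h.exitPoint_mem hx hv
  rw [h.isOpen.frontier_eq] at hp
  have hp' := h.exitPoint_mem hy hv
  rw [h.isOpen.frontier_eq] at hp'
  apply le_antisymm
  · apply csInf_le ⟨0, fun t ht => ht.1⟩
    refine ⟨by linarith, ?_⟩
    rw [e, add_sub_cancel]
    exact hp.2
  · rw [sub_le_iff_le_add']
    apply csInf_le ⟨0, fun t ht => ht.1⟩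
    refine ⟨add_nonneg hs (h.exitTime_pos hy hv).le, ?_⟩
    rw [← e]
    exact hp'.2

/-- The weight depends only on v and on the exit point, and all points of a backward characteristic
in Ω share the same exit point. -/
theorem weight_sub_smul (h : UniformlyRound Ω n R r) {x v : V3} (hx : x ∈ Ω)
    (hv : v ≠ 0) {s : ℝ} (hs : 0 ≤ s) (hs' : s < exitTime Ω x v) :
    weight Ω (x - s • v, v) = weight Ω (x, v) := by
  have : exitPoint Ω (x - s • v) v = exitPoint Ω x v := by
    rw [exitPoint, exitPoint, h.exitTime_sub_smul hx hv hs hs']; module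
  simp only [weight, exitCosine, this]

/-- The distance to the boundary is quasiconcave. -/
theorem le_infDist_segment (h : UniformlyRound Ω n R r) {x y z : V3} {d : ℝ}
    (hx : d ≤ Metric.infDist x Ωᶜ) (hy : d ≤ Metric.infDist y Ωᶜ)
    (hz : z ∈ segment ℝ x y) : d ≤ Metric.infDist z Ωᶜ := by
  rw [Metric.le_infDist h.compl_nonempty] at *
  intro w hw
  by_contra hcon
  rw [not_le] at hcon
  have b : ∀ x : V3, (∀ ⦃y : V3⦄, y ∈ Ωᶜ → d ≤ dist x y) → x + (w - z) ∈ Ω := by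
    intro x hx
    by_contra h1
    have := hx h1
    rw [dist_eq_norm, sub_add_cancel_left, norm_neg, ← dist_eq_norm, dist_comm] at this
    linarith
  have h1 := b x hx
  have h2 := b y hy
  obtain ⟨s, t, hs, ht, hst, rfl⟩ := hz
  have h3 := h.convex h1 h2 hs ht hst
  apply hw
  convert h3 using 1
  have : s • (x + (w - (s • x + t • y))) + t • (y + (w - (s • x + t • y)))
    = s • x + t • y + (s + t) • (w - (s • x + t • y)) := by module
  rw [this, hst, one_smul]
  abel

/-- At each boundary point p the quadratic support inequality holds at both ends of the chord.
Averaging it with the weights of the intermediate point leaves, besides the squared distance to p,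
the surplus s(τ - s)|v|². -/
theorem le_infDist_chord (h : UniformlyRound Ω n R r) {x v : V3} (hx : x ∈ Ω)
    (hv : v ≠ 0) {s : ℝ} (hs : 0 ≤ s) (hs' : s < exitTime Ω x v) :
    s * (exitTime Ω x v - s) * ‖v‖ ^ 2 / (2 * R) ≤ Metric.infDist (x - s • v) Ωᶜ := by
  have hy := h.sub_smul_mem hx hv hs hs'
  set τ := exitTime Ω x v with hτ
  have hR := h.pos_R
  have hτ0 : 0 < τ := h.exitTime_pos hx hv
  rw [Metric.le_infDist h.compl_nonempty]
  -- The segment to a point outside Ω meets the boundary no later than its endpoint, so only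
  -- boundary points need to be tested.
  suffices hfr : ∀ p ∈ frontier Ω, s * (τ - s) * ‖v‖ ^ 2 / (2 * R) ≤ dist (x - s • v) p by
    intro w hw
    have hex : ∃ t : ℝ, 0 ≤ t ∧ (x - s • v) - t • ((x - s • v) - w) ∉ Ω :=
      ⟨1, zero_le_one, by rw [one_smul, sub_sub_cancel]; exact hw⟩
    obtain ⟨h1, h2, h3⟩ := h.exists_exit hy hex
    refine (hfr _ h2).trans ?_
    have h4 : exitTime Ω (x - s • v) ((x - s • v) - w) ≤ 1 :=
      csInf_le ⟨0, fun t ht => ht.1⟩ ⟨zero_le_one, by rw [one_smul, sub_sub_cancel]; exact hw⟩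
    rw [dist_eq_norm, exitPoint, sub_sub_cancel, norm_smul, Real.norm_of_nonneg h1.le,
      dist_eq_norm]
    exact mul_le_of_le_one_left (norm_nonneg _) h4
  intro p hp
  have hq : x - τ • v ∈ closure Ω := frontier_subset_closure (h.exitPoint_mem hx hv)
  have i1 := h.outer p hp x (subset_closure hx)
  have i2 := h.outer p hp _ hq
  have i3 := real_inner_le_norm (n p) (p - (x - s • v))
  rw [h.norm_normal p hp, one_mul] at i3
  rw [dist_comm, dist_eq_norm]
  refine le_trans ?_ i3
  rw [div_le_iff₀ (by positivity)]
  have e1 : τ * inner ℝ (n p) (p - (x - s • v)) = (τ - s) * inner ℝ (n p) (p - x) +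
      s * inner ℝ (n p) (p - (x - τ • v)) := by
    rw [← inner_smul_right, ← inner_smul_right, ← inner_smul_right, ← inner_add_right]
    congr 1
    module
  -- Stewart's identity for the triangle formed by p and the two ends of the chord.
  have e2 : (τ - s) * ‖x - p‖ ^ 2 + s * ‖x - τ • v - p‖ ^ 2
      = τ * ‖x - s • v - p‖ ^ 2 + τ * (s * (τ - s) * ‖v‖ ^ 2) := by
    have a1 : x - τ • v - p = (x - p) - τ • v := by abel
    have a2 : x - s • v - p = (x - p) - s • v := by abel
    rw [a1, a2, norm_sub_sq_real (x - p), norm_sub_sq_real (x - p), inner_smul_right, inner_smul_right, norm_smul,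
      norm_smul, Real.norm_of_nonneg hτ0.le, Real.norm_of_nonneg hs]
    ring
  have i4 : τ * (s * (τ - s) * ‖v‖ ^ 2) ≤ τ * (inner ℝ (n p) (p - (x - s • v)) * (2 * R)) := by
    have j1 := mul_le_mul_of_nonneg_left i1 (sub_nonneg.2 hs'.le)
    have j2 := mul_le_mul_of_nonneg_left i2 hs
    have j3 : 0 ≤ τ * ‖x - s • v - p‖ ^ 2 := by positivity
    nlinarith
  exact le_of_mul_le_mul_left i4 hτ0

theorem one_le_sqrt (h : UniformlyRound Ω (outwardNormal Ω) R r) {x : V3} (hx : x ∈ Ω) :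
    1 ≤ √(2 * R / Metric.infDist x Ωᶜ) := by
  obtain ⟨v, hv⟩ := exists_ne (0 : V3)
  have h1 := h.inv_exitCosine_le hx hv
  have h2 := h.exitCosine_le_one hx hv
  have h3 := h.exitCosine_pos hx hv
  exact (one_le_inv_iff₀.2 ⟨h3, h2⟩).trans h1

/-- The antipode of p in the interior ball is tested in the circumscribed ball at p. -/
theorem interior_le (h : UniformlyRound Ω n R r) : r ≤ R := by
  obtain ⟨x, hx⟩ := h.nonempty
  obtain ⟨v, hv⟩ := exists_ne (0 : V3)
  have hp := h.exitPoint_mem hx hv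
  set p := exitPoint Ω x v
  have hn := h.norm_normal p hp
  have hr := h.pos_r
  have h1 : p - (2 * r) • n p ∈ closure Ω := by
    apply h.inner_ball p hp
    rw [mem_closedBall_iff_norm]
    have : p - (2 * r) • n p - (p - r • n p) = -(r • n p) := by module
    rw [this, norm_neg, norm_smul, hn, Real.norm_of_nonneg hr.le, mul_one]
  have h2 := h.outer p hp _ h1
  rw [sub_sub_cancel_left, norm_neg, sub_sub_cancel, norm_smul, hn, inner_smul_right,
    real_inner_self_eq_norm_sq, hn, Real.norm_of_nonneg (by positivity)] at h2
  nlinarith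

/-- Converts the estimate, which is proved with the constant 1 + R, into the form with both radii.
-/
theorem radius_le (h : UniformlyRound Ω n R r) : R ≤ √(R * r) * (1 + R / r) := by
  have hr := h.pos_r
  have hR := h.pos_R
  have h1 := h.interior_le
  have h2 : r ≤ √(R * r) := Real.le_sqrt_of_sq_le (by nlinarith)
  calc R = r * (R / r) := by field_simp
    _ ≤ √(R * r) * (1 + R / r) := by gcongr; linarith

/-- The integral of the inverse square root of the distance to the boundary along a chord. -/
theorem integral_chord_le (h : UniformlyRound Ω n R r) {x v : V3} (hx : x ∈ Ω) (hv : v ≠ 0) :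
    IntervalIntegrable (fun s => √(2 * R / Metric.infDist (x - s • v) Ωᶜ)) volume
      0 (exitTime Ω x v) ∧
    ∫ s in (0 : ℝ)..exitTime Ω x v, √(2 * R / Metric.infDist (x - s • v) Ωᶜ)
      ≤ 16 * R / ‖v‖ := by
  set τ := exitTime Ω x v with hτ
  have hτ0 : 0 < τ := h.exitTime_pos hx hv
  have hR := h.pos_R
  have hnv := norm_pos_iff.2 hv
  -- Splitting 1/(s(τ - s)) into partial fractions produces τ^{-1/2}; each of the two integrals of
  -- inverse square roots equals 2√τ, so the final bound does not depend on τ.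
  set c := 2 * R / ‖v‖ * √(2 / τ) with hc
  set g : ℝ → ℝ := fun s => c * (s ^ (-(1 / 2) : ℝ) + (τ - s) ^ (-(1 / 2) : ℝ)) with hg
  have i1 : IntervalIntegrable (fun s : ℝ => s ^ (-(1 / 2) : ℝ)) volume 0 τ :=
    intervalIntegral.intervalIntegrable_rpow' (by norm_num)
  have i2 : IntervalIntegrable (fun s : ℝ => (τ - s) ^ (-(1 / 2) : ℝ)) volume 0 τ := by
    have := (i1.comp_sub_left τ).symm
    simpa using this
  have ig : IntervalIntegrable g volume 0 τ := (i1.add i2).const_mul c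
  have hvg : ∫ s in (0 : ℝ)..τ, g s = c * (4 * √τ) := by
    have e1 : ∫ s in (0 : ℝ)..τ, s ^ (-(1 / 2) : ℝ) = 2 * √τ := by
      rw [integral_rpow (Or.inl (by norm_num)), Real.sqrt_eq_rpow]
      norm_num
      ring
    have e2 : ∫ s in (0 : ℝ)..τ, (τ - s) ^ (-(1 / 2) : ℝ) = 2 * √τ := by
      rw [intervalIntegral.integral_comp_sub_left (fun s : ℝ => s ^ (-(1 / 2) : ℝ)), ← e1]
      simp
    rw [hg, intervalIntegral.integral_const_mul, intervalIntegral.integral_add i1 i2, e1, e2]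
    ring
  have hle : ∀ s ∈ Ioo 0 τ, √(2 * R / Metric.infDist (x - s • v) Ωᶜ) ≤ g s := by
    intro s hs
    have h1 := h.le_infDist_chord hx hv hs.1.le hs.2
    rw [← hτ] at h1
    have hs0 := hs.1
    have hs1 : 0 < τ - s := sub_pos.2 hs.2
    have h2 : 2 * R / Metric.infDist (x - s • v) Ωᶜ ≤ (2 * R / ‖v‖) ^ 2 * (s * (τ - s))⁻¹ := by
      refine (div_le_div_of_nonneg_left (by positivity) (by positivity) h1).trans (le_of_eq ?_)
      field_simp
    have h3 : (s * (τ - s))⁻¹ ≤ 2 / τ * (s⁻¹ + (τ - s)⁻¹) := by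
      have : s⁻¹ + (τ - s)⁻¹ = τ * (s * (τ - s))⁻¹ := by field_simp; ring
      rw [this]
      have h5 : 0 < (s * (τ - s))⁻¹ := by positivity
      have : 2 / τ * (τ * (s * (τ - s))⁻¹) = 2 * (s * (τ - s))⁻¹ := by field_simp
      linarith
    refine (Real.sqrt_le_sqrt (h2.trans (mul_le_mul_of_nonneg_left h3 (sq_nonneg _)))).trans ?_
    rw [Real.sqrt_mul (sq_nonneg _), Real.sqrt_sq (by positivity), Real.sqrt_mul (by positivity),
      ← mul_assoc, hg, hc]
    have h6 : ∀ t : ℝ, 0 < t → t ^ (-(1 / 2) : ℝ) = √(t⁻¹) := by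
      intro t ht
      rw [Real.rpow_neg ht.le, ← Real.sqrt_eq_rpow, Real.sqrt_inv]
    simp only [h6 s hs0, h6 _ hs1]
    gcongr
    rw [Real.sqrt_le_iff]
    refine ⟨by positivity, ?_⟩
    rw [add_sq, Real.sq_sqrt (by positivity), Real.sq_sqrt (by positivity)]
    have : 0 ≤ 2 * √s⁻¹ * √(τ - s)⁻¹ := by positivity
    linarith
  have hmeas : Measurable fun s : ℝ => √(2 * R / Metric.infDist (x - s • v) Ωᶜ) := by
    have h1 : Continuous fun s : ℝ => Metric.infDist (x - s • v) Ωᶜ :=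
      (Metric.continuous_infDist_pt Ωᶜ).comp (by fun_prop)
    exact (h1.measurable.const_div _).sqrt
  have hae : ∀ᵐ s ∂volume.restrict (uIoc 0 τ), s ∈ Ioo 0 τ := by
    rw [uIoc_of_le hτ0.le, ← Measure.restrict_congr_set Ioo_ae_eq_Ioc]
    exact ae_restrict_mem measurableSet_Ioo
  have iint : IntervalIntegrable (fun s => √(2 * R / Metric.infDist (x - s • v) Ωᶜ)) volume
      0 τ := by
    refine ig.mono_fun hmeas.aestronglyMeasurable ?_
    filter_upwards [hae] with s hs
    rw [Real.norm_of_nonneg (Real.sqrt_nonneg _)]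
    exact (hle s hs).trans (le_abs_self _)
  refine ⟨iint, ?_⟩
  refine (intervalIntegral.integral_mono_on_of_le_Ioo hτ0.le iint ig hle).trans ?_
  rw [hvg, hc]
  have : √(2 / τ) * √τ = √2 := by
    rw [← Real.sqrt_mul (by positivity)]
    congr 1
    field_simp
  calc 2 * R / ‖v‖ * √(2 / τ) * (4 * √τ) = 8 * R / ‖v‖ * (√(2 / τ) * √τ) := by ring
    _ ≤ 8 * R / ‖v‖ * 2 := by
      rw [this]
      gcongr
      rw [Real.sqrt_le_iff]; norm_num
    _ = 16 * R / ‖v‖ := by ring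

end UniformlyRound

end

/-! ### The angular measure, spherical coordinates and independence of the frame. -/

section

/-- The measure `sin θ cos θ dθ dϕ` on `(ϕ, θ) ∈ (0, 2π] × (0, π/2]`. -/
def angleMeasure : Measure (ℝ × ℝ) :=
  ((volume.restrict (Ioc 0 (2 * Real.pi))).prod
    (volume.restrict (Ioc 0 (Real.pi / 2)))).withDensity
      fun p => ENNReal.ofReal (Real.sin p.2 * Real.cos p.2)

/-- The unit vector with polar angle `2θ` and azimuth `ϕ` in the frame `b`. -/
def sphereVec (b : OrthonormalBasis (Fin 3) ℝ V3) (p : ℝ × ℝ) : V3 :=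
  Real.cos (2 * p.2) • b 0 + (Real.sin (2 * p.2) * Real.cos p.1) • b 1
    + (Real.sin (2 * p.2) * Real.sin p.1) • b 2

/-- The image on the unit sphere of `sin θ cos θ dθ dϕ`. -/
def scatterMeasure : Measure V3 :=
  angleMeasure.map (sphereVec (EuclideanSpace.basisFun (Fin 3) ℝ))

theorem continuous_sphereVec (b : OrthonormalBasis (Fin 3) ℝ V3) : Continuous (sphereVec b) := by
  unfold sphereVec; fun_prop

theorem norm_combination_sq (b : OrthonormalBasis (Fin 3) ℝ V3) (x y z : ℝ) :
    ‖x • b 0 + y • b 1 + z • b 2‖ ^ 2 = x ^ 2 + y ^ 2 + z ^ 2 := by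
  have h := b.sum_sq_norm_inner_right (x • b 0 + y • b 1 + z • b 2)
  rw [← h, Fin.sum_univ_three]
  have o := b.orthonormal
  have n : ∀ i, inner ℝ (b i) (b i) = (1 : ℝ) := fun i => by
    rw [real_inner_self_eq_norm_sq, o.1 i]; norm_num
  have h01 := o.2 (show (0 : Fin 3) ≠ 1 by decide)
  have h02 := o.2 (show (0 : Fin 3) ≠ 2 by decide)
  have h12 := o.2 (show (1 : Fin 3) ≠ 2 by decide)
  have h10 := o.2 (show (1 : Fin 3) ≠ 0 by decide)
  have h20 := o.2 (show (2 : Fin 3) ≠ 0 by decide)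
  have h21 := o.2 (show (2 : Fin 3) ≠ 1 by decide)
  simp only [inner_add_right, inner_smul_right, n, h01, h02, h12, h10, h20, h21]
  simp

theorem norm_sphereVec (b : OrthonormalBasis (Fin 3) ℝ V3) (p : ℝ × ℝ) : ‖sphereVec b p‖ = 1 := by
  have h := norm_combination_sq b (Real.cos (2 * p.2)) (Real.sin (2 * p.2) * Real.cos p.1)
    (Real.sin (2 * p.2) * Real.sin p.1)
  have h2 : ‖sphereVec b p‖ ^ 2 = 1 := by
    rw [sphereVec, h]
    linear_combination Real.sin_sq_add_cos_sq (2 * p.2) +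
      Real.sin (2 * p.2) ^ 2 * Real.sin_sq_add_cos_sq p.1
  nlinarith [norm_nonneg (sphereVec b p)]

theorem lintegral_angleMeasure {g : ℝ × ℝ → ℝ≥0∞} (hg : Measurable g) :
    ∫⁻ p, g p ∂angleMeasure = ∫⁻ ϕ in Ioc 0 (2 * Real.pi), ∫⁻ θ in Ioc 0 (Real.pi / 2),
      ENNReal.ofReal (Real.sin θ * Real.cos θ) * g (ϕ, θ) := by
  have hm : Measurable fun p : ℝ × ℝ => ENNReal.ofReal (Real.sin p.2 * Real.cos p.2) := by fun_prop
  rw [angleMeasure, lintegral_withDensity_eq_lintegral_mul _ hm hg, lintegral_prod]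
  · rfl
  · exact (hm.mul hg).aemeasurable

theorem lintegral_polar {k : ℝ × ℝ → ℝ≥0∞} (hk : Measurable k) :
    ∫⁻ p, k p = ∫⁻ s in Ioi (0 : ℝ), ∫⁻ ϕ in Ioc 0 (2 * Real.pi),
      ENNReal.ofReal s * k (s * Real.cos ϕ, s * Real.sin ϕ) := by
  -- `polarCoord` has angles in (-π, π); the reflection p ↦ -p shifts them by π, into (0, 2π).
  have h1 : ∫⁻ p, k p = ∫⁻ p : ℝ × ℝ, k (-p) := by
    rw [lintegral_neg_eq_self]
  rw [h1, ← lintegral_comp_polarCoord_symm, polarCoord_target, Measure.volume_eq_prod,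
    ← Measure.prod_restrict, lintegral_prod]
  · congr 1
    ext s
    have e : ∀ ϕ : ℝ, ENNReal.ofReal (s, ϕ).1 • k (-(polarCoord.symm (s, ϕ)))
        = ENNReal.ofReal s * k (s * Real.cos (ϕ + Real.pi), s * Real.sin (ϕ + Real.pi)) := by
      intro ϕ
      simp [polarCoord_symm_apply, Real.cos_add_pi, Real.sin_add_pi]
    simp only [e]
    have hp : MeasurePreserving (fun ϕ : ℝ => ϕ + Real.pi) volume volume :=
      measurePreserving_add_right volume Real.pi
    have he : MeasurableEmbedding (fun ϕ : ℝ => ϕ + Real.pi) :=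
      (Homeomorph.addRight Real.pi).measurableEmbedding
    have := hp.setLIntegral_comp_preimage_emb he
      (fun ϕ => ENNReal.ofReal s * k (s * Real.cos ϕ, s * Real.sin ϕ)) (Ioo 0 (2 * Real.pi))
    rw [preimage_add_const_Ioo, zero_sub, two_mul, add_sub_cancel_right] at this
    rw [this, ← two_mul, setLIntegral_congr Ioo_ae_eq_Ioc]
  · have hc : Measurable fun p : ℝ × ℝ => polarCoord.symm p := by
      simp only [polarCoord_symm_apply]; fun_prop
    exact ((ENNReal.measurable_ofReal.comp measurable_fst).mul
      (hk.comp hc.neg)).aemeasurable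

/-- Polar coordinates in the upper half-plane, whose angle ranges over (0, π); writing it as 2θ
gives the factor 2 and the range of the scattering angle. -/
theorem lintegral_half_polar {k : ℝ × ℝ → ℝ≥0∞} (hk : Measurable k) :
    ∫⁻ x, ∫⁻ s in Ioi (0 : ℝ), k (x, s) = ∫⁻ ρ in Ioi (0 : ℝ), ∫⁻ θ in Ioc 0 (Real.pi / 2),
      ENNReal.ofReal (2 * ρ) * k (ρ * Real.cos (2 * θ), ρ * Real.sin (2 * θ)) := by
  have hS : MeasurableSet {p : ℝ × ℝ | 0 < p.2} := measurableSet_lt measurable_const measurable_snd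
  have hk' : Measurable (indicator {p : ℝ × ℝ | 0 < p.2} k) := hk.indicator hS
  have h1 : ∫⁻ x, ∫⁻ s in Ioi (0 : ℝ), k (x, s)
      = ∫⁻ p : ℝ × ℝ, indicator {p : ℝ × ℝ | 0 < p.2} k p := by
    rw [Measure.volume_eq_prod, lintegral_prod _ hk'.aemeasurable]
    congr 1
    ext x
    rw [← lintegral_indicator measurableSet_Ioi]
    rfl
  rw [h1, lintegral_polar hk']
  refine setLIntegral_congr_fun measurableSet_Ioi fun ρ (hρ : 0 < ρ) => ?_
  have hpi := Real.pi_pos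
  have h2 : ∀ ψ ∈ Ioc 0 (2 * Real.pi), ENNReal.ofReal ρ *
      indicator {p : ℝ × ℝ | 0 < p.2} k (ρ * Real.cos ψ, ρ * Real.sin ψ) =
      indicator (Ioo 0 Real.pi)
        (fun ψ => ENNReal.ofReal ρ * k (ρ * Real.cos ψ, ρ * Real.sin ψ)) ψ := by
    intro ψ hψ
    by_cases hc : ψ ∈ Ioo 0 Real.pi
    · have : 0 < ρ * Real.sin ψ := mul_pos hρ (Real.sin_pos_of_mem_Ioo hc)
      rw [indicator_of_mem hc, indicator_of_mem (by exact this)]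
    · have : ¬ 0 < ρ * Real.sin ψ := by
        rw [not_lt]
        apply mul_nonpos_of_nonneg_of_nonpos hρ.le
        have h3 : Real.pi ≤ ψ := by
          by_contra h4
          exact hc ⟨hψ.1, not_le.1 h4⟩
        have h5 := Real.sin_nonneg_of_nonneg_of_le_pi (x := ψ - Real.pi) (by linarith)
          (by linarith [hψ.2])
        rw [Real.sin_sub_pi] at h5
        linarith
      rw [indicator_of_notMem hc, indicator_of_notMem (by exact this), mul_zero]
  rw [setLIntegral_congr_fun measurableSet_Ioc h2, setLIntegral_indicator measurableSet_Ioo,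
    inter_eq_left.2 (show Ioo 0 Real.pi ⊆ Ioc 0 (2 * Real.pi) from
      fun ψ hψ => ⟨hψ.1, by linarith [hψ.2]⟩)]
  have h6 := Real.smul_map_volume_mul_left (two_ne_zero : (2 : ℝ) ≠ 0)
  have he : MeasurableEmbedding (fun θ : ℝ => 2 * θ) :=
    (Homeomorph.mulLeft₀ (2 : ℝ) two_ne_zero).measurableEmbedding
  conv_lhs => rw [← h6]
  rw [Measure.restrict_smul, lintegral_smul_measure, he.restrict_map, he.lintegral_map]
  have h7 : (fun θ : ℝ => 2 * θ) ⁻¹' (Ioo 0 Real.pi) = Ioo 0 (Real.pi / 2) := by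
    ext θ
    simp only [mem_preimage, mem_Ioo]
    constructor <;> intro h <;> constructor <;> linarith [h.1, h.2]
  rw [h7, setLIntegral_congr Ioo_ae_eq_Ioc, smul_eq_mul, ← lintegral_const_mul']
  · refine lintegral_congr fun θ => ?_
    rw [← mul_assoc, ← ENNReal.ofReal_mul (abs_nonneg _), abs_two]
  · exact ENNReal.ofReal_ne_top

/-- The parametrization of space by coordinates in an orthonormal frame preserves volume. -/
theorem measurePreserving_frame (b : OrthonormalBasis (Fin 3) ℝ V3) :
    MeasurePreserving (fun p : ℝ × ℝ × ℝ => p.1 • b 0 + p.2.1 • b 1 + p.2.2 • b 2) := by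
  have h1 := (volume_preserving_piFinSuccAbove (fun _ : Fin 3 => ℝ) 0).symm
  have h2 : MeasurePreserving (fun p : ℝ × ℝ × ℝ =>
      (p.1, (MeasurableEquiv.finTwoArrow (α := ℝ)).symm p.2)) :=
    (MeasurePreserving.id volume).prod (volume_preserving_finTwoArrow ℝ).symm
  have h3 := (PiLp.volume_preserving_toLp (Fin 3))
  have h4 := b.measurePreserving_repr_symm
  have h := h4.comp (h3.comp (h1.comp h2))
  have e : (fun p : ℝ × ℝ × ℝ => p.1 • b 0 + p.2.1 • b 1 + p.2.2 • b 2) =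
      b.repr.symm ∘ WithLp.toLp 2 ∘ (MeasurableEquiv.piFinSuccAbove (fun _ : Fin 3 => ℝ) 0).symm ∘
        fun p : ℝ × ℝ × ℝ => (p.1, (MeasurableEquiv.finTwoArrow (α := ℝ)).symm p.2) := by
    funext p
    rw [Function.comp_apply, ← b.sum_repr (b.repr.symm _), Fin.sum_univ_three]
    simp only [LinearIsometryEquiv.apply_symm_apply]
    rfl
  rw [e]
  exact h

/-- Cylindrical coordinates around b 0, followed by polar coordinates in the half-plane of height
and radius. With polar angle 2θ the surface element is 4 sin θ cos θ dθ dϕ, hence the factor 4. -/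
theorem lintegral_spherical (b : OrthonormalBasis (Fin 3) ℝ V3) {f : V3 → ℝ≥0∞}
    (hf : Measurable f) :
    ∫⁻ x, f x = ∫⁻ ρ in Ioi (0 : ℝ), ENNReal.ofReal (4 * ρ ^ 2) *
      ∫⁻ p, f (ρ • sphereVec b p) ∂angleMeasure := by
  have hfr := measurePreserving_frame b
  rw [← hfr.lintegral_comp hf]
  set F : ℝ × ℝ × ℝ → ℝ≥0∞ := fun p => f (p.1 • b 0 + p.2.1 • b 1 + p.2.2 • b 2) with hF
  have hFm : Measurable F := hf.comp hfr.measurable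
  change ∫⁻ p, F p = _
  rw [Measure.volume_eq_prod, lintegral_prod _ hFm.aemeasurable]
  set k : ℝ × ℝ → ℝ≥0∞ := fun q => ∫⁻ ϕ in Ioc 0 (2 * Real.pi),
    ENNReal.ofReal q.2 * F (q.1, q.2 * Real.cos ϕ, q.2 * Real.sin ϕ) with hk
  have hkm : Measurable k := by
    apply Measurable.lintegral_prod_right' (f := fun q : (ℝ × ℝ) × ℝ =>
      ENNReal.ofReal q.1.2 * F (q.1.1, q.1.2 * Real.cos q.2, q.1.2 * Real.sin q.2))
    refine Measurable.mul (by fun_prop) (hFm.comp (by fun_prop))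
  have h1 : ∫⁻ x, ∫⁻ y, F (x, y) = ∫⁻ x, ∫⁻ s in Ioi (0 : ℝ), k (x, s) := by
    refine lintegral_congr fun x => ?_
    rw [lintegral_polar (k := fun y => F (x, y)) (hFm.comp (by fun_prop))]
  rw [h1, lintegral_half_polar hkm]
  refine setLIntegral_congr_fun measurableSet_Ioi fun ρ (hρ : 0 < ρ) => ?_
  have hm0 : Measurable fun p : ℝ × ℝ => f (ρ • sphereVec b p) :=
    hf.comp ((continuous_sphereVec b).const_smul ρ).measurable
  have hm : Measurable fun p : ℝ × ℝ =>
      ENNReal.ofReal (Real.sin p.2 * Real.cos p.2) * f (ρ • sphereVec b p) :=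
    Measurable.mul (by fun_prop) hm0
  rw [lintegral_angleMeasure hm0, lintegral_lintegral_swap hm.aemeasurable,
    ← lintegral_const_mul' _ _ ENNReal.ofReal_ne_top]
  refine setLIntegral_congr_fun measurableSet_Ioc fun θ hθ => ?_
  simp only [hk]
  rw [← lintegral_const_mul' _ _ ENNReal.ofReal_ne_top,
    ← lintegral_const_mul' _ _ ENNReal.ofReal_ne_top]
  refine lintegral_congr fun ϕ => ?_
  rw [← mul_assoc, ← mul_assoc, ← ENNReal.ofReal_mul (by positivity),
    ← ENNReal.ofReal_mul (by positivity), Real.sin_two_mul]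
  congr 1
  · congr 1; ring
  · simp only [hF, sphereVec, Real.sin_two_mul]
    congr 1
    module

/-- Integrating the indicator of B at x/|x| over the unit ball does not involve the frame, and in
the coordinates of any frame it is 4/3 times the image measure of B. Hence a frame that depends
arbitrarily on the relative velocity causes no measurability problem. -/
theorem map_sphereVec (b : OrthonormalBasis (Fin 3) ℝ V3) :
    angleMeasure.map (sphereVec b) = scatterMeasure := by
  have key : ∀ (b : OrthonormalBasis (Fin 3) ℝ V3) (B : Set V3), MeasurableSet B →
      ∫⁻ x in Metric.ball (0 : V3) 1, indicator B 1 (‖x‖⁻¹ • x) =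
        ENNReal.ofReal (4 / 3) * (angleMeasure.map (sphereVec b)) B := by
    intro b B hB
    have hm : Measurable fun x : V3 => (indicator B 1 (‖x‖⁻¹ • x) : ℝ≥0∞) :=
      (measurable_one.indicator hB).comp (measurable_norm.inv.smul measurable_id)
    rw [← lintegral_indicator Metric.isOpen_ball.measurableSet,
      lintegral_spherical b (hm.indicator Metric.isOpen_ball.measurableSet),
      Measure.map_apply (continuous_sphereVec b).measurable hB]
    have h1 : ∀ ρ ∈ Ioi (0 : ℝ), ENNReal.ofReal (4 * ρ ^ 2) *
        ∫⁻ p, indicator (Metric.ball (0 : V3) 1) (fun x => indicator B 1 (‖x‖⁻¹ • x))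
          (ρ • sphereVec b p) ∂angleMeasure = indicator (Ioo 0 1)
            (fun ρ => ENNReal.ofReal (4 * ρ ^ 2) * angleMeasure (sphereVec b ⁻¹' B)) ρ := by
      intro ρ hρ
      have hρ : 0 < ρ := hρ
      by_cases h1 : ρ < 1
      · rw [indicator_of_mem (show ρ ∈ Ioo 0 1 from ⟨hρ, h1⟩)]
        congr 1
        have : ∀ p, indicator (Metric.ball (0 : V3) 1) (fun x => indicator B 1 (‖x‖⁻¹ • x))
          (ρ • sphereVec b p) = indicator (sphereVec b ⁻¹' B) (1 : ℝ × ℝ → ℝ≥0∞) p := by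
          intro p
          rw [indicator_of_mem (by simpa [norm_smul, norm_sphereVec, abs_of_pos hρ] using h1),
            norm_smul, norm_sphereVec, Real.norm_of_nonneg hρ.le, mul_one, smul_smul,
            inv_mul_cancel₀ hρ.ne', one_smul]
          rfl
        simp only [this]
        exact lintegral_indicator_one ((continuous_sphereVec b).measurable hB)
      · rw [indicator_of_notMem (fun h => h1 h.2)]
        have : ∀ p, indicator (Metric.ball (0 : V3) 1) (fun x => indicator B 1 (‖x‖⁻¹ • x))
          (ρ • sphereVec b p) = (0 : ℝ≥0∞) := by
          intro p
          rw [indicator_of_notMem]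
          simpa [norm_smul, norm_sphereVec, abs_of_pos hρ] using h1
        simp only [this, lintegral_zero, mul_zero]
    rw [setLIntegral_congr_fun measurableSet_Ioi h1, setLIntegral_indicator measurableSet_Ioo,
      inter_eq_left.2 (fun x hx => hx.1), lintegral_mul_const _ (by fun_prop)]
    congr 1
    rw [setLIntegral_congr Ioo_ae_eq_Ioc, ← ofReal_integral_eq_lintegral_ofReal,
      ← intervalIntegral.integral_of_le zero_le_one]
    · congr 1
      simp
      norm_num
    · exact (Continuous.integrableOn_Ioc (by fun_prop))
    · exact Filter.Eventually.of_forall fun x => by positivity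
  ext B hB
  have h1 := key b B hB
  have h2 := key (EuclideanSpace.basisFun (Fin 3) ℝ) B hB
  rw [h1] at h2
  exact (ENNReal.mul_right_inj (by norm_num) ENNReal.ofReal_ne_top).1 h2

/-- A crude bound: the density is at most 1 and the parameter rectangle has area π² < 10. -/
theorem scatterMeasure_univ_le : scatterMeasure univ ≤ ENNReal.ofReal 10 := by
  rw [scatterMeasure, Measure.map_apply (continuous_sphereVec _).measurable MeasurableSet.univ,
    preimage_univ, ← lintegral_one, lintegral_angleMeasure measurable_const]
  have h1 : ∀ ϕ θ : ℝ, ENNReal.ofReal (Real.sin θ * Real.cos θ) * 1 ≤ 1 := by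
    intro ϕ θ
    rw [mul_one, ENNReal.ofReal_le_one]
    nlinarith [Real.sin_sq_add_cos_sq θ, sq_nonneg (Real.sin θ - Real.cos θ)]
  refine (lintegral_mono fun ϕ => lintegral_mono fun θ => h1 ϕ θ).trans ?_
  simp only [lintegral_one, Measure.restrict_apply_univ, Real.volume_Ioc, sub_zero,
    lintegral_const]
  rw [← ENNReal.ofReal_mul (by positivity)]
  apply ENNReal.ofReal_le_ofReal
  nlinarith [Real.pi_lt_d2, Real.pi_pos]

instance : IsFiniteMeasure scatterMeasure :=
  ⟨scatterMeasure_univ_le.trans_lt ENNReal.ofReal_lt_top⟩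

theorem ae_norm_scatterMeasure : ∀ᵐ σ ∂scatterMeasure, ‖σ‖ = 1 := by
  rw [scatterMeasure, ae_map_iff (continuous_sphereVec _).measurable.aemeasurable
    (measurableSet_eq_fun measurable_norm measurable_const)]
  exact Filter.Eventually.of_forall fun p => norm_sphereVec _ p

theorem exists_frame (c : V3) : ∃ b : OrthonormalBasis (Fin 3) ℝ V3, c = ‖c‖ • b 0 := by
  by_cases hc : c = 0
  · exact ⟨EuclideanSpace.basisFun (Fin 3) ℝ, by simp [hc]⟩
  · have hn : ‖c‖ ≠ 0 := norm_ne_zero_iff.2 hc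
    have h1 : Orthonormal ℝ (({0} : Set (Fin 3)).domRestrict fun _ : Fin 3 => ‖c‖⁻¹ • c) := by
      rw [orthonormal_iff_ite]
      rintro ⟨i, hi⟩ ⟨j, hj⟩
      rw [mem_singleton_iff] at hi hj
      subst hi hj
      rw [if_pos rfl, domRestrict_apply, real_inner_self_eq_norm_sq, norm_smul, norm_inv,
        norm_norm, inv_mul_cancel₀ hn, one_pow]
    obtain ⟨b, hb⟩ := h1.exists_orthonormalBasis_extension_of_card_eq (by simp)
    refine ⟨b, ?_⟩
    rw [hb 0 rfl, smul_smul, mul_inv_cancel₀ hn, one_smul]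

/-- The mean of `1 / |y|` over a sphere is bounded by a multiple of the inverse radius. -/
theorem lintegral_inv_norm_sphere_le (c : V3) {ρ : ℝ} (hρ : 0 < ρ) :
    ∫⁻ σ, ‖c + ρ • σ‖ₑ⁻¹ ∂scatterMeasure ≤ ENNReal.ofReal (5 / ρ) := by
  obtain ⟨b, hb⟩ := exists_frame c
  have hm : Measurable fun σ : V3 => ‖c + ρ • σ‖ₑ⁻¹ := by fun_prop
  rw [← map_sphereVec b, lintegral_map hm (continuous_sphereVec b).measurable,
    lintegral_angleMeasure (g := fun p => ‖c + ρ • sphereVec b p‖ₑ⁻¹)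
      (hm.comp (continuous_sphereVec b).measurable)]
  have h1 : ∀ ϕ : ℝ, ∀ θ ∈ Ioo 0 (Real.pi / 2), ENNReal.ofReal (Real.sin θ * Real.cos θ) *
      ‖c + ρ • sphereVec b (ϕ, θ)‖ₑ⁻¹ ≤ ENNReal.ofReal (1 / (2 * ρ)) := by
    intro ϕ θ hθ
    have hs : 0 < Real.sin θ := Real.sin_pos_of_pos_of_lt_pi hθ.1 (by linarith [hθ.2, Real.pi_pos])
    have hc : 0 < Real.cos θ := Real.cos_pos_of_mem_Ioo ⟨by linarith [hθ.1, Real.pi_pos], hθ.2⟩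
    -- The frame has its first axis along c, so the right side is at least the distance to that
    -- axis. The density sin θ cos θ cancels this sine and the integrand is at most 1/(2ρ). The
    -- final constant is π²/2 < 5.
    have h2 : ρ * Real.sin (2 * θ) ≤ ‖c + ρ • sphereVec b (ϕ, θ)‖ := by
      have h3 := norm_combination_sq b (‖c‖ + ρ * Real.cos (2 * θ))
        (ρ * (Real.sin (2 * θ) * Real.cos ϕ)) (ρ * (Real.sin (2 * θ) * Real.sin ϕ))
      have h4 : c + ρ • sphereVec b (ϕ, θ) = (‖c‖ + ρ * Real.cos (2 * θ)) • b 0 +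
        (ρ * (Real.sin (2 * θ) * Real.cos ϕ)) • b 1 +
        (ρ * (Real.sin (2 * θ) * Real.sin ϕ)) • b 2 := by
        conv_lhs => rw [hb]
        rw [sphereVec]
        module
      rw [← h4] at h3
      apply le_of_sq_le_sq _ (norm_nonneg _)
      rw [h3]
      have h5 : (ρ * Real.sin (2 * θ)) ^ 2 = (ρ * (Real.sin (2 * θ) * Real.cos ϕ)) ^ 2 +
        (ρ * (Real.sin (2 * θ) * Real.sin ϕ)) ^ 2 := by
        linear_combination -(ρ * Real.sin (2 * θ)) ^ 2 * Real.sin_sq_add_cos_sq ϕ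
      nlinarith [sq_nonneg (‖c‖ + ρ * Real.cos (2 * θ))]
    rw [Real.sin_two_mul] at h2
    have h3 : 0 < ρ * (2 * Real.sin θ * Real.cos θ) := by positivity
    have h4 : 0 < ‖c + ρ • sphereVec b (ϕ, θ)‖ := h3.trans_le h2
    rw [← ofReal_norm, ← ENNReal.ofReal_inv_of_pos h4,
      ← ENNReal.ofReal_mul (by positivity)]
    apply ENNReal.ofReal_le_ofReal
    rw [← div_eq_mul_inv, div_le_div_iff₀ h4 (by positivity)]
    linarith
  have h2 : ∀ ϕ : ℝ, ∫⁻ θ in Ioc 0 (Real.pi / 2), ENNReal.ofReal (Real.sin θ * Real.cos θ) *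
      ‖c + ρ • sphereVec b (ϕ, θ)‖ₑ⁻¹ ≤ ENNReal.ofReal (1 / (2 * ρ) * (Real.pi / 2)) := by
    intro ϕ
    rw [← setLIntegral_congr Ioo_ae_eq_Ioc]
    refine (setLIntegral_mono measurable_const (h1 ϕ)).trans ?_
    rw [setLIntegral_const, Real.volume_Ioo, sub_zero, ← ENNReal.ofReal_mul (by positivity)]
  refine (lintegral_mono h2).trans ?_
  rw [setLIntegral_const, Real.volume_Ioc, sub_zero, ← ENNReal.ofReal_mul (by positivity)]
  apply ENNReal.ofReal_le_ofReal
  have : 1 / (2 * ρ) * (Real.pi / 2) * (2 * Real.pi) = (Real.pi ^ 2 / 2) / ρ := by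
    field_simp
  rw [this]
  gcongr
  nlinarith [Real.pi_lt_d2, Real.pi_pos]

end

section

/-! ### Elementary integrals -/

theorem integrable_gaussian {b : ℝ} (hb : 0 < b) :
    Integrable fun p : V3 => Real.exp (-b * ‖p‖ ^ 2) := by
  apply Integrable.of_integral_ne_zero
  rw [GaussianFourier.integral_rexp_neg_mul_sq_norm hb]
  positivity

theorem integrableOn_inv_norm (ρ : ℝ) :
    IntegrableOn (fun u : V3 => ‖u‖⁻¹) (Metric.ball 0 ρ) := by
  rw [integrableOn_fun_norm_addHaar volume (f := fun y => y⁻¹)]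
  have h1 : IntegrableOn (fun y : ℝ => y) (Ioo 0 ρ) :=
    (continuous_id.integrableOn_Icc (a := 0) (b := ρ)).mono_set Ioo_subset_Icc_self
  refine h1.congr_fun (fun y hy => ?_) measurableSet_Ioo
  have : y ≠ 0 := hy.1.ne'
  simp
  field_simp

theorem lintegral_inv_enorm_ball_lt_top (ρ : ℝ) :
    ∫⁻ u in Metric.ball (0 : V3) ρ, ‖u‖ₑ⁻¹ < ∞ := by
  have h := (integrableOn_inv_norm ρ).2
  refine lt_of_eq_of_lt ?_ h
  apply lintegral_congr_ae
  have h0 : ∀ᵐ u : V3 ∂volume.restrict (Metric.ball 0 ρ), u ≠ 0 :=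
    ae_restrict_of_ae (Measure.ae_ne volume 0)
  filter_upwards [h0] with u hu
  rw [enorm_inv (norm_ne_zero_iff.2 hu), enorm_norm]

/-- Split at |u| = 1: inside, 1/|u| is integrable and the Gaussian is at most 1; outside, 1/|u| is
at most 1. The Gaussian integral is translation invariant, which gives uniformity in v. -/
theorem exists_lintegral_gaussian_inv_le : ∃ c : ℝ, 0 ≤ c ∧ ∀ v : V3,
    ∫⁻ u, ENNReal.ofReal (Real.exp (-‖v + u‖ ^ 2 / 8)) * (1 + ‖u‖ₑ⁻¹) ≤ ENNReal.ofReal c := by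
  set A := ∫⁻ u : V3, ENNReal.ofReal (Real.exp (-‖u‖ ^ 2 / 8)) with hA
  set B := ∫⁻ u in Metric.ball (0 : V3) 1, ‖u‖ₑ⁻¹ with hB
  have hAfin : A < ∞ := by
    have h := (integrable_gaussian (b := 1 / 8) (by norm_num)).lintegral_lt_top
    refine lt_of_eq_of_lt (lintegral_congr fun u => ?_) h
    congr 2; ring
  have hBfin : B < ∞ := lintegral_inv_enorm_ball_lt_top 1
  refine ⟨(2 * A + B).toReal, ENNReal.toReal_nonneg, fun v => ?_⟩
  have hfin : 2 * A + B ≠ ∞ := by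
    simp [ENNReal.mul_eq_top, hAfin.ne, hBfin.ne]
  rw [ENNReal.ofReal_toReal hfin]
  have hpt : ∀ u : V3, ENNReal.ofReal (Real.exp (-‖v + u‖ ^ 2 / 8)) * (1 + ‖u‖ₑ⁻¹) ≤
      ENNReal.ofReal (Real.exp (-‖v + u‖ ^ 2 / 8)) * 2 +
        indicator (Metric.ball (0 : V3) 1) (fun u => ‖u‖ₑ⁻¹) u := by
    intro u
    have h1 : ENNReal.ofReal (Real.exp (-‖v + u‖ ^ 2 / 8)) ≤ 1 := by
      rw [ENNReal.ofReal_le_one, Real.exp_le_one_iff]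
      nlinarith [sq_nonneg ‖v + u‖]
    by_cases hu : u ∈ Metric.ball (0 : V3) 1
    · rw [indicator_of_mem hu, mul_add, mul_one]
      refine add_le_add ?_ (mul_le_of_le_one_left (by positivity) h1)
      exact le_mul_of_one_le_right (by positivity) one_le_two
    · rw [indicator_of_notMem hu, add_zero]
      gcongr
      have : (1 : ℝ≥0∞) ≤ ‖u‖ₑ := by
        rw [← ofReal_norm, ENNReal.one_le_ofReal]
        simpa using hu
      calc (1 : ℝ≥0∞) + ‖u‖ₑ⁻¹ ≤ 1 + 1 := by
            gcongr
            exact ENNReal.inv_le_one.2 this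
        _ = 2 := by norm_num
  refine (lintegral_mono hpt).trans ?_
  rw [lintegral_add_left (by fun_prop), lintegral_mul_const _ (by fun_prop),
    lintegral_indicator Metric.isOpen_ball.measurableSet,
    lintegral_add_left_eq_self (μ := volume)
      (fun u : V3 => ENNReal.ofReal (Real.exp (-‖u‖ ^ 2 / 8))) v, mul_comm]

/-! ### Bounds for the collision kernel -/

/-- The velocity `v' = v + (u + |u|σ)/2`, where `u = v⋆ - v`. -/
def postV (v : V3) (q : V3 × V3) : V3 := v + (2⁻¹ : ℝ) • (q.1 + ‖q.1‖ • q.2)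

/-- The velocity `v⋆' = v + (u - |u|σ)/2`, where `u = v⋆ - v`. -/
def postVS (v : V3) (q : V3 × V3) : V3 := v + (2⁻¹ : ℝ) • (q.1 - ‖q.1‖ • q.2)

/-- Conservation of energy. -/
theorem norm_sq_postV_add (v : V3) {q : V3 × V3} (hq : ‖q.2‖ = 1) :
    ‖postV v q‖ ^ 2 + ‖postVS v q‖ ^ 2 = ‖v‖ ^ 2 + ‖v + q.1‖ ^ 2 := by
  obtain ⟨u, σ⟩ := q
  have h1 : postV v (u, σ) = (v + (2⁻¹ : ℝ) • u) + (2⁻¹ * ‖u‖) • σ := by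
    simp only [postV]; module
  have h2 : postVS v (u, σ) = (v + (2⁻¹ : ℝ) • u) - (2⁻¹ * ‖u‖) • σ := by
    simp only [postVS]; module
  have h3 : v = (v + (2⁻¹ : ℝ) • u) - (2⁻¹ : ℝ) • u := by module
  have h4 : v + u = (v + (2⁻¹ : ℝ) • u) + (2⁻¹ : ℝ) • u := by module
  rw [h1, h2]
  conv_rhs => rw [h4]; enter [1]; rw [h3]
  have p1 := parallelogram_law_with_norm ℝ (v + (2⁻¹ : ℝ) • u) ((2⁻¹ * ‖u‖) • σ)
  have p2 := parallelogram_law_with_norm ℝ (v + (2⁻¹ : ℝ) • u) ((2⁻¹ : ℝ) • u)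
  have n1 : ‖(2⁻¹ * ‖u‖) • σ‖ = 2⁻¹ * ‖u‖ := by
    rw [norm_smul, hq, Real.norm_of_nonneg (by positivity), mul_one]
  have n2 : ‖(2⁻¹ : ℝ) • u‖ = 2⁻¹ * ‖u‖ := by
    rw [norm_smul, Real.norm_of_nonneg (by positivity)]
  rw [n1] at p1
  rw [n2] at p2
  linarith

theorem norm_postV_le (v : V3) {q : V3 × V3} (hq : ‖q.2‖ = 1) :
    ‖postV v q‖ ≤ ‖v‖ + ‖v + q.1‖ := by
  have := norm_sq_postV_add v hq
  apply le_of_sq_le_sq _ (by positivity)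
  nlinarith [norm_nonneg v, norm_nonneg (v + q.1), sq_nonneg ‖postVS v q‖]

theorem norm_postVS_le (v : V3) {q : V3 × V3} (hq : ‖q.2‖ = 1) :
    ‖postVS v q‖ ≤ ‖v‖ + ‖v + q.1‖ := by
  have := norm_sq_postV_add v hq
  apply le_of_sq_le_sq _ (by positivity)
  nlinarith [norm_nonneg v, norm_nonneg (v + q.1), sq_nonneg ‖postV v q‖]

/-- Separates the growth in v, which the collision frequency will compensate, from a factor in v + u
that the Gaussian absorbs. -/
theorem norm_rpow_le {γ : ℝ} (hγ₀ : 0 ≤ γ) (hγ₁ : γ ≤ 1) (v u : V3) :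
    ‖u‖ ^ γ ≤ (1 + ‖v‖) ^ γ * (1 + ‖v + u‖) := by
  have h1 : ‖u‖ ≤ (1 + ‖v‖) * (1 + ‖v + u‖) := by
    have : ‖u‖ ≤ ‖v + u‖ + ‖v‖ := by
      have := norm_sub_le (v + u) v
      rwa [add_sub_cancel_left] at this
    nlinarith [norm_nonneg v, norm_nonneg (v + u)]
  calc ‖u‖ ^ γ ≤ ((1 + ‖v‖) * (1 + ‖v + u‖)) ^ γ := by gcongr
    _ = (1 + ‖v‖) ^ γ * (1 + ‖v + u‖) ^ γ := Real.mul_rpow (by positivity) (by positivity)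
    _ ≤ (1 + ‖v‖) ^ γ * (1 + ‖v + u‖) ^ (1 : ℝ) := by
      gcongr
      linarith [norm_nonneg (v + u)]
    _ = _ := by rw [Real.rpow_one]

theorem one_le_growth {γ : ℝ} (hγ₀ : 0 ≤ γ) (v : V3) : 1 ≤ (1 + ‖v‖) ^ γ :=
  Real.one_le_rpow (by linarith [norm_nonneg v]) hγ₀

theorem gaussian_mul_le (x : ℝ) :
    Real.exp (-x ^ 2 / 4) * (1 + x) ≤ Real.exp 2 * Real.exp (-x ^ 2 / 8) := by
  calc Real.exp (-x ^ 2 / 4) * (1 + x) ≤ Real.exp (-x ^ 2 / 4) * Real.exp x := by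
        gcongr; linarith [Real.add_one_le_exp x]
    _ = Real.exp (-x ^ 2 / 4 + x) := (Real.exp_add _ _).symm
    _ ≤ Real.exp (2 + -x ^ 2 / 8) := by
        apply Real.exp_le_exp.2
        nlinarith [sq_nonneg (x - 4)]
    _ = _ := Real.exp_add _ _

/-- The post-collisional velocity runs over the sphere with centre v + u/2 and radius |u|/2. -/
theorem lintegral_enorm_postV_inv_le (v u : V3) (hu : u ≠ 0) :
    ∫⁻ σ, ‖postV v (u, σ)‖ₑ⁻¹ ∂scatterMeasure ≤ 10 * ‖u‖ₑ⁻¹ := by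
  have hn := norm_pos_iff.2 hu
  have h := lintegral_inv_norm_sphere_le (v + (2⁻¹ : ℝ) • u) (ρ := 2⁻¹ * ‖u‖) (by positivity)
  refine le_trans (le_of_eq ?_) (h.trans (le_of_eq ?_))
  · refine lintegral_congr fun σ => ?_
    congr 2
    simp only [postV]; module
  · rw [← ofReal_norm, ← ENNReal.ofReal_inv_of_pos hn,
      show (10 : ℝ≥0∞) = ENNReal.ofReal 10 by norm_num, ← ENNReal.ofReal_mul (by positivity)]
    congr 1
    field_simp
    norm_num

theorem lintegral_enorm_postVS_inv_le (v u : V3) (hu : u ≠ 0) :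
    ∫⁻ σ, ‖postVS v (u, σ)‖ₑ⁻¹ ∂scatterMeasure ≤ 10 * ‖u‖ₑ⁻¹ := by
  -- Reversing the signs of v and u turns `postVS` into minus `postV`, with the same σ.
  refine le_trans (le_of_eq ?_) (lintegral_enorm_postV_inv_le (-v) (-u) (neg_ne_zero.2 hu) |>.trans
    (by rw [enorm_neg]))
  refine lintegral_congr fun σ => ?_
  congr 1
  rw [← enorm_neg]
  congr 1
  simp only [postV, postVS, norm_neg]; module

/-- Integrating first over σ replaces the singularities 1/|v'| and 1/|v⋆'| by 1/|u|, which is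
locally integrable in u and is then controlled by the Gaussian. -/
theorem exists_lintegral_gain_le {γ : ℝ} (hγ₀ : 0 ≤ γ) (hγ₁ : γ ≤ 1) : ∃ c : ℝ, 0 ≤ c ∧ ∀ v : V3,
    ∫⁻ q : V3 × V3, ENNReal.ofReal (Real.exp (-‖v + q.1‖ ^ 2 / 4) * ‖q.1‖ ^ γ) *
      (1 + ‖postV v q‖ₑ⁻¹ + ‖postVS v q‖ₑ⁻¹) ∂(volume.prod scatterMeasure)
      ≤ ENNReal.ofReal (c * (1 + ‖v‖) ^ γ) := by
  obtain ⟨c, hc0, hc⟩ := exists_lintegral_gaussian_inv_le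
  refine ⟨(Real.exp 2 * 10 + 20) * c, by positivity, fun v => ?_⟩
  have hpost : Measurable fun q : V3 × V3 => ‖postV v q‖ₑ⁻¹ := by
    have : Continuous fun q : V3 × V3 => postV v q := by unfold postV; fun_prop
    exact this.measurable.enorm.inv
  have hpostS : Measurable fun q : V3 × V3 => ‖postVS v q‖ₑ⁻¹ := by
    have : Continuous fun q : V3 × V3 => postVS v q := by unfold postVS; fun_prop
    exact this.measurable.enorm.inv
  have hw : Measurable fun q : V3 × V3 =>
      ENNReal.ofReal (Real.exp (-‖v + q.1‖ ^ 2 / 4) * ‖q.1‖ ^ γ) := by fun_prop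
  have hm : Measurable fun q : V3 × V3 =>
      ENNReal.ofReal (Real.exp (-‖v + q.1‖ ^ 2 / 4) * ‖q.1‖ ^ γ) *
        (1 + ‖postV v q‖ₑ⁻¹ + ‖postVS v q‖ₑ⁻¹) :=
    hw.mul ((measurable_const.add hpost).add hpostS)
  rw [lintegral_prod _ hm.aemeasurable]
  have hg := one_le_growth hγ₀ v
  set g := (1 + ‖v‖) ^ γ with hgdef
  have hpt : ∀ᵐ u : V3, ∫⁻ σ, ENNReal.ofReal (Real.exp (-‖v + u‖ ^ 2 / 4) * ‖u‖ ^ γ) *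
      (1 + ‖postV v (u, σ)‖ₑ⁻¹ + ‖postVS v (u, σ)‖ₑ⁻¹) ∂scatterMeasure ≤
      ENNReal.ofReal ((Real.exp 2 * 10 + 20) * g) *
        (ENNReal.ofReal (Real.exp (-‖v + u‖ ^ 2 / 8)) * (1 + ‖u‖ₑ⁻¹)) := by
    filter_upwards [Measure.ae_ne volume (0 : V3)] with u hu
    have hn := norm_pos_iff.2 hu
    rw [lintegral_const_mul' _ _ ENNReal.ofReal_ne_top, lintegral_add_left, lintegral_add_left]
    rotate_left
    · fun_prop
    · exact measurable_const.add (hpost.comp (by fun_prop))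
    rw [lintegral_one]
    calc _ ≤ ENNReal.ofReal (Real.exp (-‖v + u‖ ^ 2 / 4) * ‖u‖ ^ γ) *
          (ENNReal.ofReal 10 + 10 * ‖u‖ₑ⁻¹ + 10 * ‖u‖ₑ⁻¹) := by
          gcongr
          · exact scatterMeasure_univ_le
          · exact lintegral_enorm_postV_inv_le v u hu
          · exact lintegral_enorm_postVS_inv_le v u hu
      _ ≤ _ := by
          rw [← ofReal_norm, ← ENNReal.ofReal_inv_of_pos hn,
            show (10 : ℝ≥0∞) = ENNReal.ofReal 10 by norm_num, ← ENNReal.ofReal_one,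
            ← ENNReal.ofReal_mul (by positivity), ← ENNReal.ofReal_add (by positivity)
            (by positivity), ← ENNReal.ofReal_add (by positivity) (by positivity),
            ← ENNReal.ofReal_add (by positivity) (by positivity),
            ← ENNReal.ofReal_mul (by positivity), ← ENNReal.ofReal_mul (by positivity),
            ← ENNReal.ofReal_mul (by positivity)]
          apply ENNReal.ofReal_le_ofReal
          set x := ‖v + u‖
          have hx : 0 ≤ x := norm_nonneg _
          have h1 : Real.exp (-x ^ 2 / 4) * ‖u‖ ^ γ ≤ g * (Real.exp 2 * Real.exp (-x ^ 2 / 8)) := by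
            calc _ ≤ Real.exp (-x ^ 2 / 4) * (g * (1 + x)) := by
                  gcongr
                  exact norm_rpow_le hγ₀ hγ₁ v u
              _ = g * (Real.exp (-x ^ 2 / 4) * (1 + x)) := by ring
              _ ≤ _ := by
                  gcongr ?_ * ?_
                  exact gaussian_mul_le x
          have h2 : ‖u‖ ^ γ * ‖u‖⁻¹ ≤ 1 + ‖u‖⁻¹ := by
            rcases le_total ‖u‖ 1 with h | h
            · have : ‖u‖ ^ γ ≤ 1 := Real.rpow_le_one hn.le h hγ₀
              have h3 : 0 < ‖u‖⁻¹ := by positivity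
              nlinarith
            · have : ‖u‖ ^ γ ≤ ‖u‖ := by
                calc ‖u‖ ^ γ ≤ ‖u‖ ^ (1 : ℝ) := Real.rpow_le_rpow_of_exponent_le h hγ₁
                  _ = ‖u‖ := Real.rpow_one _
              have h3 : 0 < ‖u‖⁻¹ := by positivity
              have h4 : ‖u‖ * ‖u‖⁻¹ = 1 := mul_inv_cancel₀ hn.ne'
              nlinarith
          have h3 : Real.exp (-x ^ 2 / 4) ≤ Real.exp (-x ^ 2 / 8) := by
            apply Real.exp_le_exp.2; nlinarith [sq_nonneg x]
          have h4 : Real.exp (-x ^ 2 / 4) * (‖u‖ ^ γ * ‖u‖⁻¹) ≤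
              g * (Real.exp (-x ^ 2 / 8) * (1 + ‖u‖⁻¹)) := by
            calc _ ≤ Real.exp (-x ^ 2 / 8) * (1 + ‖u‖⁻¹) := by gcongr
              _ ≤ _ := le_mul_of_one_le_left (by positivity) hg
          have h5 : 0 ≤ g * (Real.exp 2 * Real.exp (-x ^ 2 / 8)) * ‖u‖⁻¹ := by positivity
          nlinarith
  refine (lintegral_mono_ae hpt).trans ?_
  rw [lintegral_const_mul' _ _ ENNReal.ofReal_ne_top]
  refine (mul_le_mul_right (hc v) _).trans ?_
  rw [← ENNReal.ofReal_mul (by positivity)]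
  apply le_of_eq
  congr 1
  ring

theorem exists_lintegral_loss_le {γ : ℝ} (hγ₀ : 0 ≤ γ) (hγ₁ : γ ≤ 1) : ∃ c : ℝ, 0 ≤ c ∧ ∀ v : V3,
    ∫⁻ u : V3, ENNReal.ofReal (Real.exp (-‖v + u‖ ^ 2 / 4) * ‖u‖ ^ γ) *
      (1 + ‖v + u‖ₑ⁻¹) ≤ ENNReal.ofReal (c * (1 + ‖v‖) ^ γ) := by
  obtain ⟨c, hc0, hc⟩ := exists_lintegral_gaussian_inv_le
  refine ⟨Real.exp 2 * c, by positivity, fun v => ?_⟩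
  set g := (1 + ‖v‖) ^ γ with hgdef
  have hpt : ∀ u : V3, ENNReal.ofReal (Real.exp (-‖v + u‖ ^ 2 / 4) * ‖u‖ ^ γ) *
      (1 + ‖v + u‖ₑ⁻¹) ≤ ENNReal.ofReal (Real.exp 2 * g) *
        (ENNReal.ofReal (Real.exp (-‖0 + (v + u)‖ ^ 2 / 8)) * (1 + ‖v + u‖ₑ⁻¹)) := by
    intro u
    rw [← mul_assoc, ← ENNReal.ofReal_mul (by positivity), zero_add]
    refine mul_le_mul_left (ENNReal.ofReal_le_ofReal ?_) _
    calc Real.exp (-‖v + u‖ ^ 2 / 4) * ‖u‖ ^ γ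
        ≤ Real.exp (-‖v + u‖ ^ 2 / 4) * (g * (1 + ‖v + u‖)) := by
          gcongr
          exact norm_rpow_le hγ₀ hγ₁ v u
      _ = g * (Real.exp (-‖v + u‖ ^ 2 / 4) * (1 + ‖v + u‖)) := by ring
      _ ≤ g * (Real.exp 2 * Real.exp (-‖v + u‖ ^ 2 / 8)) := by
          gcongr ?_ * ?_
          exact gaussian_mul_le _
      _ = _ := by ring
  refine (lintegral_mono hpt).trans ?_
  rw [lintegral_const_mul' _ _ ENNReal.ofReal_ne_top, lintegral_add_left_eq_self (μ := volume)
      (fun u : V3 => ENNReal.ofReal (Real.exp (-‖0 + u‖ ^ 2 / 8)) * (1 + ‖u‖ₑ⁻¹)) v]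
  refine (mul_le_mul_right (hc 0) _).trans ?_
  rw [← ENNReal.ofReal_mul (by positivity)]
  apply le_of_eq
  congr 1
  ring

theorem norm_sq_ge {p q : V3} : ‖p‖ ^ 2 - 2 * ‖p‖ * ‖p - q‖ ≤ ‖q‖ ^ 2 := by
  have h1 : ‖p‖ ≤ ‖q‖ + ‖p - q‖ := by
    have := norm_add_le q (p - q)
    rwa [add_sub_cancel] at this
  rcases le_total ‖p‖ (‖p - q‖) with h | h
  · nlinarith [norm_nonneg p, sq_nonneg ‖q‖]
  · nlinarith [norm_nonneg p, norm_nonneg q, norm_nonneg (p - q)]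

theorem abs_exp_sub_exp_le (a b : ℝ) :
    |Real.exp a - Real.exp b| ≤ |a - b| * Real.exp (max a b) := by
  wlog h : b ≤ a generalizing a b
  · rw [abs_sub_comm, abs_sub_comm a b, max_comm]
    exact this b a (le_of_not_ge h)
  rw [max_eq_left h, abs_of_nonneg (sub_nonneg.2 h),
    abs_of_nonneg (sub_nonneg.2 (Real.exp_le_exp.2 h))]
  have h1 := Real.add_one_le_exp (b - a)
  have h2 : Real.exp b = Real.exp (b - a) * Real.exp a := by rw [← Real.exp_add]; ring_nf
  rw [h2]
  nlinarith [Real.exp_pos a]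

/-- Local Lipschitz bound of Gaussians. -/
theorem abs_gaussian_sub_le {β : ℝ} (hβ₀ : 1 / 2 ≤ β) (hβ₁ : β ≤ 1) {p q : V3}
    (h : ‖p - q‖ ≤ 1) : |Real.exp (-β * ‖p‖ ^ 2) - Real.exp (-β * ‖q‖ ^ 2)| ≤
      ‖p - q‖ * (Real.exp 16 * Real.exp (-‖p‖ ^ 2 / 4)) := by
  have hp := norm_nonneg p
  have hq := norm_nonneg q
  have ht := norm_nonneg (p - q)
  have h1 := norm_sq_ge (p := p) (q := q)
  have h2 : |‖p‖ - ‖q‖| ≤ ‖p - q‖ := abs_norm_sub_norm_le p q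
  rw [abs_le] at h2
  have h3 : |(-β * ‖p‖ ^ 2) - (-β * ‖q‖ ^ 2)| ≤ ‖p - q‖ * (2 * ‖p‖ + 1) := by
    have e : (-β * ‖p‖ ^ 2) - (-β * ‖q‖ ^ 2) = β * ((‖q‖ - ‖p‖) * (‖q‖ + ‖p‖)) := by ring
    rw [e, abs_mul, abs_mul, abs_of_nonneg (by linarith : 0 ≤ β),
      abs_of_nonneg (by positivity : 0 ≤ ‖q‖ + ‖p‖)]
    have h5 : |‖q‖ - ‖p‖| ≤ ‖p - q‖ := by rw [abs_le]; constructor <;> linarith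
    calc β * (|‖q‖ - ‖p‖| * (‖q‖ + ‖p‖)) ≤ 1 * (‖p - q‖ * (2 * ‖p‖ + 1)) := by
          gcongr ?_ * (?_ * ?_)
          linarith
      _ = _ := one_mul _
  -- The lower bound β ≥ 1/2 enters here. Half of the Gaussian is then spent on the linear terms: 4x
  -- - x²/2 ≤ 16 - x²/4, because (x - 8)² ≥ 0.
  have h4 : max (-β * ‖p‖ ^ 2) (-β * ‖q‖ ^ 2) ≤ 2 * ‖p‖ - ‖p‖ ^ 2 / 2 := by
    apply max_le
    · nlinarith [sq_nonneg ‖p‖]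
    · have h5 : 2 * ‖p‖ * ‖p - q‖ ≤ 2 * ‖p‖ := mul_le_of_le_one_right (by positivity) h
      have h6 : ‖p‖ ^ 2 - 2 * ‖p‖ ≤ ‖q‖ ^ 2 := by linarith
      nlinarith [sq_nonneg ‖p‖, sq_nonneg ‖q‖]
  refine (abs_exp_sub_exp_le _ _).trans ?_
  calc _ ≤ ‖p - q‖ * (2 * ‖p‖ + 1) * Real.exp (2 * ‖p‖ - ‖p‖ ^ 2 / 2) := by gcongr
    _ ≤ ‖p - q‖ * Real.exp (2 * ‖p‖) * Real.exp (2 * ‖p‖ - ‖p‖ ^ 2 / 2) := by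
        gcongr; exact Real.add_one_le_exp _
    _ = ‖p - q‖ * Real.exp (2 * ‖p‖ + (2 * ‖p‖ - ‖p‖ ^ 2 / 2)) := by
        rw [mul_assoc, ← Real.exp_add]
    _ ≤ ‖p - q‖ * Real.exp (16 + -‖p‖ ^ 2 / 4) := by
        refine mul_le_mul_of_nonneg_left (Real.exp_le_exp.2 ?_) ht
        nlinarith [sq_nonneg (‖p‖ - 8)]
    _ = _ := by rw [Real.exp_add]

end

/-! ### Two-sided control of the collision frequency. -/

section

/-- The angular integral equals π. With u = v⋆ - v as the variable, the dependence on v sits only in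
the smooth Maxwellian. -/
theorem collisionFrequency_eq (C γ : ℝ) (v : V3) :
    collisionFrequency C γ v =
      C * Real.pi * ∫ u : V3, maxwellian (v + u) * ‖u‖ ^ γ := by
  rw [collisionFrequency, ← integral_const_mul, ← integral_add_left_eq_self (μ := volume)
    (fun vs : V3 => ∫ _ϕ in (0 : ℝ)..(2 * Real.pi), ∫ θ in (0 : ℝ)..(Real.pi / 2),
    maxwellian vs * crossSection C γ ‖v - vs‖ θ) v]
  congr 1
  ext u
  have h1 : ∀ θ, maxwellian (v + u) * crossSection C γ ‖v - (v + u)‖ θ =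
      maxwellian (v + u) * C * ‖u‖ ^ γ * (Real.sin θ * Real.cos θ) := by
    intro θ
    rw [crossSection, sub_add_cancel_left, norm_neg]; ring
  simp only [h1, intervalIntegral.integral_const_mul, integral_sin_mul_cos₁]
  simp
  ring

theorem continuous_maxwellian : Continuous maxwellian := by
  unfold maxwellian; fun_prop

theorem maxwellian_pos (v : V3) : 0 < maxwellian v := by
  unfold maxwellian; positivity

theorem maxwellian_le (p : V3) : maxwellian p ≤ Real.exp (-‖p‖ ^ 2 / 4) := by
  have h1 : Real.pi ^ (-(3 / 2) : ℝ) ≤ 1 :=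
    Real.rpow_le_one_of_one_le_of_nonpos (by linarith [Real.pi_gt_three]) (by norm_num)
  have h2 : Real.exp (-‖p‖ ^ 2) ≤ Real.exp (-‖p‖ ^ 2 / 4) := by
    apply Real.exp_le_exp.2; nlinarith [sq_nonneg ‖p‖]
  have h3 : (0 : ℝ) ≤ Real.pi ^ (-(3 / 2) : ℝ) := by positivity
  rw [maxwellian]
  nlinarith [Real.exp_pos (-‖p‖ ^ 2)]

/-- The integral of the Gaussian weight against the kernel is finite. -/
theorem integrable_weight_kernel {γ : ℝ} (hγ₀ : 0 ≤ γ) (hγ₁ : γ ≤ 1) (v : V3) :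
    Integrable fun u : V3 => Real.exp (-‖v + u‖ ^ 2 / 4) * ‖u‖ ^ γ := by
  obtain ⟨c, -, hc⟩ := exists_lintegral_loss_le hγ₀ hγ₁
  refine ⟨by fun_prop, ?_⟩
  rw [hasFiniteIntegral_iff_ofReal (Filter.Eventually.of_forall fun u => by positivity)]
  refine lt_of_le_of_lt (lintegral_mono fun u => ?_) ((hc v).trans_lt ENNReal.ofReal_lt_top)
  exact le_mul_of_one_le_right (by positivity) (by simp)

theorem exists_integral_weight_kernel_le {γ : ℝ} (hγ₀ : 0 ≤ γ) (hγ₁ : γ ≤ 1) :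
    ∃ c : ℝ, 0 ≤ c ∧ ∀ v : V3,
      ∫ u : V3, Real.exp (-‖v + u‖ ^ 2 / 4) * ‖u‖ ^ γ ≤ c * (1 + ‖v‖) ^ γ := by
  obtain ⟨c, hc0, hc⟩ := exists_lintegral_loss_le hγ₀ hγ₁
  refine ⟨c, hc0, fun v => ?_⟩
  rw [integral_eq_lintegral_of_nonneg_ae (Filter.Eventually.of_forall fun u => by positivity)
    (by fun_prop)]
  refine ENNReal.toReal_le_of_le_ofReal (by positivity) (le_trans (lintegral_mono fun u => ?_) (hc v))
  exact le_mul_of_one_le_right (by positivity) (by simp)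

theorem integrable_maxwellian_kernel {γ : ℝ} (hγ₀ : 0 ≤ γ) (hγ₁ : γ ≤ 1) (v : V3) :
    Integrable fun u : V3 => maxwellian (v + u) * ‖u‖ ^ γ := by
  refine (integrable_weight_kernel hγ₀ hγ₁ v).mono' ?_ (Filter.Eventually.of_forall fun u => ?_)
  · have : Measurable fun u : V3 => maxwellian (v + u) :=
      (continuous_maxwellian.comp (continuous_const.add continuous_id)).measurable
    exact (this.mul (by fun_prop)).aestronglyMeasurable
  · have := (maxwellian_pos (v + u)).le
    rw [Real.norm_of_nonneg (by positivity)]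
    gcongr
    exact maxwellian_le _

/-- The Maxwellian is even, so p and -p can be averaged. The larger of |p - v| and |p + v| is at
least |p| and at least |v|, hence at least min(1,|p|)(1+|v|)/2, and raising this to the power γ
separates the two variables. -/
theorem exists_collisionFrequency_ge {C γ : ℝ} (hC : 0 < C) (hγ₀ : 0 ≤ γ) (hγ₁ : γ ≤ 1) :
    ∃ c : ℝ, 0 < c ∧ ∀ v : V3, c * (1 + ‖v‖) ^ γ ≤ collisionFrequency C γ v := by
  set J := ∫ p : V3, maxwellian p * min 1 ‖p‖ with hJ
  have hcm : Continuous fun p : V3 => maxwellian p * min 1 ‖p‖ :=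
    continuous_maxwellian.mul (by fun_prop)
  have hint : Integrable fun p : V3 => maxwellian p * min 1 ‖p‖ := by
    refine (integrable_gaussian (b := 1 / 4) (by norm_num)).mono' hcm.aestronglyMeasurable
      (Filter.Eventually.of_forall fun p => ?_)
    have h1 := maxwellian_le p
    have h2 := (maxwellian_pos p).le
    rw [Real.norm_of_nonneg (by positivity)]
    calc maxwellian p * min 1 ‖p‖ ≤ Real.exp (-‖p‖ ^ 2 / 4) * 1 := by
          gcongr
          exact min_le_left _ _
      _ = _ := by rw [mul_one]; congr 1; ring
  have hJpos : 0 < J := by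
    obtain ⟨e, he⟩ := exists_ne (0 : V3)
    refine integral_pos_of_integrable_nonneg_nonzero (x := e) hcm hint
      (fun p => mul_nonneg (maxwellian_pos p).le (by positivity)) ?_
    exact mul_ne_zero (maxwellian_pos e).ne'
      (lt_min one_pos (norm_pos_iff.2 he)).ne'
  refine ⟨C * Real.pi * (J / 4), by positivity, fun v => ?_⟩
  set f : V3 → ℝ := fun p => maxwellian p * ‖p - v‖ ^ γ with hf
  have e1 : ∫ u : V3, maxwellian (v + u) * ‖u‖ ^ γ = ∫ p, f p := by
    rw [← integral_add_left_eq_self (μ := volume) f v]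
    simp only [hf, add_sub_cancel_left]
  have hfi : Integrable f := by
    have := (integrable_maxwellian_kernel hγ₀ hγ₁ v).comp_add_left (-v)
    refine this.congr (Filter.Eventually.of_forall fun p => ?_)
    simp only [hf, add_neg_cancel_left]
    rw [neg_add_eq_sub]
  have e2 : ∫ p, f (-p) = ∫ p, f p := integral_neg_eq_self f volume
  set g := (1 + ‖v‖) ^ γ with hg
  have hpt : ∀ p, g / 2 * (maxwellian p * min 1 ‖p‖) ≤ f p + f (-p) := by
    intro p
    have hM := (maxwellian_pos p).le
    have hev : maxwellian (-p) = maxwellian p := by simp [maxwellian]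
    simp only [hf, hev, ← neg_add', norm_neg]
    have h0 : min 1 ‖p‖ * ((1 + ‖v‖) / 2) ≤ max ‖p - v‖ ‖p + v‖ := by
      have a1 : ‖p‖ ≤ max ‖p - v‖ ‖p + v‖ := by
        have h := norm_add_le (p - v) (p + v)
        rw [show p - v + (p + v) = (2 : ℝ) • p by module, norm_smul, Real.norm_two] at h
        have := le_max_left ‖p - v‖ ‖p + v‖
        have := le_max_right ‖p - v‖ ‖p + v‖
        linarith
      have a2 : ‖v‖ ≤ max ‖p - v‖ ‖p + v‖ := by
        have h := norm_sub_le (p + v) (p - v)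
        rw [show p + v - (p - v) = (2 : ℝ) • v by module, norm_smul, Real.norm_two] at h
        have := le_max_left ‖p - v‖ ‖p + v‖
        have := le_max_right ‖p - v‖ ‖p + v‖
        linarith
      have b1 := min_le_left 1 ‖p‖
      have b2 := min_le_right 1 ‖p‖
      have b3 : 0 ≤ min 1 ‖p‖ := by positivity
      rcases le_total ‖v‖ 1 with h | h
      · nlinarith
      · nlinarith
    have h1 : min 1 ‖p‖ * (g / 2) ≤ ‖p - v‖ ^ γ + ‖p + v‖ ^ γ := by
      have b3 : 0 ≤ min 1 ‖p‖ := by positivity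
      have c1 : (max ‖p - v‖ ‖p + v‖) ^ γ ≤ ‖p - v‖ ^ γ + ‖p + v‖ ^ γ := by
        rcases max_choice ‖p - v‖ ‖p + v‖ with h | h <;> rw [h]
        · linarith [Real.rpow_nonneg (norm_nonneg (p + v)) γ]
        · linarith [Real.rpow_nonneg (norm_nonneg (p - v)) γ]
      have c2 : min 1 ‖p‖ ≤ (min 1 ‖p‖) ^ γ := by
        rcases b3.eq_or_lt with h | h
        · rw [← h]; positivity
        · calc min 1 ‖p‖ = (min 1 ‖p‖) ^ (1 : ℝ) := (Real.rpow_one _).symm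
            _ ≤ _ := Real.rpow_le_rpow_of_exponent_ge h (min_le_left _ _) hγ₁
      have c3 : g / 2 ≤ ((1 + ‖v‖) / 2) ^ γ := by
        rw [Real.div_rpow (by positivity) (by positivity)]
        gcongr
        calc (2 : ℝ) ^ γ ≤ 2 ^ (1 : ℝ) := Real.rpow_le_rpow_of_exponent_le one_le_two hγ₁
          _ = 2 := Real.rpow_one _
      calc min 1 ‖p‖ * (g / 2) ≤ (min 1 ‖p‖) ^ γ * ((1 + ‖v‖) / 2) ^ γ := by gcongr
        _ = (min 1 ‖p‖ * ((1 + ‖v‖) / 2)) ^ γ := (Real.mul_rpow b3 (by positivity)).symm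
        _ ≤ (max ‖p - v‖ ‖p + v‖) ^ γ := by gcongr
        _ ≤ _ := c1
    nlinarith
  have hI : g / 2 * J ≤ 2 * ∫ p, f p := by
    have := integral_mono (hint.const_mul (g / 2)) (hfi.add hfi.comp_neg) hpt
    simp only [Pi.add_apply] at this
    rw [integral_const_mul, integral_add hfi hfi.comp_neg, e2] at this
    linarith
  rw [collisionFrequency_eq, e1]
  have : J / 4 * g ≤ ∫ p, f p := by linarith
  calc C * Real.pi * (J / 4) * g = C * Real.pi * (J / 4 * g) := by ring
    _ ≤ _ := by gcongr

/-- In the variable u the difference falls on the Maxwellian, so |u|^γ never has to be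
differentiated. -/
theorem exists_collisionFrequency_sub_le {C γ : ℝ} (hC : 0 < C) (hγ₀ : 0 ≤ γ) (hγ₁ : γ ≤ 1) :
    ∃ c : ℝ, 0 ≤ c ∧ ∀ v w : V3, ‖v - w‖ ≤ 1 →
      |collisionFrequency C γ v - collisionFrequency C γ w| ≤ c * (1 + ‖v‖) ^ γ * ‖v - w‖ := by
  obtain ⟨c, hc0, hc⟩ := exists_integral_weight_kernel_le hγ₀ hγ₁
  refine ⟨C * Real.pi * (Real.exp 16 * c), by positivity, fun v w hvw => ?_⟩
  have hpos : 0 < C * Real.pi := by positivity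
  rw [collisionFrequency_eq, collisionFrequency_eq, ← mul_sub, abs_mul, abs_of_pos hpos,
    ← integral_sub (integrable_maxwellian_kernel hγ₀ hγ₁ v)
      (integrable_maxwellian_kernel hγ₀ hγ₁ w),
    mul_assoc (C * Real.pi * _), mul_assoc (C * Real.pi)]
  refine mul_le_mul_of_nonneg_left ?_ hpos.le
  have hpt : ∀ u : V3, ‖maxwellian (v + u) * ‖u‖ ^ γ - maxwellian (w + u) * ‖u‖ ^ γ‖ ≤
      ‖v - w‖ * Real.exp 16 * (Real.exp (-‖v + u‖ ^ 2 / 4) * ‖u‖ ^ γ) := by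
    intro u
    have h1 := abs_gaussian_sub_le (β := 1) (p := v + u) (q := w + u) (by norm_num) le_rfl
      (by rwa [add_sub_add_right_eq_sub])
    rw [add_sub_add_right_eq_sub] at h1
    have h2 : Real.pi ^ (-(3 / 2) : ℝ) ≤ 1 :=
      Real.rpow_le_one_of_one_le_of_nonpos (by linarith [Real.pi_gt_three]) (by norm_num)
    have h3 : (0 : ℝ) ≤ Real.pi ^ (-(3 / 2) : ℝ) := by positivity
    rw [← sub_mul, norm_mul, Real.norm_eq_abs, Real.norm_of_nonneg (by positivity), ← mul_assoc]
    refine mul_le_mul_of_nonneg_right ?_ (by positivity)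
    rw [maxwellian, maxwellian, ← mul_sub, abs_mul, abs_of_nonneg h3]
    simp only [neg_mul, one_mul] at h1
    rw [mul_assoc]
    calc _ ≤ 1 * |Real.exp (-‖v + u‖ ^ 2) - Real.exp (-‖w + u‖ ^ 2)| := by gcongr
      _ ≤ _ := by rw [one_mul]; exact h1
  have h4 := norm_integral_le_of_norm_le ((integrable_weight_kernel hγ₀ hγ₁ v).const_mul _)
    (Filter.Eventually.of_forall hpt)
  rw [Real.norm_eq_abs, integral_const_mul] at h4
  refine h4.trans ?_
  calc _ ≤ ‖v - w‖ * Real.exp 16 * (c * (1 + ‖v‖) ^ γ) := by gcongr; exact hc v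
    _ = _ := by ring

end

/-! ### From bounded weak gradients to a locally Lipschitz representative. -/

section

open scoped Convolution

instance : Measure.IsAddHaarMeasure (volume : Measure (V3 × V3)) :=
  Measure.prod.instIsAddHaarMeasure _ _

instance : Measure.IsNegInvariant (volume : Measure (V3 × V3)) :=
  ⟨((Measure.measurePreserving_neg (volume : Measure V3)).prod
    (Measure.measurePreserving_neg (volume : Measure V3))).map_eq⟩

theorem isCompact_segment' (x y : V3 × V3) : IsCompact (segment ℝ x y) := by
  rw [segment_eq_image_lineMap]
  exact isCompact_Icc.image AffineMap.lineMap_continuous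

theorem convolution_mul_eq_lsmul (f g : V3 × V3 → ℝ) (z : V3 × V3) :
    (f ⋆[ContinuousLinearMap.mul ℝ ℝ, volume] g) z =
      (g ⋆[ContinuousLinearMap.lsmul ℝ ℝ, volume] f) z := by
  rw [convolution_mul_swap, convolution_lsmul]
  exact integral_congr_ae (Filter.Eventually.of_forall fun t => mul_comm _ _)

theorem isTestFunction_normed_bump {Ω : Set V3} (φ : ContDiffBump (0 : V3 × V3)) {z : V3 × V3}
    (hz : Metric.closedBall z φ.rOut ⊆ phaseSpace Ω) :
    IsTestFunction Ω fun y => φ.normed volume (z - y) := by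
  have hsub : tsupport (fun y => φ.normed volume (z - y)) ⊆ Metric.closedBall z φ.rOut := by
    refine closure_minimal (fun y hy => ?_) Metric.isClosed_closedBall
    have h1 : z - y ∈ Function.support (φ.normed volume) := hy
    rw [φ.support_normed_eq, mem_ball_zero_iff] at h1
    rw [mem_closedBall_iff_norm, norm_sub_rev]
    exact h1.le
  refine ⟨?_, ?_, hsub.trans hz⟩
  · exact φ.contDiff_normed.comp (contDiff_const.sub contDiff_id)
  · exact HasCompactSupport.of_support_subset_isCompact (isCompact_closedBall z φ.rOut)
      (subset_closure.trans hsub)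

/-- A bounded function with a bounded weak gradient on a convex open set `S` is Lipschitz on the
Lebesgue points of `S`. -/
theorem abs_convolution_sub_le {Ω : Set V3} (hΩ : IsOpen Ω) {f : V3 × V3 → ℝ}
    {GX GV : V3 × V3 → V3} (hX : IsWeakGradX Ω f GX) (hV : IsWeakGradV Ω f GV)
    (hloc : LocallyIntegrable (indicator (phaseSpace Ω) f))
    {S : Set (V3 × V3)} (hS : S ⊆ phaseSpace Ω) {m : ℝ}
    (hm : ∀ᵐ z ∂volume.restrict (phaseSpace Ω), z ∈ S → ‖GX z‖ + ‖GV z‖ ≤ m)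
    (φ : ContDiffBump (0 : V3 × V3)) {z₁ z₂ : V3 × V3}
    (hseg : ∀ z ∈ segment ℝ z₁ z₂, Metric.closedBall z φ.rOut ⊆ S) :
    |(indicator (phaseSpace Ω) f ⋆[ContinuousLinearMap.mul ℝ ℝ, volume] φ.normed volume) z₁ -
      (indicator (phaseSpace Ω) f ⋆[ContinuousLinearMap.mul ℝ ℝ, volume] φ.normed volume) z₂|
        ≤ m * ‖z₁ - z₂‖ := by
  have hmeas : MeasurableSet (phaseSpace Ω) := (hΩ.prod isOpen_univ).measurableSet
  set f₀ := indicator (phaseSpace Ω) f with hf₀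
  set ψ := φ.normed (volume : Measure (V3 × V3)) with hψ
  have hψc : HasCompactSupport ψ := φ.hasCompactSupport_normed
  have hψd : ContDiff ℝ 1 ψ := φ.contDiff_normed
  have hder := fun z => hψc.hasFDerivAt_convolution_right (ContinuousLinearMap.mul ℝ ℝ) hloc hψd z
  have hbound : ∀ z ∈ segment ℝ z₁ z₂,
      ‖(f₀ ⋆[(ContinuousLinearMap.mul ℝ ℝ).precompR (V3 × V3), volume] fderiv ℝ ψ) z‖ ≤ m := by
    intro z hz
    have hball := hseg z hz
    have htest := isTestFunction_normed_bump φ (hball.trans hS)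
    have hm' : ∀ᵐ y ∂volume.restrict (phaseSpace Ω), ψ (z - y) ≠ 0 → ‖GX y‖ + ‖GV y‖ ≤ m := by
      filter_upwards [hm] with y hy hne
      apply hy
      apply hball
      have h1 : z - y ∈ Function.support (φ.normed volume) := hne
      rw [φ.support_normed_eq, mem_ball_zero_iff] at h1
      rw [mem_closedBall_iff_norm, norm_sub_rev]
      exact h1.le
    have hint1 : Integrable (fun y => ψ (z - y)) := φ.integrable_normed.comp_sub_left z
    have hone : ∫ y, ψ (z - y) = 1 := by
      rw [integral_sub_left_eq_self ψ volume z]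
      exact φ.integral_normed
    have hnn : ∀ y, 0 ≤ ψ (z - y) := fun y => φ.nonneg_normed _
    -- The mollifier has mass one inside `S`, so the bound holds at some point of its support and m
    -- cannot be negative.
    have hm0 : 0 ≤ m := by
      by_contra hneg
      have h0 : ∀ᵐ y ∂volume.restrict (phaseSpace Ω), ψ (z - y) = 0 := by
        filter_upwards [hm'] with y hy
        by_contra hne
        exact hneg ((by positivity : (0 : ℝ) ≤ _).trans (hy hne))
      have h1 : ∫ y in phaseSpace Ω, ψ (z - y) = 0 := integral_eq_zero_of_ae h0
      rw [setIntegral_eq_integral_of_forall_compl_eq_zero, hone] at h1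
      · exact one_ne_zero h1
      · intro y hy
        by_contra hne
        exact hy (htest.tsupport_subset (subset_closure hne))
    have hfd : ∀ y e, fderiv ℝ (fun y => ψ (z - y)) y e = -(fderiv ℝ ψ (z - y) e) := by
      intro y e
      have h1 : HasFDerivAt ψ (fderiv ℝ ψ (z - y)) (z - y) :=
        (hψd.differentiable one_ne_zero _).hasFDerivAt
      have h2 : HasFDerivAt (fun y => z - y) (-(ContinuousLinearMap.id ℝ (V3 × V3))) y :=
        (hasFDerivAt_id y).const_sub z
      have h3 := (h1.comp y h2).fderiv
      have h4 : (ψ ∘ fun y => z - y) = fun y => ψ (z - y) := rfl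
      rw [h4] at h3
      rw [h3]
      simp
    -- The derivative of the mollification is a pairing of f with the derivative of a test function,
    -- to which the definition of the weak gradient applies.
    have hD : ∀ e, (f₀ ⋆[(ContinuousLinearMap.mul ℝ ℝ).precompR (V3 × V3), volume] fderiv ℝ ψ) z e
        = -∫ y in phaseSpace Ω, f y * fderiv ℝ (fun y => ψ (z - y)) y e := by
      intro e
      rw [convolution_precompR_apply _ hloc (hψc.fderiv ℝ) (hψd.continuous_fderiv one_ne_zero),
        convolution_mul, ← integral_neg, ← integral_indicator hmeas]
      congr 1
      ext y
      by_cases hy : y ∈ phaseSpace Ω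
      · simp [hf₀, hy, hfd]
      · simp [hf₀, hy]
    have hintG : ∀ (G : V3 × V3 → V3), LocallyIntegrableOn G (phaseSpace Ω) volume → ∀ e : V3,
        Integrable (fun y => inner ℝ (G y) e * ψ (z - y)) (volume.restrict (phaseSpace Ω)) := by
      intro G hG e
      have hK := hG.integrableOn_compact_subset htest.tsupport_subset htest.hasCompactSupport
      have h1 : IntegrableOn (fun y => inner ℝ (G y) e * ψ (z - y))
          (tsupport fun y => ψ (z - y)) := by
        have hGe : IntegrableOn (fun y => inner ℝ (G y) e) (tsupport fun y => ψ (z - y)) :=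
          hK.inner_const e
        exact hGe.mul_continuousOn (htest.contDiff.continuous.continuousOn)
          htest.hasCompactSupport
      refine (h1.of_forall_sdiff_eq_zero hmeas ?_)
      intro y hy
      have : ψ (z - y) = 0 := image_eq_zero_of_notMem_tsupport (f := fun y => ψ (z - y)) hy.2
      rw [this, mul_zero]
    -- The product carries the maximum norm, so the sum of the norms of the two partial gradients
    -- controls the operator norm.
    refine ContinuousLinearMap.opNorm_le_bound _ hm0 fun e => ?_
    have hsplit : e = (e.1, 0) + (0, e.2) := by simp
    have hi1 := hintG GX hX.locallyIntegrableOn_grad e.1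
    have hi2 := hintG GV hV.locallyIntegrableOn_grad e.2
    rw [hsplit, map_add, hD, hD, hX.integral_eq _ htest, hV.integral_eq _ htest, neg_neg, neg_neg,
      ← integral_add hi1 hi2, ← hsplit]
    have hle : ‖∫ y in phaseSpace Ω, (inner ℝ (GX y) e.1 * ψ (z - y) +
        inner ℝ (GV y) e.2 * ψ (z - y))‖ ≤ ∫ y in phaseSpace Ω, m * ‖e‖ * ψ (z - y) := by
      refine norm_integral_le_of_norm_le ((hint1.const_mul _).restrict) ?_
      filter_upwards [hm'] with y hy
      rw [← add_mul, norm_mul, Real.norm_of_nonneg (hnn y)]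
      by_cases h0 : ψ (z - y) = 0
      · simp [h0]
      · refine mul_le_mul_of_nonneg_right ?_ (hnn y)
        refine (norm_add_le _ _).trans ?_
        have a1 := norm_inner_le_norm (𝕜 := ℝ) (GX y) e.1
        have a2 := norm_inner_le_norm (𝕜 := ℝ) (GV y) e.2
        have a3 := norm_fst_le e
        have a4 := norm_snd_le e
        calc _ ≤ ‖GX y‖ * ‖e.1‖ + ‖GV y‖ * ‖e.2‖ := add_le_add a1 a2
          _ ≤ ‖GX y‖ * ‖e‖ + ‖GV y‖ * ‖e‖ := by gcongr
          _ = (‖GX y‖ + ‖GV y‖) * ‖e‖ := by ring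
          _ ≤ _ := by gcongr; exact hy h0
    refine hle.trans ?_
    rw [integral_const_mul]
    refine mul_le_of_le_one_right (by positivity) ?_
    rw [← hone]
    exact setIntegral_le_integral hint1 (Filter.Eventually.of_forall hnn)
  have h := (convex_segment z₁ z₂).norm_image_sub_le_of_norm_hasFDerivWithin_le
    (fun z _ => (hder z).hasFDerivWithinAt) hbound (right_mem_segment ℝ z₁ z₂)
    (left_mem_segment ℝ z₁ z₂)
  exact h

/-- A bounded function whose weak gradient is bounded by a continuous function `b` on an open set
`U` of full measure has a representative that is locally Lipschitz with constants given by `b`. -/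
theorem exists_lipschitz_representative {Ω : Set V3} (hΩ : IsOpen Ω) {f : V3 × V3 → ℝ}
    {GX GV : V3 × V3 → V3} (hX : IsWeakGradX Ω f GX) (hV : IsWeakGradV Ω f GV) {B : ℝ}
    (hB : ∀ᵐ z ∂volume.restrict (phaseSpace Ω), |f z| ≤ B)
    {U : Set (V3 × V3)} (hU : IsOpen U) (hUΩ : U ⊆ phaseSpace Ω) {b : V3 × V3 → ℝ}
    (hbc : ContinuousOn b U) (hb0 : ∀ z ∈ U, 0 ≤ b z)
    (hb : ∀ᵐ z ∂volume.restrict (phaseSpace Ω), ‖GX z‖ + ‖GV z‖ ≤ b z) :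
    ∃ F : V3 × V3 → ℝ, ContinuousOn F U ∧ (∀ᵐ z ∂volume.restrict U, F z = f z) ∧
      ∀ z₁ z₂, segment ℝ z₁ z₂ ⊆ U → ∀ m, (∀ z ∈ segment ℝ z₁ z₂, b z ≤ m) →
        |F z₁ - F z₂| ≤ m * ‖z₁ - z₂‖ := by
  have hmeas : MeasurableSet (phaseSpace Ω) := (hΩ.prod isOpen_univ).measurableSet
  have hloc : LocallyIntegrable (indicator (phaseSpace Ω) f) := by
    have h1 : MemLp f ∞ (volume.restrict (phaseSpace Ω)) :=
      memLp_top_of_bound hX.locallyIntegrableOn.aestronglyMeasurable B hB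
    exact ((memLp_indicator_iff_restrict hmeas).2 h1).locallyIntegrable le_top
  set φ : ℕ → ContDiffBump (0 : V3 × V3) := fun k =>
    ⟨1 / ((k : ℝ) + 1), 2 * (1 / ((k : ℝ) + 1)), by positivity, by
      have : (0 : ℝ) < 1 / ((k : ℝ) + 1) := by positivity
      linarith⟩ with hφ
  have hrout : Filter.Tendsto (fun k => (φ k).rOut) Filter.atTop (𝓝 0) := by
    have := tendsto_one_div_add_atTop_nhds_zero_nat (𝕜 := ℝ)
    simpa [hφ] using this.const_mul 2
  have hconv := ContDiffBump.ae_convolution_tendsto_right_of_locallyIntegrable (K := 2)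
    (μ := (volume : Measure (V3 × V3))) hrout
    (Filter.Eventually.of_forall fun k => by simp [hφ]) hloc
  set fk : ℕ → V3 × V3 → ℝ := fun k => indicator (phaseSpace Ω) f
    ⋆[ContinuousLinearMap.mul ℝ ℝ, volume] (φ k).normed volume with hfk
  -- Almost every point of U lies in D, so D is dense in U; f is locally Lipschitz on D and the
  -- representative is its extension by limits.
  set D : Set (V3 × V3) := {z | z ∈ U ∧ Filter.Tendsto (fun k => fk k z) Filter.atTop (𝓝 (f z))}
    with hD
  have hDae : ∀ᵐ z ∂(volume : Measure (V3 × V3)), z ∈ U → z ∈ D := by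
    filter_upwards [hconv] with z hz hzU
    refine ⟨hzU, ?_⟩
    rw [indicator_of_mem (hUΩ hzU)] at hz
    convert hz using 1
    ext k
    exact convolution_mul_eq_lsmul _ _ _
  have hdense : U ⊆ closure D := by
    intro z hz
    rw [mem_closure_iff]
    intro O hO hzO
    have hpos : 0 < volume (O ∩ U) := (hO.inter hU).measure_pos volume ⟨z, hzO, hz⟩
    by_contra hne
    have hsub : O ∩ U ⊆ {z | ¬(z ∈ U → z ∈ D)} := by
      rintro y ⟨hyO, hyU⟩ hcon
      exact hne ⟨y, hyO, hcon hyU⟩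
    exact hpos.ne' (measure_mono_null hsub hDae)
  have hcore : ∀ S : Set (V3 × V3), IsOpen S → Convex ℝ S → S ⊆ U → ∀ m : ℝ, (∀ z ∈ S, b z ≤ m) →
      ∀ z₁ ∈ D ∩ S, ∀ z₂ ∈ D ∩ S, |f z₁ - f z₂| ≤ m * ‖z₁ - z₂‖ := by
    intro S hSo hSc hSU m hbm z₁ hz₁ z₂ hz₂
    have hlim : Filter.Tendsto (fun k => |fk k z₁ - fk k z₂|) Filter.atTop
        (𝓝 |f z₁ - f z₂|) := (hz₁.1.2.sub hz₂.1.2).abs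
    refine le_of_tendsto hlim ?_
    have hcpt : IsCompact (segment ℝ z₁ z₂) := isCompact_segment' z₁ z₂
    obtain ⟨δ, hδ, hthick⟩ := hcpt.exists_thickening_subset_open hSo (hSc.segment_subset hz₁.2 hz₂.2)
    filter_upwards [hrout.eventually (gt_mem_nhds hδ)] with k hk
    refine abs_convolution_sub_le hΩ hX hV hloc (hSU.trans hUΩ) ?_ (φ k) ?_
    · filter_upwards [hb] with z hz hzS using hz.trans (hbm z hzS)
    · intro z hz y hy
      apply hthick
      rw [Metric.mem_thickening_iff]
      exact ⟨z, hz, (Metric.mem_closedBall.1 hy).trans_lt hk⟩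
  have hext : ∀ S : Set (V3 × V3), IsOpen S → Convex ℝ S → S ⊆ U → ∀ m : ℝ, 0 ≤ m →
      (∀ z ∈ S, b z ≤ m) → ∃ H : V3 × V3 → ℝ, LipschitzWith m.toNNReal H ∧
        (∀ z ∈ S, extendFrom D f z = H z) ∧ ∀ z ∈ D ∩ S, f z = H z := by
    intro S hSo hSc hSU m hm0 hbm
    have hl : LipschitzOnWith m.toNNReal f (D ∩ S) := by
      refine LipschitzOnWith.of_dist_le_mul fun x hx y hy => ?_
      rw [Real.dist_eq, dist_eq_norm, Real.coe_toNNReal m hm0]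
      exact hcore S hSo hSc hSU m hbm x hx y hy
    obtain ⟨H, hH, hEq⟩ := hl.extend_real
    refine ⟨H, hH, fun z hz => ?_, fun z hz => hEq hz⟩
    refine extendFrom_eq (hdense (hSU hz)) ?_
    have h1 : Filter.Tendsto H (𝓝[D] z) (𝓝 (H z)) :=
      (hH.continuous.tendsto z).mono_left nhdsWithin_le_nhds
    refine h1.congr' ?_
    filter_upwards [self_mem_nhdsWithin, mem_nhdsWithin_of_mem_nhds (hSo.mem_nhds hz)] with y hy hyS
    exact (hEq ⟨hy, hyS⟩).symm
  have hball : ∀ z ∈ U, ∃ S : Set (V3 × V3), IsOpen S ∧ Convex ℝ S ∧ S ⊆ U ∧ z ∈ S ∧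
      ∀ y ∈ S, b y ≤ b z + 1 := by
    intro z hz
    have h1 : ∀ᶠ y in 𝓝 z, y ∈ U ∧ b y < b z + 1 :=
      Filter.Eventually.and (hU.mem_nhds hz) ((hbc.continuousAt (hU.mem_nhds hz)).eventually
        (gt_mem_nhds (lt_add_one _)))
    obtain ⟨ε, hε, h2⟩ := Metric.eventually_nhds_iff_ball.1 h1
    exact ⟨Metric.ball z ε, Metric.isOpen_ball, convex_ball z ε, fun y hy => (h2 y hy).1,
      Metric.mem_ball_self hε, fun y hy => (h2 y hy).2.le⟩
  refine ⟨extendFrom D f, ?_, ?_, ?_⟩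
  · intro z hz
    obtain ⟨S, hSo, hSc, hSU, hzS, hbS⟩ := hball z hz
    obtain ⟨H, hH, h1, -⟩ := hext S hSo hSc hSU _ (by linarith [hb0 z hz]) hbS
    have : extendFrom D f =ᶠ[𝓝 z] H := by
      filter_upwards [hSo.mem_nhds hzS] with y hy using h1 y hy
    exact (hH.continuous.continuousAt.congr this.symm).continuousWithinAt
  · rw [ae_restrict_iff' hU.measurableSet]
    filter_upwards [hDae] with z hzD hz
    obtain ⟨S, hSo, hSc, hSU, hzS, hbS⟩ := hball z hz
    obtain ⟨H, hH, h1, h2⟩ := hext S hSo hSc hSU _ (by linarith [hb0 z hz]) hbS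
    rw [h1 z hzS, h2 z ⟨hzD hz, hzS⟩]
  · intro z₁ z₂ hseg m hbm
    have hm0 : 0 ≤ m := (hb0 _ (hseg (left_mem_segment ℝ z₁ z₂))).trans
      (hbm _ (left_mem_segment ℝ z₁ z₂))
    -- The bound m is known only on the segment. By continuity m + η bounds b on a thickening of it,
    -- which is open and convex.
    have hη : ∀ η > 0, |extendFrom D f z₁ - extendFrom D f z₂| ≤ (m + η) * ‖z₁ - z₂‖ := by
      intro η hη
      have hO : IsOpen (U ∩ b ⁻¹' Iio (m + η)) := hbc.isOpen_inter_preimage hU isOpen_Iio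
      have hcpt : IsCompact (segment ℝ z₁ z₂) := isCompact_segment' z₁ z₂
      have hsub : segment ℝ z₁ z₂ ⊆ U ∩ b ⁻¹' Iio (m + η) := fun z hz =>
        ⟨hseg hz, (hbm z hz).trans_lt (lt_add_of_pos_right m hη)⟩
      obtain ⟨δ, hδ, hthick⟩ := hcpt.exists_thickening_subset_open hO hsub
      obtain ⟨H, hH, h1, -⟩ := hext _ Metric.isOpen_thickening
        ((convex_segment z₁ z₂).thickening δ) (hthick.trans inter_subset_left) (m + η)
        (by linarith) (fun z hz => (hthick hz).2.le)
      have hs := Metric.self_subset_thickening hδ (segment ℝ z₁ z₂)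
      rw [h1 _ (hs (left_mem_segment ℝ z₁ z₂)), h1 _ (hs (right_mem_segment ℝ z₁ z₂))]
      have := hH.dist_le_mul z₁ z₂
      rwa [Real.dist_eq, dist_eq_norm, Real.coe_toNNReal _ (by linarith)] at this
    have hlim : Filter.Tendsto (fun η : ℝ => (m + η) * ‖z₁ - z₂‖) (𝓝[>] 0)
        (𝓝 ((m + 0) * ‖z₁ - z₂‖)) := by
      have : Continuous fun η : ℝ => (m + η) * ‖z₁ - z₂‖ := by fun_prop
      exact (this.tendsto 0).mono_left nhdsWithin_le_nhds
    rw [add_zero] at hlim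
    refine ge_of_tendsto hlim ?_
    filter_upwards [self_mem_nhdsWithin] with η hη' using hη η hη'

end

/-! ### Functions whose local Lipschitz constants are controlled by the inverse weight. -/

section

/-- The factor `√(2R / d(x, ∂Ω))`, which dominates `1 / N(x, v)` for all `v`. -/
def boundaryFactor (Ω : Set V3) (R : ℝ) (x : V3) : ℝ := √(2 * R / Metric.infDist x Ωᶜ)

theorem boundaryFactor_nonneg (Ω : Set V3) (R : ℝ) (x : V3) : 0 ≤ boundaryFactor Ω R x :=
  Real.sqrt_nonneg _

/-- Functions with Gaussian decay that are locally Lipschitz on `Ω × (ℝ³ ∖ {0})`, with Lipschitz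
constants controlled by the inverse of the weight. -/
structure IsWeightedLipschitz (Ω : Set V3) (α A : ℝ) (h : V3 × V3 → ℝ) : Prop where
  measurable : Measurable h
  abs_le : ∀ z, |h z| ≤ A * Real.exp (-α * ‖z.2‖ ^ 2)
  abs_sub_le_of_segment : ∀ z₁ z₂, segment ℝ z₁ z₂ ⊆ Ω ×ˢ ({0}ᶜ : Set V3) → ∀ m,
    (∀ z ∈ segment ℝ z₁ z₂, A * Real.exp (-α * ‖z.2‖ ^ 2) * (weight Ω z)⁻¹ ≤ m) →
      |h z₁ - h z₂| ≤ m * ‖z₁ - z₂‖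

theorem phaseSpace_ae_eq (Ω : Set V3) :
    (Ω ×ˢ ({0}ᶜ : Set V3) : Set (V3 × V3)) =ᵐ[volume] phaseSpace Ω := by
  have h0 : ∀ᵐ z : V3 × V3, z.2 ≠ 0 := by
    have : volume (univ ×ˢ ({0} : Set V3) : Set (V3 × V3)) = 0 := by
      rw [Measure.volume_eq_prod, Measure.prod_prod]; simp
    refine measure_mono_null (fun z hz => ?_) this
    simpa using hz
  filter_upwards [h0] with z hz
  simp only [eq_iff_iff]
  constructor
  · exact fun h => ⟨h.1, mem_univ _⟩
  · exact fun h => ⟨h.1, hz⟩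

theorem ae_le_of_supNorm_lt {E : Type*} [NormedAddCommGroup E] {Ω : Set V3} {α A : ℝ}
    {f : V3 × V3 → E} (h : supNorm Ω α f < ENNReal.ofReal A) :
    ∀ᵐ z ∂volume.restrict (phaseSpace Ω), ‖f z‖ ≤ A * Real.exp (-α * ‖z.2‖ ^ 2) := by
  have hA : 0 < A := by
    by_contra hA
    rw [ENNReal.ofReal_of_nonpos (not_lt.1 hA)] at h
    exact not_lt_bot h
  have h1 := ENNReal.ae_le_essSup (μ := volume.restrict (phaseSpace Ω))
    (fun z => ENNReal.ofReal (Real.exp (α * ‖z.2‖ ^ 2)) * ‖f z‖ₑ)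
  filter_upwards [h1] with z hz
  have h2 := hz.trans h.le
  rw [← ofReal_norm, ← ENNReal.ofReal_mul (by positivity), ENNReal.ofReal_le_ofReal_iff hA.le] at h2
  have h3 : Real.exp (-α * ‖z.2‖ ^ 2) * Real.exp (α * ‖z.2‖ ^ 2) = 1 := by
    rw [← Real.exp_add]; simp
  have h4 := mul_le_mul_of_nonneg_left h2 (Real.exp_pos (-α * ‖z.2‖ ^ 2)).le
  rw [← mul_assoc, h3, one_mul] at h4
  linarith

/-- The strict inequality selects weak gradients from the infima in the norm; adding the bounds in x
and in v gives the factor 2. The inverse weight is continuous off v = 0, so the representative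
theorem applies with it as the bound. -/
theorem exists_isWeightedLipschitz {Ω : Set V3} {R r α A : ℝ} {h : V3 × V3 → ℝ}
    (hΩ : UniformlyRound Ω (outwardNormal Ω) R r) (hα : 0 ≤ α)
    (hA : hatNorm Ω α h < ENNReal.ofReal A) :
    ∃ H, IsWeightedLipschitz Ω α (2 * A) H ∧ ∀ᵐ z ∂volume.restrict (phaseSpace Ω), H z = h z := by
  have hApos : 0 < A := by
    by_contra hA'
    rw [ENNReal.ofReal_of_nonpos (not_lt.1 hA')] at hA
    exact not_lt_bot hA
  have hs : supNorm Ω α h < ENNReal.ofReal A :=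
    lt_of_le_of_lt (le_add_right (le_add_right le_rfl)) hA
  have hx : gradXNorm Ω α h < ENNReal.ofReal A :=
    lt_of_le_of_lt (le_add_right (le_add_left le_rfl)) hA
  have hv : gradVNorm Ω α h < ENNReal.ofReal A := lt_of_le_of_lt (le_add_left le_rfl) hA
  simp only [gradXNorm, gradVNorm, iInf_lt_iff] at hx hv
  obtain ⟨GX, hGX, hx⟩ := hx
  obtain ⟨GV, hGV, hv⟩ := hv
  have bs := ae_le_of_supNorm_lt hs
  have bx := ae_le_of_supNorm_lt hx
  have bv := ae_le_of_supNorm_lt hv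
  set U : Set (V3 × V3) := Ω ×ˢ ({0}ᶜ : Set V3) with hU
  have hUo : IsOpen U := hΩ.isOpen_prod
  have hrestr : volume.restrict U = volume.restrict (phaseSpace Ω) :=
    Measure.restrict_congr_set (phaseSpace_ae_eq Ω)
  set b : V3 × V3 → ℝ := fun z => 2 * A * Real.exp (-α * ‖z.2‖ ^ 2) * (weight Ω z)⁻¹ with hb
  have hbc : ContinuousOn b U :=
    ContinuousOn.mul (by fun_prop) (hΩ.continuousOn_weight.inv₀ fun z hz => (hΩ.weight_pos hz).ne')
  have hbG : ∀ᵐ z ∂volume.restrict (phaseSpace Ω), ‖GX z‖ + ‖GV z‖ ≤ b z := by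
    have hmem : ∀ᵐ z ∂volume.restrict (phaseSpace Ω), z ∈ U := by
      rw [← hrestr]; exact ae_restrict_mem hUo.measurableSet
    filter_upwards [bx, bv, hmem] with z h1 h2 hz
    have hw := hΩ.weight_pos hz
    rw [norm_smul, Real.norm_of_nonneg hw.le] at h1 h2
    rw [hb]
    simp only
    rw [← div_eq_mul_inv, le_div_iff₀ hw]
    linarith
  obtain ⟨F, hFc, hFae, hFseg⟩ := exists_lipschitz_representative hΩ.isOpen hGX hGV (B := A) (by
    filter_upwards [bs] with z hz
    rw [← Real.norm_eq_abs]
    refine hz.trans (mul_le_of_le_one_right hApos.le ?_)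
    rw [Real.exp_le_one_iff]
    nlinarith [sq_nonneg ‖z.2‖]) hUo (fun z hz => ⟨hz.1, mem_univ _⟩) hbc
    (fun z hz => mul_nonneg (by positivity) (inv_nonneg.2 (hΩ.weight_pos hz).le)) hbG
  -- The bound holds almost everywhere and F is continuous: the set where it fails is open and null,
  -- hence empty.
  have hFb : ∀ z ∈ U, |F z| ≤ A * Real.exp (-α * ‖z.2‖ ^ 2) := by
    intro z hz
    by_contra hcon
    rw [not_le] at hcon
    have hO : IsOpen (U ∩ (fun z => |F z| - A * Real.exp (-α * ‖z.2‖ ^ 2)) ⁻¹' Ioi 0) :=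
      (hFc.abs.sub (by fun_prop)).isOpen_inter_preimage hUo isOpen_Ioi
    have hpos := hO.measure_pos volume ⟨z, hz, sub_pos.2 hcon⟩
    have hnull : ∀ᵐ z ∂volume.restrict U, |F z| ≤ A * Real.exp (-α * ‖z.2‖ ^ 2) := by
      rw [← hrestr] at bs
      filter_upwards [hFae, bs] with z h1 h2
      rw [h1, ← Real.norm_eq_abs]
      exact h2
    rw [ae_restrict_iff' hUo.measurableSet] at hnull
    refine hpos.ne' (measure_mono_null (fun y hy => ?_) hnull)
    intro hcon2
    have h1 := hcon2 hy.1
    have h2 : 0 < |F y| - A * Real.exp (-α * ‖y.2‖ ^ 2) := hy.2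
    linarith
  refine ⟨indicator U F, ⟨?_, ?_, ?_⟩, ?_⟩
  · classical
    have h1 := hFc.measurable_piecewise (continuousOn_const (c := (0 : ℝ)) (s := Uᶜ))
      hUo.measurableSet
    change Measurable (U.piecewise F 0) at h1
    rwa [piecewise_eq_indicator] at h1
  · intro z
    by_cases hz : z ∈ U
    · rw [indicator_of_mem hz]
      refine (hFb z hz).trans ?_
      nlinarith [Real.exp_pos (-α * ‖z.2‖ ^ 2)]
    · rw [indicator_of_notMem hz, abs_zero]
      positivity
  · intro z₁ z₂ hseg m hm
    rw [indicator_of_mem (hseg (left_mem_segment ℝ z₁ z₂)),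
      indicator_of_mem (hseg (right_mem_segment ℝ z₁ z₂))]
    exact hFseg z₁ z₂ hseg m hm
  · rw [← hrestr]
    filter_upwards [hFae, ae_restrict_mem hUo.measurableSet] with z h1 h2
    rw [indicator_of_mem h2, h1]

namespace IsWeightedLipschitz

variable {Ω : Set V3} {R r α A : ℝ} {h : V3 × V3 → ℝ}

theorem nonneg (hh : IsWeightedLipschitz Ω α A h) : 0 ≤ A := by
  have h1 := (abs_nonneg _).trans (hh.abs_le 0)
  simpa using h1

theorem exp_neg_le (hα : 0 ≤ α) {p q : V3} {t : ℝ} (hq : ‖p - q‖ ≤ t) :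
    Real.exp (-α * ‖q‖ ^ 2) ≤ Real.exp (-α * ‖p‖ ^ 2 + 2 * α * ‖p‖ * t) := by
  apply Real.exp_le_exp.2
  have h1 := norm_sq_ge (p := p) (q := q)
  have h2 : ‖p‖ * ‖p - q‖ ≤ ‖p‖ * t := by gcongr
  nlinarith

/-- The distance to the boundary along the segment is at least its smaller end value, so the inverse
weight there is bounded by the sum of the two end factors. -/
theorem abs_sub_le_space (hh : IsWeightedLipschitz Ω α A h)
    (hΩ : UniformlyRound Ω (outwardNormal Ω) R r) {x y p : V3} (hx : x ∈ Ω) (hy : y ∈ Ω)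
    (hp : p ≠ 0) : |h (x, p) - h (y, p)| ≤ A * Real.exp (-α * ‖p‖ ^ 2) * ((1 + ‖p‖⁻¹) *
      (boundaryFactor Ω R x + boundaryFactor Ω R y)) * ‖x - y‖ := by
  have hA := hh.nonneg
  have hsub : segment ℝ ((x, p) : V3 × V3) (y, p) ⊆ segment ℝ x y ×ˢ segment ℝ p p :=
    Prod.segment_subset _ _
  rw [segment_same] at hsub
  have hR := hΩ.pos_R
  have h1 := hh.abs_sub_le_of_segment (x, p) (y, p) (fun z hz => ⟨hΩ.convex.segment_subset hx hy
    (hsub hz).1, by rw [(hsub hz).2]; exact hp⟩) (A * Real.exp (-α * ‖p‖ ^ 2) * ((1 + ‖p‖⁻¹) *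
      (boundaryFactor Ω R x + boundaryFactor Ω R y))) (by
    intro z hz
    have hzx := hΩ.convex.segment_subset hx hy (hsub hz).1
    have hzp : z.2 = p := (hsub hz).2
    rw [hzp]
    have hz' : z ∈ Ω ×ˢ ({0}ᶜ : Set V3) := ⟨hzx, by rw [hzp]; exact hp⟩
    refine mul_le_mul_of_nonneg_left ?_ (by positivity)
    refine (hΩ.inv_weight_le hz').trans ?_
    rw [hzp]
    refine mul_le_mul_of_nonneg_left ?_ (by positivity)
    have hdx := hΩ.infDist_pos hx
    have hdy := hΩ.infDist_pos hy
    rcases le_total (Metric.infDist x Ωᶜ) (Metric.infDist y Ωᶜ) with hle | hle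
    · have := hΩ.le_infDist_segment le_rfl hle (hsub hz).1
      refine le_trans ?_ (le_add_of_nonneg_right (boundaryFactor_nonneg Ω R y))
      exact Real.sqrt_le_sqrt (by gcongr)
    · have := hΩ.le_infDist_segment hle le_rfl (hsub hz).1
      refine le_trans ?_ (le_add_of_nonneg_left (boundaryFactor_nonneg Ω R x))
      exact Real.sqrt_le_sqrt (by gcongr))
  refine h1.trans (le_of_eq ?_)
  congr 1
  simp [Prod.norm_def]

/-- If |p - q| ≤ |p|/2, the segment avoids zero velocity and |p| at most halves along it. Otherwise
|p - q|/|p| is at least 1/2 and the pointwise bounds of h suffice. Only the norm of p enters, so q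
may vanish. -/
theorem abs_sub_le_velocity (hh : IsWeightedLipschitz Ω α A h) (hα : 0 ≤ α)
    (hΩ : UniformlyRound Ω (outwardNormal Ω) R r) {x p q : V3} (hx : x ∈ Ω) (hp : p ≠ 0) :
    |h (x, p) - h (x, q)| ≤ 4 * (A * Real.exp (-α * ‖p‖ ^ 2 + 2 * α * ‖p‖ * ‖p - q‖)) *
      ((1 + ‖p‖⁻¹) * boundaryFactor Ω R x) * ‖p - q‖ := by
  have hA := hh.nonneg
  have hn := norm_pos_iff.2 hp
  have hδ : 1 ≤ boundaryFactor Ω R x := hΩ.one_le_sqrt hx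
  set E := Real.exp (-α * ‖p‖ ^ 2 + 2 * α * ‖p‖ * ‖p - q‖) with hE
  have hE0 : 0 < E := Real.exp_pos _
  rcases le_or_gt ‖p - q‖ (‖p‖ / 2) with ht | ht
  · have hsub : segment ℝ ((x, p) : V3 × V3) (x, q) ⊆ segment ℝ x x ×ˢ segment ℝ p q :=
      Prod.segment_subset _ _
    rw [segment_same] at hsub
    have hdist : ∀ y ∈ segment ℝ p q, ‖p - y‖ ≤ ‖p - q‖ := by
      intro y hy
      have := norm_sub_le_of_mem_segment hy
      rwa [norm_sub_rev y, norm_sub_rev q] at this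
    have hnorm : ∀ y ∈ segment ℝ p q, ‖p‖ / 2 ≤ ‖y‖ := by
      intro y hy
      have h1 := hdist y hy
      have h2 := norm_sub_norm_le p y
      linarith
    have hmem : ∀ z ∈ segment ℝ ((x, p) : V3 × V3) (x, q), z ∈ Ω ×ˢ ({0}ᶜ : Set V3) := by
      intro z hz
      have h1 : z.1 = x := (hsub hz).1
      have h2 := hnorm _ (hsub hz).2
      exact ⟨by rw [h1]; exact hx, norm_pos_iff.1 (by linarith)⟩
    have h1 := hh.abs_sub_le_of_segment (x, p) (x, q) hmem (A * E * ((1 + 2 * ‖p‖⁻¹) *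
      boundaryFactor Ω R x)) (by
      intro z hz
      have h1 : z.1 = x := (hsub hz).1
      have h2 := hnorm _ (hsub hz).2
      have h3 := hdist _ (hsub hz).2
      have h4 := exp_neg_le hα h3
      have h5 := hΩ.inv_weight_le (hmem z hz)
      rw [h1] at h5
      have h6 : ‖z.2‖⁻¹ ≤ 2 * ‖p‖⁻¹ := by
        rw [show 2 * ‖p‖⁻¹ = (‖p‖ / 2)⁻¹ by field_simp]
        exact inv_anti₀ (by positivity) h2
      have h7 : 0 ≤ (weight Ω z)⁻¹ := (inv_pos.2 (hΩ.weight_pos (hmem z hz))).le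
      refine mul_le_mul (mul_le_mul_of_nonneg_left h4 hA) (h5.trans ?_) h7 (by positivity)
      exact mul_le_mul_of_nonneg_right (by linarith) (Real.sqrt_nonneg _))
    refine h1.trans ?_
    have h2 : ‖((x, p) : V3 × V3) - (x, q)‖ = ‖p - q‖ := by simp [Prod.norm_def]
    rw [h2]
    refine mul_le_mul_of_nonneg_right ?_ (norm_nonneg _)
    rw [mul_assoc 4, mul_left_comm 4]
    refine mul_le_mul_of_nonneg_left ?_ (by positivity)
    rw [← mul_assoc]
    refine mul_le_mul_of_nonneg_right ?_ (by positivity)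
    have : 0 < ‖p‖⁻¹ := by positivity
    linarith
  · have h1 := hh.abs_le (x, p)
    have h2 := hh.abs_le (x, q)
    have h3 := exp_neg_le hα (le_refl ‖p - q‖)
    have h4 : Real.exp (-α * ‖p‖ ^ 2) ≤ E := by
      apply Real.exp_le_exp.2
      have : 0 ≤ 2 * α * ‖p‖ * ‖p - q‖ := by positivity
      linarith
    have h5 : |h (x, p) - h (x, q)| ≤ 2 * (A * E) := by
      refine (abs_sub _ _).trans ?_
      have a1 := mul_le_mul_of_nonneg_left h3 hA
      have a2 := mul_le_mul_of_nonneg_left h4 hA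
      simp only at h1 h2
      linarith
    have h6 : 1 ≤ 2 * (‖p‖⁻¹ * ‖p - q‖) := by
      have : ‖p‖⁻¹ * (‖p‖ / 2) ≤ ‖p‖⁻¹ * ‖p - q‖ := by gcongr
      have e : ‖p‖⁻¹ * (‖p‖ / 2) = 1 / 2 := by field_simp
      linarith
    have h7 : 1 ≤ 2 * ((1 + ‖p‖⁻¹) * boundaryFactor Ω R x * ‖p - q‖) := by
      have a1 : ‖p‖⁻¹ ≤ (1 + ‖p‖⁻¹) * boundaryFactor Ω R x := by
        have : 0 < ‖p‖⁻¹ := by positivity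
        nlinarith
      have a2 := mul_le_mul_of_nonneg_right a1 (norm_nonneg (p - q))
      linarith
    refine h5.trans ?_
    have h8 : 0 ≤ 2 * (A * E) := by positivity
    nlinarith

theorem abs_sub_le (hh : IsWeightedLipschitz Ω α A h) (hα : 0 ≤ α)
    (hΩ : UniformlyRound Ω (outwardNormal Ω) R r) {x y p q : V3} (hx : x ∈ Ω) (hy : y ∈ Ω)
    (hp : p ≠ 0) :
    |h (x, p) - h (y, q)| ≤ 4 * (A * Real.exp (-α * ‖p‖ ^ 2 + 2 * α * ‖p‖ * ‖p - q‖)) *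
      ((1 + ‖p‖⁻¹) * (boundaryFactor Ω R x + boundaryFactor Ω R y)) * (‖x - y‖ + ‖p - q‖) := by
  have hA := hh.nonneg
  have h1 := hh.abs_sub_le_space hΩ hx hy hp
  have h2 := hh.abs_sub_le_velocity (q := q) hα hΩ hy hp
  have h3 := _root_.abs_sub_le (h (x, p)) (h (y, p)) (h (y, q))
  have hδx := boundaryFactor_nonneg Ω R x
  have hδy := boundaryFactor_nonneg Ω R y
  set E := Real.exp (-α * ‖p‖ ^ 2 + 2 * α * ‖p‖ * ‖p - q‖) with hE
  have h4 : Real.exp (-α * ‖p‖ ^ 2) ≤ 4 * E := by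
    have : Real.exp (-α * ‖p‖ ^ 2) ≤ E := by
      apply Real.exp_le_exp.2
      have : 0 ≤ 2 * α * ‖p‖ * ‖p - q‖ := by positivity
      linarith
    linarith [Real.exp_pos (-α * ‖p‖ ^ 2 + 2 * α * ‖p‖ * ‖p - q‖)]
  set D := boundaryFactor Ω R x + boundaryFactor Ω R y with hD
  have a1 : A * Real.exp (-α * ‖p‖ ^ 2) * ((1 + ‖p‖⁻¹) * D) * ‖x - y‖ ≤
      4 * (A * E) * ((1 + ‖p‖⁻¹) * D) * ‖x - y‖ := by
    have : A * Real.exp (-α * ‖p‖ ^ 2) ≤ 4 * (A * E) := by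
      have := mul_le_mul_of_nonneg_left h4 hA
      linarith
    gcongr
  have a2 : 4 * (A * E) * ((1 + ‖p‖⁻¹) * boundaryFactor Ω R y) * ‖p - q‖ ≤
      4 * (A * E) * ((1 + ‖p‖⁻¹) * D) * ‖p - q‖ := by
    gcongr
    linarith
  linarith

end IsWeightedLipschitz

end

section

/-! ### Integrated bounds of the kernels -/

/-- The dominating function of the gain term. -/
def gainWeight (γ : ℝ) (v : V3) (q : V3 × V3) : ℝ :=
  Real.exp (-‖v + q.1‖ ^ 2 / 4) * ‖q.1‖ ^ γ * (1 + ‖postV v q‖⁻¹ + ‖postVS v q‖⁻¹)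

theorem gainWeight_nonneg (γ : ℝ) (v : V3) (q : V3 × V3) : 0 ≤ gainWeight γ v q := by
  unfold gainWeight; positivity

theorem continuous_postV_right (v : V3) : Continuous (postV v) := by unfold postV; fun_prop

theorem continuous_postVS_right (v : V3) : Continuous (postVS v) := by unfold postVS; fun_prop

/-- Passing from extended to real inverses, for which 0⁻¹ = 0, requires that the post-collisional
velocities are almost never zero. -/
theorem exists_integral_gainWeight_le {γ : ℝ} (hγ₀ : 0 ≤ γ) (hγ₁ : γ ≤ 1) :
    ∃ c : ℝ, 0 ≤ c ∧ ∀ v : V3,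
      Integrable (gainWeight γ v) (volume.prod scatterMeasure) ∧
      ∫ q, gainWeight γ v q ∂(volume.prod scatterMeasure) ≤ c * (1 + ‖v‖) ^ γ ∧
      ∀ᵐ q ∂(volume.prod scatterMeasure), postV v q ≠ 0 ∧ postVS v q ≠ 0 ∧ ‖q.2‖ = 1 := by
  obtain ⟨c, hc0, hc⟩ := exists_lintegral_gain_le hγ₀ hγ₁
  refine ⟨c, hc0, fun v => ?_⟩
  have mV : Measurable fun q => ‖postV v q‖ₑ⁻¹ := (continuous_postV_right v).measurable.enorm.inv
  have mVS : Measurable fun q => ‖postVS v q‖ₑ⁻¹ := (continuous_postVS_right v).measurable.enorm.inv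
  have hm : Measurable fun q : V3 × V3 =>
      ENNReal.ofReal (Real.exp (-‖v + q.1‖ ^ 2 / 4) * ‖q.1‖ ^ γ) *
        (1 + ‖postV v q‖ₑ⁻¹ + ‖postVS v q‖ₑ⁻¹) :=
    Measurable.mul (by fun_prop) ((measurable_const.add mV).add mVS)
  have h0 : ∀ᵐ q ∂((volume : Measure V3).prod scatterMeasure), q.1 ≠ 0 :=
    Measure.quasiMeasurePreserving_fst.ae (Measure.ae_ne volume 0)
  have h1 : ∀ᵐ q ∂((volume : Measure V3).prod scatterMeasure), ‖q.2‖ = 1 :=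
    Measure.quasiMeasurePreserving_snd.ae ae_norm_scatterMeasure
  have hae : ∀ᵐ q ∂((volume : Measure V3).prod scatterMeasure),
      postV v q ≠ 0 ∧ postVS v q ≠ 0 ∧ ‖q.2‖ = 1 := by
    -- A finite integral makes the integrand finite almost everywhere, which excludes zeros of the
    -- post-collisional velocities, where the extended inverse is infinite.
    filter_upwards [ae_lt_top hm ((hc v).trans_lt ENNReal.ofReal_lt_top).ne, h0, h1] with q h2 h3 h4
    have hn := norm_pos_iff.2 h3
    have h5 : ENNReal.ofReal (Real.exp (-‖v + q.1‖ ^ 2 / 4) * ‖q.1‖ ^ γ) ≠ 0 := by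
      rw [Ne, ENNReal.ofReal_eq_zero, not_le]; positivity
    have h6 : 1 + ‖postV v q‖ₑ⁻¹ + ‖postVS v q‖ₑ⁻¹ ≠ ∞ := by
      intro h7
      rw [h7, ENNReal.mul_top h5] at h2
      exact lt_irrefl _ h2
    refine ⟨fun h7 => h6 ?_, fun h7 => h6 ?_, h4⟩
    · simp [h7]
    · simp [h7]
  have heq : ∀ᵐ q ∂((volume : Measure V3).prod scatterMeasure), ENNReal.ofReal (gainWeight γ v q) =
      ENNReal.ofReal (Real.exp (-‖v + q.1‖ ^ 2 / 4) * ‖q.1‖ ^ γ) *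
        (1 + ‖postV v q‖ₑ⁻¹ + ‖postVS v q‖ₑ⁻¹) := by
    filter_upwards [hae] with q hq
    rw [gainWeight, ENNReal.ofReal_mul (by positivity), ENNReal.ofReal_add (by positivity)
      (by positivity), ENNReal.ofReal_add (by positivity) (by positivity), ENNReal.ofReal_one,
      ENNReal.ofReal_inv_of_pos (norm_pos_iff.2 hq.1),
      ENNReal.ofReal_inv_of_pos (norm_pos_iff.2 hq.2.1), ofReal_norm, ofReal_norm]
  have hme : Measurable (gainWeight γ v) := by
    unfold gainWeight
    exact Measurable.mul (by fun_prop) ((measurable_const.add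
      (continuous_postV_right v).measurable.norm.inv).add
      (continuous_postVS_right v).measurable.norm.inv)
  have hlin : ∫⁻ q, ENNReal.ofReal (gainWeight γ v q) ∂(volume.prod scatterMeasure) ≤
      ENNReal.ofReal (c * (1 + ‖v‖) ^ γ) := by
    rw [lintegral_congr_ae heq]; exact hc v
  have hnn : 0 ≤ᵐ[volume.prod scatterMeasure] gainWeight γ v :=
    Filter.Eventually.of_forall (gainWeight_nonneg γ v)
  refine ⟨⟨hme.aestronglyMeasurable, ?_⟩, ?_, hae⟩
  · rw [hasFiniteIntegral_iff_ofReal hnn]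
    exact hlin.trans_lt ENNReal.ofReal_lt_top
  · rw [integral_eq_lintegral_of_nonneg_ae hnn hme.aestronglyMeasurable]
    exact ENNReal.toReal_le_of_le_ofReal (by positivity) hlin

/-- The dominating function of the loss term. -/
def lossWeight (γ : ℝ) (v u : V3) : ℝ :=
  Real.exp (-‖v + u‖ ^ 2 / 4) * ‖u‖ ^ γ * (1 + ‖v + u‖⁻¹)

theorem exists_integral_lossWeight_le {γ : ℝ} (hγ₀ : 0 ≤ γ) (hγ₁ : γ ≤ 1) :
    ∃ c : ℝ, 0 ≤ c ∧ ∀ v : V3,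
      Integrable (lossWeight γ v) ∧ ∫ u, lossWeight γ v u ≤ c * (1 + ‖v‖) ^ γ ∧
      ∀ᵐ u : V3, v + u ≠ 0 := by
  obtain ⟨c, hc0, hc⟩ := exists_lintegral_loss_le hγ₀ hγ₁
  refine ⟨c, hc0, fun v => ?_⟩
  have hae : ∀ᵐ u : V3, v + u ≠ 0 := by
    filter_upwards [Measure.ae_ne volume (-v)] with u hu h
    exact hu (eq_neg_of_add_eq_zero_right h)
  have heq : ∀ᵐ u : V3, ENNReal.ofReal (lossWeight γ v u) =
      ENNReal.ofReal (Real.exp (-‖v + u‖ ^ 2 / 4) * ‖u‖ ^ γ) * (1 + ‖v + u‖ₑ⁻¹) := by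
    filter_upwards [hae] with u hu
    rw [lossWeight, ENNReal.ofReal_mul (by positivity), ENNReal.ofReal_add (by positivity)
      (by positivity), ENNReal.ofReal_one, ENNReal.ofReal_inv_of_pos (norm_pos_iff.2 hu),
      ofReal_norm]
  have hme : Measurable (lossWeight γ v) := by unfold lossWeight; fun_prop
  have hlin : ∫⁻ u, ENNReal.ofReal (lossWeight γ v u) ≤ ENNReal.ofReal (c * (1 + ‖v‖) ^ γ) := by
    rw [lintegral_congr_ae heq]; exact hc v
  have hnn : 0 ≤ᵐ[volume] lossWeight γ v :=
    Filter.Eventually.of_forall fun u => by simp only [Pi.zero_apply, lossWeight]; positivity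
  refine ⟨⟨hme.aestronglyMeasurable, ?_⟩, ?_, hae⟩
  · rw [hasFiniteIntegral_iff_ofReal hnn]
    exact hlin.trans_lt ENNReal.ofReal_lt_top
  · rw [integral_eq_lintegral_of_nonneg_ae hnn hme.aestronglyMeasurable]
    exact ENNReal.toReal_le_of_le_ofReal (by positivity) hlin

/-! ### The square root of the Maxwellian -/

theorem sqrt_maxwellian (p : V3) :
    √(maxwellian p) = √(Real.pi ^ (-(3 / 2) : ℝ)) * Real.exp (-(1 / 2) * ‖p‖ ^ 2) := by
  rw [maxwellian, Real.sqrt_mul (by positivity), Real.sqrt_eq_rpow (Real.exp _), ← Real.exp_mul]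
  congr 2
  ring

theorem sqrt_pi_rpow_le_one : √(Real.pi ^ (-(3 / 2) : ℝ)) ≤ 1 := by
  rw [Real.sqrt_le_one]
  exact Real.rpow_le_one_of_one_le_of_nonpos (by linarith [Real.pi_gt_three]) (by norm_num)

theorem sqrt_maxwellian_le (p : V3) : √(maxwellian p) ≤ Real.exp (-(1 / 2) * ‖p‖ ^ 2) := by
  rw [sqrt_maxwellian]
  exact mul_le_of_le_one_left (by positivity) sqrt_pi_rpow_le_one

theorem sqrt_maxwellian_le_weight (p : V3) : √(maxwellian p) ≤ Real.exp (-‖p‖ ^ 2 / 4) := by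
  refine (sqrt_maxwellian_le p).trans (Real.exp_le_exp.2 ?_)
  nlinarith [sq_nonneg ‖p‖]

theorem sqrt_maxwellian_sub_le {p q : V3} (h : ‖p - q‖ ≤ 1) :
    |√(maxwellian p) - √(maxwellian q)| ≤
      ‖p - q‖ * (Real.exp 16 * Real.exp (-‖p‖ ^ 2 / 4)) := by
  rw [sqrt_maxwellian, sqrt_maxwellian, ← mul_sub, abs_mul, abs_of_nonneg (Real.sqrt_nonneg _)]
  exact (mul_le_of_le_one_left (abs_nonneg _) sqrt_pi_rpow_le_one).trans
    (abs_gaussian_sub_le le_rfl (by norm_num) h)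

theorem sqrt_maxwellian_le_near {p q : V3} (h : ‖p - q‖ ≤ 1) :
    √(maxwellian q) ≤ Real.exp (-‖p‖ ^ 2 / 2 + ‖p‖) := by
  refine (sqrt_maxwellian_le q).trans (Real.exp_le_exp.2 ?_)
  have h1 := norm_sq_ge (p := p) (q := q)
  have h2 : ‖p‖ * ‖p - q‖ ≤ ‖p‖ * 1 := by gcongr
  nlinarith

/-! ### The reduced collision operator -/

/-- The gain term of `Γ`, as an integral over `u = v⋆ - v` and the scattering direction. -/
def gainTerm (γ : ℝ) (h₁ h₂ : V3 × V3 → ℝ) (z : V3 × V3) : ℝ :=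
  ∫ q, √(maxwellian (z.2 + q.1)) * ‖q.1‖ ^ γ * (h₁ (z.1, postV z.2 q) * h₂ (z.1, postVS z.2 q))
    ∂((volume : Measure V3).prod scatterMeasure)

/-- The multiplier of the loss term of `Γ`. -/
def lossTerm (γ : ℝ) (h : V3 × V3 → ℝ) (z : V3 × V3) : ℝ :=
  ∫ u : V3, √(maxwellian (z.2 + u)) * ‖u‖ ^ γ * h (z.1, z.2 + u)

/-- The operator `Γ` in the variables `u = v⋆ - v` and `σ`. -/
def reducedGamma (C γ : ℝ) (h₁ h₂ : V3 × V3 → ℝ) (z : V3 × V3) : ℝ :=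
  C * (gainTerm γ h₁ h₂ z - scatterMeasure.real univ * (h₁ z * lossTerm γ h₂ z))

theorem measurable_gain_integrand {γ : ℝ} {h₁ h₂ : V3 × V3 → ℝ} (m₁ : Measurable h₁)
    (m₂ : Measurable h₂) : Measurable fun w : (V3 × V3) × (V3 × V3) =>
      √(maxwellian (w.1.2 + w.2.1)) * ‖w.2.1‖ ^ γ *
        (h₁ (w.1.1, postV w.1.2 w.2) * h₂ (w.1.1, postVS w.1.2 w.2)) := by
  have a : Measurable fun w : (V3 × V3) × (V3 × V3) => √(maxwellian (w.1.2 + w.2.1)) :=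
    (continuous_maxwellian.measurable.comp (by fun_prop)).sqrt
  have c1 : Continuous fun w : (V3 × V3) × (V3 × V3) => (w.1.1, postV w.1.2 w.2) := by
    unfold postV; fun_prop
  have c2 : Continuous fun w : (V3 × V3) × (V3 × V3) => (w.1.1, postVS w.1.2 w.2) := by
    unfold postVS; fun_prop
  exact (a.mul (by fun_prop)).mul ((m₁.comp c1.measurable).mul (m₂.comp c2.measurable))

theorem measurable_loss_integrand {γ : ℝ} {h : V3 × V3 → ℝ} (m : Measurable h) :
    Measurable fun w : (V3 × V3) × V3 =>
      √(maxwellian (w.1.2 + w.2)) * ‖w.2‖ ^ γ * h (w.1.1, w.1.2 + w.2) := by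
  have a : Measurable fun w : (V3 × V3) × V3 => √(maxwellian (w.1.2 + w.2)) :=
    (continuous_maxwellian.measurable.comp (by fun_prop)).sqrt
  exact (a.mul (by fun_prop)).mul (m.comp (by fun_prop))

theorem measurable_reducedGamma {C γ : ℝ} {h₁ h₂ : V3 × V3 → ℝ} (m₁ : Measurable h₁)
    (m₂ : Measurable h₂) : Measurable (reducedGamma C γ h₁ h₂) := by
  have hg : Measurable (gainTerm γ h₁ h₂) :=
    ((measurable_gain_integrand m₁ m₂).stronglyMeasurable.integral_prod_right'
      (ν := (volume : Measure V3).prod scatterMeasure)).measurable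
  have hl : Measurable (lossTerm γ h₂) :=
    ((measurable_loss_integrand m₂).stronglyMeasurable.integral_prod_right'
      (ν := (volume : Measure V3))).measurable
  exact (hg.sub ((m₁.mul hl).const_mul _)).const_mul C

variable {Ω : Set V3} {R r α A₁ A₂ γ : ℝ} {h₁ h₂ : V3 × V3 → ℝ}

/-- By conservation of energy the two Gaussian factors multiply to e^{-α(|v|² + |v⋆|²)}, which is at
most e^{-α|v|²}. -/
theorem abs_gain_integrand_le (H₁ : IsWeightedLipschitz Ω α A₁ h₁)
    (H₂ : IsWeightedLipschitz Ω α A₂ h₂) (hα : 0 ≤ α) (z : V3 × V3) {q : V3 × V3}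
    (hq : ‖q.2‖ = 1) :
    |√(maxwellian (z.2 + q.1)) * ‖q.1‖ ^ γ * (h₁ (z.1, postV z.2 q) * h₂ (z.1, postVS z.2 q))| ≤
      A₁ * A₂ * Real.exp (-α * ‖z.2‖ ^ 2) * gainWeight γ z.2 q := by
  have hA₁ := H₁.nonneg
  have hA₂ := H₂.nonneg
  have e := norm_sq_postV_add z.2 hq
  have b1 := H₁.abs_le (z.1, postV z.2 q)
  have b2 := H₂.abs_le (z.1, postVS z.2 q)
  simp only at b1 b2
  have b3 : |h₁ (z.1, postV z.2 q) * h₂ (z.1, postVS z.2 q)| ≤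
      A₁ * A₂ * Real.exp (-α * ‖z.2‖ ^ 2) := by
    rw [abs_mul]
    calc _ ≤ (A₁ * Real.exp (-α * ‖postV z.2 q‖ ^ 2)) *
          (A₂ * Real.exp (-α * ‖postVS z.2 q‖ ^ 2)) := by gcongr
      _ = A₁ * A₂ * Real.exp (-α * ‖postV z.2 q‖ ^ 2 + -α * ‖postVS z.2 q‖ ^ 2) := by
          rw [Real.exp_add]; ring
      _ ≤ _ := by
          refine mul_le_mul_of_nonneg_left (Real.exp_le_exp.2 ?_) (by positivity)
          nlinarith [sq_nonneg ‖z.2 + q.1‖]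
  rw [abs_mul, abs_of_nonneg (by positivity : 0 ≤ √(maxwellian (z.2 + q.1)) * ‖q.1‖ ^ γ)]
  have b4 : √(maxwellian (z.2 + q.1)) * ‖q.1‖ ^ γ ≤ gainWeight γ z.2 q := by
    unfold gainWeight
    calc _ ≤ Real.exp (-‖z.2 + q.1‖ ^ 2 / 4) * ‖q.1‖ ^ γ := by
          gcongr; exact sqrt_maxwellian_le_weight _
      _ ≤ _ := by
          refine le_mul_of_one_le_right (by positivity) ?_
          have : 0 ≤ ‖postV z.2 q‖⁻¹ + ‖postVS z.2 q‖⁻¹ := by positivity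
          linarith
  calc _ ≤ gainWeight γ z.2 q * (A₁ * A₂ * Real.exp (-α * ‖z.2‖ ^ 2)) :=
        mul_le_mul b4 b3 (abs_nonneg _) (gainWeight_nonneg _ _ _)
    _ = _ := mul_comm _ _

theorem integrable_gain_integrand (H₁ : IsWeightedLipschitz Ω α A₁ h₁)
    (H₂ : IsWeightedLipschitz Ω α A₂ h₂) (hα : 0 ≤ α) (hγ₀ : 0 ≤ γ) (hγ₁ : γ ≤ 1) (z : V3 × V3) :
    Integrable (fun q => √(maxwellian (z.2 + q.1)) * ‖q.1‖ ^ γ *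
      (h₁ (z.1, postV z.2 q) * h₂ (z.1, postVS z.2 q)))
      ((volume : Measure V3).prod scatterMeasure) := by
  obtain ⟨c, -, hc⟩ := exists_integral_gainWeight_le hγ₀ hγ₁
  obtain ⟨hi, -, hae⟩ := hc z.2
  refine (hi.const_mul (A₁ * A₂ * Real.exp (-α * ‖z.2‖ ^ 2))).mono' ?_ ?_
  · exact ((measurable_gain_integrand H₁.measurable H₂.measurable).comp
      (measurable_prodMk_left (x := z))).aestronglyMeasurable
  · filter_upwards [hae] with q hq
    exact abs_gain_integrand_le H₁ H₂ hα z hq.2.2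

theorem abs_loss_integrand_le (H₂ : IsWeightedLipschitz Ω α A₂ h₂) (hα : 0 ≤ α) (z : V3 × V3)
    (u : V3) : |√(maxwellian (z.2 + u)) * ‖u‖ ^ γ * h₂ (z.1, z.2 + u)| ≤
      A₂ * lossWeight γ z.2 u := by
  have hA₂ := H₂.nonneg
  have b2 := H₂.abs_le (z.1, z.2 + u)
  have b3 : |h₂ (z.1, z.2 + u)| ≤ A₂ := by
    refine b2.trans (mul_le_of_le_one_right hA₂ ?_)
    rw [Real.exp_le_one_iff]
    nlinarith [sq_nonneg ‖z.2 + u‖]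
  rw [abs_mul, abs_of_nonneg (by positivity : 0 ≤ √(maxwellian (z.2 + u)) * ‖u‖ ^ γ), mul_comm]
  have b4 : √(maxwellian (z.2 + u)) * ‖u‖ ^ γ ≤ lossWeight γ z.2 u := by
    unfold lossWeight
    calc _ ≤ Real.exp (-‖z.2 + u‖ ^ 2 / 4) * ‖u‖ ^ γ := by
          gcongr; exact sqrt_maxwellian_le_weight _
      _ ≤ _ := by
          refine le_mul_of_one_le_right (by positivity) ?_
          have : 0 ≤ ‖z.2 + u‖⁻¹ := by positivity
          linarith
  exact mul_le_mul b3 b4 (by positivity) hA₂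

theorem integrable_loss_integrand (H₂ : IsWeightedLipschitz Ω α A₂ h₂) (hα : 0 ≤ α)
    (hγ₀ : 0 ≤ γ) (hγ₁ : γ ≤ 1) (z : V3 × V3) :
    Integrable fun u : V3 => √(maxwellian (z.2 + u)) * ‖u‖ ^ γ * h₂ (z.1, z.2 + u) := by
  obtain ⟨c, -, hc⟩ := exists_integral_lossWeight_le hγ₀ hγ₁
  refine ((hc z.2).1.const_mul A₂).mono' ?_
    (Filter.Eventually.of_forall fun u => abs_loss_integrand_le H₂ hα z u)
  exact ((measurable_loss_integrand H₂.measurable).comp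
      (measurable_prodMk_left (x := z))).aestronglyMeasurable

theorem exp_collect_le (x : ℝ) (k : ℝ) (hk : k ≤ 2) (hx : 0 ≤ x) :
    Real.exp (-x ^ 2 / 2 + x) * Real.exp (k * (1 + x)) ≤ Real.exp 16 * Real.exp (-x ^ 2 / 4) := by
  rw [← Real.exp_add, ← Real.exp_add]
  apply Real.exp_le_exp.2
  nlinarith [sq_nonneg (x - 6)]

set_option maxHeartbeats 1000000 in
/-- Pointwise Lipschitz bound of the gain integrand. -/
theorem abs_gain_integrand_sub_le (H₁ : IsWeightedLipschitz Ω α A₁ h₁)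
    (H₂ : IsWeightedLipschitz Ω α A₂ h₂) (hΩ : UniformlyRound Ω (outwardNormal Ω) R r)
    (hα : 0 ≤ α) (hα' : α ≤ 1 / 2) {x y v w : V3} (hx : x ∈ Ω) (hy : y ∈ Ω)
    (ht : ‖v - w‖ * (1 + ‖v‖) ≤ 1) {q : V3 × V3} (hq : ‖q.2‖ = 1) (ha : postV v q ≠ 0)
    (hb : postVS v q ≠ 0) :
    |√(maxwellian (v + q.1)) * ‖q.1‖ ^ γ * (h₁ (x, postV v q) * h₂ (x, postVS v q)) -
      √(maxwellian (w + q.1)) * ‖q.1‖ ^ γ * (h₁ (y, postV w q) * h₂ (y, postVS w q))| ≤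
      9 * Real.exp 16 * (A₁ * A₂ * Real.exp (-α * ‖v‖ ^ 2) *
        ((boundaryFactor Ω R x + boundaryFactor Ω R y) * (‖x - y‖ + ‖v - w‖))) *
        gainWeight γ v q := by
  have hA₁ := H₁.nonneg
  have hA₂ := H₂.nonneg
  have hna := norm_postV_le v hq
  have hnb := norm_postVS_le v hq
  have hen := norm_sq_postV_add v hq
  set a := postV v q with hadef
  set b := postVS v q with hbdef
  set p := v + q.1 with hp
  set t := ‖v - w‖ with htdef
  have ht0 : 0 ≤ t := norm_nonneg _
  have ht1 : t ≤ 1 := by nlinarith [norm_nonneg v]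
  have da : ‖a - postV w q‖ = t := by
    rw [hadef, postV, postV, add_sub_add_right_eq_sub]
  have db : ‖b - postVS w q‖ = t := by
    rw [hbdef, postVS, postVS, add_sub_add_right_eq_sub]
  have dp : ‖p - (w + q.1)‖ = t := by rw [hp, add_sub_add_right_eq_sub]
  set Δ := boundaryFactor Ω R x + boundaryFactor Ω R y with hΔ
  have hδx : 1 ≤ boundaryFactor Ω R x := hΩ.one_le_sqrt hx
  have hδy := boundaryFactor_nonneg Ω R y
  have hΔ1 : 1 ≤ Δ := by linarith
  set D := ‖x - y‖ + t with hD
  have hDt : t ≤ D := by linarith [norm_nonneg (x - y)]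
  have hD0 : 0 ≤ D := ht0.trans hDt
  set X := Real.exp (1 + ‖p‖) with hX
  have hX1 : 1 ≤ X := Real.one_le_exp (by positivity)
  set ea := Real.exp (-α * ‖a‖ ^ 2) with hea
  set eb := Real.exp (-α * ‖b‖ ^ 2) with heb
  set Ev := Real.exp (-α * ‖v‖ ^ 2) with hEv
  have hab : ea * eb ≤ Ev := by
    rw [hea, heb, ← Real.exp_add]
    apply Real.exp_le_exp.2
    nlinarith [sq_nonneg ‖p‖]
  -- A post-collisional velocity may be as large as |v|, so the shift t must satisfy t(1+|v|) ≤ 1.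
  -- With α ≤ 1/2 the loss is then only e^{1+|p|}, which the Maxwellian of p absorbs.
  have hexp : ∀ c : V3, ‖c‖ ≤ ‖v‖ + ‖p‖ →
      Real.exp (-α * ‖c‖ ^ 2 + 2 * α * ‖c‖ * t) ≤ Real.exp (-α * ‖c‖ ^ 2) * X := by
    intro c hc
    rw [hX, ← Real.exp_add]
    apply Real.exp_le_exp.2
    have h1 : ‖c‖ * t ≤ 1 + ‖p‖ := by
      calc ‖c‖ * t ≤ (‖v‖ + ‖p‖) * t := by gcongr
        _ ≤ 1 + ‖p‖ := by nlinarith [norm_nonneg p, norm_nonneg v]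
    have h2 : 0 ≤ ‖c‖ * t := by positivity
    nlinarith
  have k1 : |h₁ (x, a) - h₁ (y, postV w q)| ≤ 4 * (A₁ * (ea * X)) * ((1 + ‖a‖⁻¹) * Δ) * D := by
    have h := H₁.abs_sub_le (q := postV w q) hα hΩ hx hy ha
    rw [da] at h
    refine h.trans ?_
    have := hexp a hna
    gcongr
  have k2 : |h₂ (x, b) - h₂ (y, postVS w q)| ≤ 4 * (A₂ * (eb * X)) * ((1 + ‖b‖⁻¹) * Δ) * D := by
    have h := H₂.abs_sub_le (q := postVS w q) hα hΩ hx hy hb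
    rw [db] at h
    refine h.trans ?_
    have := hexp b hnb
    gcongr
  have k3 : |h₁ (x, a)| ≤ A₁ * ea := H₁.abs_le (x, a)
  have k4 : |h₂ (x, b)| ≤ A₂ * eb := H₂.abs_le (x, b)
  have k5 : |h₁ (y, postV w q)| ≤ A₁ * (ea * X) := by
    refine (H₁.abs_le (y, postV w q)).trans (mul_le_mul_of_nonneg_left ?_ hA₁)
    exact (IsWeightedLipschitz.exp_neg_le hα da.le).trans (hexp a hna)
  have k6 := sqrt_maxwellian_sub_le (p := p) (q := w + q.1) (by rw [dp]; exact ht1)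
  rw [dp] at k6
  have k7 := sqrt_maxwellian_le_near (p := p) (q := w + q.1) (by rw [dp]; exact ht1)
  set m₁ := √(maxwellian p) with hm₁
  set m₂ := √(maxwellian (w + q.1)) with hm₂
  have hm₂0 : 0 ≤ m₂ := Real.sqrt_nonneg _
  set W := Real.exp (-‖p‖ ^ 2 / 4) with hW
  have l1 : m₂ * X ≤ Real.exp 16 * W := by
    refine le_trans ?_ (exp_collect_le ‖p‖ 1 one_le_two (norm_nonneg p))
    rw [one_mul]
    exact mul_le_mul_of_nonneg_right k7 (by positivity)
  have l2 : m₂ * (X * X) ≤ Real.exp 16 * W := by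
    refine le_trans ?_ (exp_collect_le ‖p‖ 2 le_rfl (norm_nonneg p))
    rw [hX, ← Real.exp_add]
    refine mul_le_mul k7 (Real.exp_le_exp.2 (by linarith)) (by positivity) (by positivity)
  set P := A₁ * A₂ * Ev * (Δ * D) with hP
  have hP0 : 0 ≤ P := by positivity
  have t1 : |(m₁ - m₂) * (h₁ (x, a) * h₂ (x, b))| ≤ P * (Real.exp 16 * W) := by
    rw [abs_mul, abs_mul]
    calc _ ≤ (t * (Real.exp 16 * W)) * ((A₁ * ea) * (A₂ * eb)) := by gcongr
      _ = A₁ * A₂ * (ea * eb) * (1 * t) * (Real.exp 16 * W) := by ring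
      _ ≤ A₁ * A₂ * Ev * (Δ * D) * (Real.exp 16 * W) := by gcongr
  have t2 : |m₂ * ((h₁ (x, a) - h₁ (y, postV w q)) * h₂ (x, b))| ≤
      P * (4 * (1 + ‖a‖⁻¹) * (Real.exp 16 * W)) := by
    rw [abs_mul, abs_mul, abs_of_nonneg hm₂0]
    calc _ ≤ m₂ * ((4 * (A₁ * (ea * X)) * ((1 + ‖a‖⁻¹) * Δ) * D) * (A₂ * eb)) := by gcongr
      _ = A₁ * A₂ * (ea * eb) * (Δ * D) * (4 * (1 + ‖a‖⁻¹) * (m₂ * X)) := by ring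
      _ ≤ _ := by rw [hP]; gcongr
  have t3 : |m₂ * (h₁ (y, postV w q) * (h₂ (x, b) - h₂ (y, postVS w q)))| ≤
      P * (4 * (1 + ‖b‖⁻¹) * (Real.exp 16 * W)) := by
    rw [abs_mul, abs_mul, abs_of_nonneg hm₂0]
    calc _ ≤ m₂ * ((A₁ * (ea * X)) * (4 * (A₂ * (eb * X)) * ((1 + ‖b‖⁻¹) * Δ) * D)) := by gcongr
      _ = A₁ * A₂ * (ea * eb) * (Δ * D) * (4 * (1 + ‖b‖⁻¹) * (m₂ * (X * X))) := by ring
      _ ≤ _ := by rw [hP]; gcongr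
  -- One factor changes at a time, so 1/|a| and 1/|b| appear in separate terms and are never
  -- multiplied.
  have hsplit : m₁ * ‖q.1‖ ^ γ * (h₁ (x, a) * h₂ (x, b)) -
      m₂ * ‖q.1‖ ^ γ * (h₁ (y, postV w q) * h₂ (y, postVS w q)) =
      ‖q.1‖ ^ γ * ((m₁ - m₂) * (h₁ (x, a) * h₂ (x, b)) +
        m₂ * ((h₁ (x, a) - h₁ (y, postV w q)) * h₂ (x, b)) +
        m₂ * (h₁ (y, postV w q) * (h₂ (x, b) - h₂ (y, postVS w q)))) := by ring
  have hu : 0 ≤ ‖q.1‖ ^ γ := by positivity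
  rw [hsplit, abs_mul, abs_of_nonneg hu]
  have hsum := (abs_add_three ((m₁ - m₂) * (h₁ (x, a) * h₂ (x, b)))
        (m₂ * ((h₁ (x, a) - h₁ (y, postV w q)) * h₂ (x, b)))
        (m₂ * (h₁ (y, postV w q) * (h₂ (x, b) - h₂ (y, postVS w q))))).trans
        (add_le_add (add_le_add t1 t2) t3)
  calc _ ≤ ‖q.1‖ ^ γ * (P * (Real.exp 16 * W) + P * (4 * (1 + ‖a‖⁻¹) * (Real.exp 16 * W)) +
        P * (4 * (1 + ‖b‖⁻¹) * (Real.exp 16 * W))) := mul_le_mul_of_nonneg_left hsum hu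
    _ = P * (Real.exp 16 * W) * ‖q.1‖ ^ γ * (9 + 4 * ‖a‖⁻¹ + 4 * ‖b‖⁻¹) := by ring
    _ ≤ P * (Real.exp 16 * W) * ‖q.1‖ ^ γ * (9 * (1 + ‖a‖⁻¹ + ‖b‖⁻¹)) := by
        refine mul_le_mul_of_nonneg_left ?_ (by positivity)
        have i1 : 0 ≤ ‖a‖⁻¹ := by positivity
        have i2 : 0 ≤ ‖b‖⁻¹ := by positivity
        linarith
    _ = _ := by rw [gainWeight]; ring

theorem abs_loss_integrand_sub_le (H₂ : IsWeightedLipschitz Ω α A₂ h₂)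
    (hΩ : UniformlyRound Ω (outwardNormal Ω) R r)
    (hα : 0 ≤ α) (hα' : α ≤ 1 / 2) {x y v w : V3} (hx : x ∈ Ω) (hy : y ∈ Ω)
    (ht1 : ‖v - w‖ ≤ 1) {u : V3} (hu : v + u ≠ 0) :
    |√(maxwellian (v + u)) * ‖u‖ ^ γ * h₂ (x, v + u) -
      √(maxwellian (w + u)) * ‖u‖ ^ γ * h₂ (y, w + u)| ≤
      5 * Real.exp 16 * (A₂ *
        ((boundaryFactor Ω R x + boundaryFactor Ω R y) * (‖x - y‖ + ‖v - w‖))) *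
        lossWeight γ v u := by
  have hA₂ := H₂.nonneg
  set p := v + u with hp
  set t := ‖v - w‖ with htdef
  have ht0 : 0 ≤ t := norm_nonneg _
  have dp : ‖p - (w + u)‖ = t := by rw [hp, add_sub_add_right_eq_sub]
  set Δ := boundaryFactor Ω R x + boundaryFactor Ω R y with hΔ
  have hδx : 1 ≤ boundaryFactor Ω R x := hΩ.one_le_sqrt hx
  have hδy := boundaryFactor_nonneg Ω R y
  have hΔ1 : 1 ≤ Δ := by linarith
  set D := ‖x - y‖ + t with hD
  have hDt : t ≤ D := by linarith [norm_nonneg (x - y)]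
  have hD0 : 0 ≤ D := ht0.trans hDt
  set X := Real.exp (1 + ‖p‖) with hX
  have k2 : |h₂ (x, p) - h₂ (y, w + u)| ≤ 4 * (A₂ * X) * ((1 + ‖p‖⁻¹) * Δ) * D := by
    have h := H₂.abs_sub_le (q := w + u) hα hΩ hx hy hu
    rw [dp] at h
    refine h.trans ?_
    have : Real.exp (-α * ‖p‖ ^ 2 + 2 * α * ‖p‖ * t) ≤ X := by
      apply Real.exp_le_exp.2
      have h1 : ‖p‖ * t ≤ ‖p‖ * 1 := by gcongr
      have h2 : 0 ≤ ‖p‖ * t := by positivity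
      nlinarith [sq_nonneg ‖p‖]
    gcongr
  have k4 : |h₂ (x, p)| ≤ A₂ := by
    refine (H₂.abs_le (x, p)).trans (mul_le_of_le_one_right hA₂ ?_)
    rw [Real.exp_le_one_iff]
    nlinarith [sq_nonneg ‖p‖]
  have k6 := sqrt_maxwellian_sub_le (p := p) (q := w + u) (by rw [dp]; exact ht1)
  rw [dp] at k6
  have k7 := sqrt_maxwellian_le_near (p := p) (q := w + u) (by rw [dp]; exact ht1)
  set m₁ := √(maxwellian p) with hm₁
  set m₂ := √(maxwellian (w + u)) with hm₂
  have hm₂0 : 0 ≤ m₂ := Real.sqrt_nonneg _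
  set W := Real.exp (-‖p‖ ^ 2 / 4) with hW
  have l1 : m₂ * X ≤ Real.exp 16 * W := by
    refine le_trans ?_ (exp_collect_le ‖p‖ 1 one_le_two (norm_nonneg p))
    rw [one_mul]
    exact mul_le_mul_of_nonneg_right k7 (by positivity)
  set P := A₂ * (Δ * D) with hP
  have hP0 : 0 ≤ P := by positivity
  have t1 : |(m₁ - m₂) * h₂ (x, p)| ≤ P * (Real.exp 16 * W) := by
    rw [abs_mul]
    calc _ ≤ (t * (Real.exp 16 * W)) * A₂ := by gcongr
      _ = A₂ * (1 * t) * (Real.exp 16 * W) := by ring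
      _ ≤ A₂ * (Δ * D) * (Real.exp 16 * W) := by gcongr
  have t2 : |m₂ * (h₂ (x, p) - h₂ (y, w + u))| ≤ P * (4 * (1 + ‖p‖⁻¹) * (Real.exp 16 * W)) := by
    rw [abs_mul, abs_of_nonneg hm₂0]
    calc _ ≤ m₂ * (4 * (A₂ * X) * ((1 + ‖p‖⁻¹) * Δ) * D) := by gcongr
      _ = A₂ * (Δ * D) * (4 * (1 + ‖p‖⁻¹) * (m₂ * X)) := by ring
      _ ≤ _ := by rw [hP]; gcongr
  have hsplit : m₁ * ‖u‖ ^ γ * h₂ (x, p) - m₂ * ‖u‖ ^ γ * h₂ (y, w + u) =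
      ‖u‖ ^ γ * ((m₁ - m₂) * h₂ (x, p) + m₂ * (h₂ (x, p) - h₂ (y, w + u))) := by ring
  have hu' : 0 ≤ ‖u‖ ^ γ := by positivity
  rw [hsplit, abs_mul, abs_of_nonneg hu']
  calc _ ≤ ‖u‖ ^ γ * (P * (Real.exp 16 * W) + P * (4 * (1 + ‖p‖⁻¹) * (Real.exp 16 * W))) :=
        mul_le_mul_of_nonneg_left ((abs_add_le _ _).trans (add_le_add t1 t2)) hu'
    _ = P * (Real.exp 16 * W) * ‖u‖ ^ γ * (5 + 4 * ‖p‖⁻¹) := by ring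
    _ ≤ P * (Real.exp 16 * W) * ‖u‖ ^ γ * (5 * (1 + ‖p‖⁻¹)) := by
        refine mul_le_mul_of_nonneg_left ?_ (by positivity)
        have i1 : 0 ≤ ‖p‖⁻¹ := by positivity
        linarith
    _ = _ := by rw [lossWeight]; ring

end

section

/-! ### Bounds of the reduced collision operator -/

theorem exists_abs_lossTerm_le {γ : ℝ} (hγ₀ : 0 ≤ γ) (hγ₁ : γ ≤ 1) :
    ∃ c : ℝ, 0 ≤ c ∧ ∀ {Ω : Set V3} {α A : ℝ} {h : V3 × V3 → ℝ},
      IsWeightedLipschitz Ω α A h → 0 ≤ α → ∀ z : V3 × V3,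
      |lossTerm γ h z| ≤ c * (1 + ‖z.2‖) ^ γ * A := by
  obtain ⟨c, hc0, hc⟩ := exists_integral_lossWeight_le hγ₀ hγ₁
  refine ⟨c, hc0, fun {Ω α A h} H hα z => ?_⟩
  have hA := H.nonneg
  rw [lossTerm, ← Real.norm_eq_abs]
  calc _ ≤ ∫ u, A * lossWeight γ z.2 u :=
        norm_integral_le_of_norm_le ((hc z.2).1.const_mul A)
          (Filter.Eventually.of_forall fun u => abs_loss_integrand_le H hα z u)
    _ = A * ∫ u, lossWeight γ z.2 u := integral_const_mul _ _
    _ ≤ A * (c * (1 + ‖z.2‖) ^ γ) := mul_le_mul_of_nonneg_left (hc z.2).2.1 hA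
    _ = _ := mul_comm _ _

theorem exists_abs_gainTerm_le {γ : ℝ} (hγ₀ : 0 ≤ γ) (hγ₁ : γ ≤ 1) :
    ∃ c : ℝ, 0 ≤ c ∧ ∀ {Ω : Set V3} {α A₁ A₂ : ℝ} {h₁ h₂ : V3 × V3 → ℝ},
      IsWeightedLipschitz Ω α A₁ h₁ → IsWeightedLipschitz Ω α A₂ h₂ → 0 ≤ α → ∀ z : V3 × V3,
      |gainTerm γ h₁ h₂ z| ≤ c * (1 + ‖z.2‖) ^ γ * (A₁ * A₂ * Real.exp (-α * ‖z.2‖ ^ 2)) := by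
  obtain ⟨c, hc0, hc⟩ := exists_integral_gainWeight_le hγ₀ hγ₁
  refine ⟨c, hc0, fun {Ω α A₁ A₂ h₁ h₂} H₁ H₂ hα z => ?_⟩
  have hA₁ := H₁.nonneg
  have hA₂ := H₂.nonneg
  rw [gainTerm, ← Real.norm_eq_abs]
  calc _ ≤ ∫ q, A₁ * A₂ * Real.exp (-α * ‖z.2‖ ^ 2) * gainWeight γ z.2 q
        ∂(volume.prod scatterMeasure) :=
        norm_integral_le_of_norm_le ((hc z.2).1.const_mul _)
          ((hc z.2).2.2.mono fun q hq => abs_gain_integrand_le H₁ H₂ hα z hq.2.2)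
    _ = A₁ * A₂ * Real.exp (-α * ‖z.2‖ ^ 2) *
        ∫ q, gainWeight γ z.2 q ∂(volume.prod scatterMeasure) := integral_const_mul _ _
    _ ≤ A₁ * A₂ * Real.exp (-α * ‖z.2‖ ^ 2) * (c * (1 + ‖z.2‖) ^ γ) :=
        mul_le_mul_of_nonneg_left (hc z.2).2.1 (by positivity)
    _ = _ := mul_comm _ _

theorem exists_abs_reducedGamma_le {C γ : ℝ} (hC : 0 < C) (hγ₀ : 0 ≤ γ) (hγ₁ : γ ≤ 1) :
    ∃ c : ℝ, 0 ≤ c ∧ ∀ {Ω : Set V3} {α A₁ A₂ : ℝ} {h₁ h₂ : V3 × V3 → ℝ},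
      IsWeightedLipschitz Ω α A₁ h₁ → IsWeightedLipschitz Ω α A₂ h₂ → 0 ≤ α → ∀ z : V3 × V3,
      |reducedGamma C γ h₁ h₂ z| ≤
        c * (1 + ‖z.2‖) ^ γ * (A₁ * A₂ * Real.exp (-α * ‖z.2‖ ^ 2)) := by
  obtain ⟨c₁, hc₁, h1⟩ := exists_abs_gainTerm_le hγ₀ hγ₁
  obtain ⟨c₂, hc₂, h2⟩ := exists_abs_lossTerm_le hγ₀ hγ₁
  set m := scatterMeasure.real univ with hm
  have hm0 : 0 ≤ m := measureReal_nonneg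
  refine ⟨C * (c₁ + m * c₂), by positivity, fun {Ω α A₁ A₂ h₁ h₂} H₁ H₂ hα z => ?_⟩
  have hA₁ := H₁.nonneg
  have hA₂ := H₂.nonneg
  rw [reducedGamma, abs_mul, abs_of_pos hC, mul_assoc, mul_assoc]
  refine mul_le_mul_of_nonneg_left ?_ hC.le
  refine (abs_sub _ _).trans ?_
  rw [abs_mul, abs_mul, abs_of_nonneg hm0]
  calc _ ≤ c₁ * (1 + ‖z.2‖) ^ γ * (A₁ * A₂ * Real.exp (-α * ‖z.2‖ ^ 2)) +
        m * (A₁ * Real.exp (-α * ‖z.2‖ ^ 2) * (c₂ * (1 + ‖z.2‖) ^ γ * A₂)) := by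
        gcongr
        · exact h1 H₁ H₂ hα z
        · exact H₁.abs_le z
        · exact h2 H₂ hα z
    _ = _ := by ring

theorem exists_abs_gainTerm_sub_le {γ : ℝ} (hγ₀ : 0 ≤ γ) (hγ₁ : γ ≤ 1) :
    ∃ c : ℝ, 0 ≤ c ∧ ∀ {Ω : Set V3} {R r α A₁ A₂ : ℝ} {h₁ h₂ : V3 × V3 → ℝ},
      IsWeightedLipschitz Ω α A₁ h₁ → IsWeightedLipschitz Ω α A₂ h₂ →
      UniformlyRound Ω (outwardNormal Ω) R r → 0 ≤ α → α ≤ 1 / 2 →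
      ∀ {x y v w : V3}, x ∈ Ω → y ∈ Ω → ‖v - w‖ * (1 + ‖v‖) ≤ 1 →
      |gainTerm γ h₁ h₂ (x, v) - gainTerm γ h₁ h₂ (y, w)| ≤
        c * (1 + ‖v‖) ^ γ * (A₁ * A₂ * Real.exp (-α * ‖v‖ ^ 2) *
          ((boundaryFactor Ω R x + boundaryFactor Ω R y) * (‖x - y‖ + ‖v - w‖))) := by
  obtain ⟨c, hc0, hc⟩ := exists_integral_gainWeight_le hγ₀ hγ₁
  refine ⟨9 * Real.exp 16 * c, by positivity,
    fun {Ω R r α A₁ A₂ h₁ h₂} H₁ H₂ hΩ hα hα' {x y v w} hx hy ht => ?_⟩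
  have hA₁ := H₁.nonneg
  have hA₂ := H₂.nonneg
  have hδx := boundaryFactor_nonneg Ω R x
  have hδy := boundaryFactor_nonneg Ω R y
  set P := A₁ * A₂ * Real.exp (-α * ‖v‖ ^ 2) *
          ((boundaryFactor Ω R x + boundaryFactor Ω R y) * (‖x - y‖ + ‖v - w‖)) with hP
  have hP0 : 0 ≤ P := by positivity
  have hi := integrable_gain_integrand H₁ H₂ hα hγ₀ hγ₁ (x, v)
  have hj := integrable_gain_integrand H₁ H₂ hα hγ₀ hγ₁ (y, w)
  rw [gainTerm, gainTerm, ← integral_sub hi hj, ← Real.norm_eq_abs]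
  calc _ ≤ ∫ q, 9 * Real.exp 16 * P * gainWeight γ v q ∂(volume.prod scatterMeasure) :=
        norm_integral_le_of_norm_le ((hc v).1.const_mul _)
          ((hc v).2.2.mono fun q hq =>
            abs_gain_integrand_sub_le H₁ H₂ hΩ hα hα' hx hy ht hq.2.2 hq.1 hq.2.1)
    _ = 9 * Real.exp 16 * P * ∫ q, gainWeight γ v q ∂(volume.prod scatterMeasure) :=
        integral_const_mul _ _
    _ ≤ 9 * Real.exp 16 * P * (c * (1 + ‖v‖) ^ γ) :=
        mul_le_mul_of_nonneg_left (hc v).2.1 (by positivity)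
    _ = _ := by ring

theorem exists_abs_lossTerm_sub_le {γ : ℝ} (hγ₀ : 0 ≤ γ) (hγ₁ : γ ≤ 1) :
    ∃ c : ℝ, 0 ≤ c ∧ ∀ {Ω : Set V3} {R r α A : ℝ} {h : V3 × V3 → ℝ},
      IsWeightedLipschitz Ω α A h →
      UniformlyRound Ω (outwardNormal Ω) R r → 0 ≤ α → α ≤ 1 / 2 →
      ∀ {x y v w : V3}, x ∈ Ω → y ∈ Ω → ‖v - w‖ ≤ 1 →
      |lossTerm γ h (x, v) - lossTerm γ h (y, w)| ≤
        c * (1 + ‖v‖) ^ γ * (A *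
          ((boundaryFactor Ω R x + boundaryFactor Ω R y) * (‖x - y‖ + ‖v - w‖))) := by
  obtain ⟨c, hc0, hc⟩ := exists_integral_lossWeight_le hγ₀ hγ₁
  refine ⟨5 * Real.exp 16 * c, by positivity,
    fun {Ω R r α A h} H hΩ hα hα' {x y v w} hx hy ht => ?_⟩
  have hA := H.nonneg
  have hδx := boundaryFactor_nonneg Ω R x
  have hδy := boundaryFactor_nonneg Ω R y
  set P := A * ((boundaryFactor Ω R x + boundaryFactor Ω R y) * (‖x - y‖ + ‖v - w‖)) with hP
  have hP0 : 0 ≤ P := by positivity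
  have hi := integrable_loss_integrand H hα hγ₀ hγ₁ (x, v)
  have hj := integrable_loss_integrand H hα hγ₀ hγ₁ (y, w)
  rw [lossTerm, lossTerm, ← integral_sub hi hj, ← Real.norm_eq_abs]
  calc _ ≤ ∫ u, 5 * Real.exp 16 * P * lossWeight γ v u :=
        norm_integral_le_of_norm_le ((hc v).1.const_mul _)
          ((hc v).2.2.mono fun q hq =>
            abs_loss_integrand_sub_le H hΩ hα hα' hx hy ht hq)
    _ = 5 * Real.exp 16 * P * ∫ u, lossWeight γ v u := integral_const_mul _ _
    _ ≤ 5 * Real.exp 16 * P * (c * (1 + ‖v‖) ^ γ) :=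
        mul_le_mul_of_nonneg_left (hc v).2.1 (by positivity)
    _ = _ := by ring

/-- The increment of h₁ at the velocity v itself is left unestimated. Bounding it by (1 + 1/|v|)
times the boundary factor and integrating along the chord would cost a second factor 1/|v|, too
singular for the weight; along the characteristic its Lipschitz constant is instead 1/w. -/
theorem exists_abs_reducedGamma_sub_le {C γ : ℝ} (hC : 0 < C) (hγ₀ : 0 ≤ γ) (hγ₁ : γ ≤ 1) :
    ∃ c : ℝ, 0 ≤ c ∧ ∀ {Ω : Set V3} {R r α A₁ A₂ : ℝ} {h₁ h₂ : V3 × V3 → ℝ},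
      IsWeightedLipschitz Ω α A₁ h₁ → IsWeightedLipschitz Ω α A₂ h₂ →
      UniformlyRound Ω (outwardNormal Ω) R r → 0 ≤ α → α ≤ 1 / 2 →
      ∀ {x y v w : V3}, x ∈ Ω → y ∈ Ω → ‖v - w‖ * (1 + ‖v‖) ≤ 1 →
      |reducedGamma C γ h₁ h₂ (x, v) - reducedGamma C γ h₁ h₂ (y, w)| ≤
        c * (1 + ‖v‖) ^ γ * (A₁ * A₂ * Real.exp (-α * ‖v‖ ^ 2) *
          ((boundaryFactor Ω R x + boundaryFactor Ω R y) * (‖x - y‖ + ‖v - w‖)) +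
          A₂ * |h₁ (x, v) - h₁ (y, w)|) := by
  obtain ⟨c₁, hc₁, d1⟩ := exists_abs_gainTerm_sub_le hγ₀ hγ₁
  obtain ⟨c₂, hc₂, d2⟩ := exists_abs_lossTerm_sub_le hγ₀ hγ₁
  obtain ⟨c₃, hc₃, d3⟩ := exists_abs_lossTerm_le hγ₀ hγ₁
  set m := scatterMeasure.real univ with hm
  have hm0 : 0 ≤ m := measureReal_nonneg
  refine ⟨C * (c₁ + m * (Real.exp 1 * c₂ + c₃)), by positivity,
    fun {Ω R r α A₁ A₂ h₁ h₂} H₁ H₂ hΩ hα hα' {x y v w} hx hy ht => ?_⟩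
  have hA₁ := H₁.nonneg
  have hA₂ := H₂.nonneg
  have hδx := boundaryFactor_nonneg Ω R x
  have hδy := boundaryFactor_nonneg Ω R y
  have ht1 : ‖v - w‖ ≤ 1 := by
    nlinarith [norm_nonneg v, mul_nonneg (norm_nonneg (v - w)) (norm_nonneg v)]
  set T := (boundaryFactor Ω R x + boundaryFactor Ω R y) * (‖x - y‖ + ‖v - w‖) with hT
  have hT0 : 0 ≤ T := by positivity
  set E := Real.exp (-α * ‖v‖ ^ 2) with hE
  set g := (1 + ‖v‖) ^ γ with hg
  have hg0 : 0 ≤ g := by positivity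
  set D := |h₁ (x, v) - h₁ (y, w)| with hD
  have hD0 : 0 ≤ D := abs_nonneg _
  -- Moving the Gaussian from w to v costs e^{2α|v||v-w|}, at most e since |v||v-w| ≤ 1 and α ≤ 1/2.
  have hb : |h₁ (y, w)| ≤ A₁ * (E * Real.exp 1) := by
    refine (H₁.abs_le (y, w)).trans (mul_le_mul_of_nonneg_left ?_ hA₁)
    refine (IsWeightedLipschitz.exp_neg_le hα (le_refl ‖v - w‖)).trans ?_
    rw [hE, ← Real.exp_add]
    apply Real.exp_le_exp.2
    have h1 : ‖v‖ * ‖v - w‖ ≤ 1 := by nlinarith [norm_nonneg (v - w)]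
    have h2 : 0 ≤ ‖v‖ * ‖v - w‖ := by positivity
    nlinarith
  have e1 := d1 H₁ H₂ hΩ hα hα' hx hy ht
  have e2 := d2 H₂ hΩ hα hα' hx hy ht1
  have e3 := d3 H₂ hα (x, v)
  have hs : reducedGamma C γ h₁ h₂ (x, v) - reducedGamma C γ h₁ h₂ (y, w) =
      C * ((gainTerm γ h₁ h₂ (x, v) - gainTerm γ h₁ h₂ (y, w)) -
        m * (h₁ (y, w) * (lossTerm γ h₂ (x, v) - lossTerm γ h₂ (y, w)) +
          (h₁ (x, v) - h₁ (y, w)) * lossTerm γ h₂ (x, v))) := by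
    rw [reducedGamma, reducedGamma]; ring
  rw [hs, abs_mul, abs_of_pos hC]
  have k : |(gainTerm γ h₁ h₂ (x, v) - gainTerm γ h₁ h₂ (y, w)) -
        m * (h₁ (y, w) * (lossTerm γ h₂ (x, v) - lossTerm γ h₂ (y, w)) +
          (h₁ (x, v) - h₁ (y, w)) * lossTerm γ h₂ (x, v))| ≤
      c₁ * g * (A₁ * A₂ * E * T) + m * (A₁ * (E * Real.exp 1) * (c₂ * g * (A₂ * T)) +
        D * (c₃ * g * A₂)) := by
    refine (abs_sub _ _).trans ?_
    rw [abs_mul, abs_of_nonneg hm0]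
    refine add_le_add e1 (mul_le_mul_of_nonneg_left ?_ hm0)
    refine (abs_add_le _ _).trans ?_
    rw [abs_mul, abs_mul]
    exact add_le_add (mul_le_mul hb e2 (abs_nonneg _) (by positivity))
      (mul_le_mul_of_nonneg_left e3 hD0)
  have hr : c₁ * g * (A₁ * A₂ * E * T) + m * (A₁ * (E * Real.exp 1) * (c₂ * g * (A₂ * T)) +
        D * (c₃ * g * A₂)) ≤
      (c₁ + m * (Real.exp 1 * c₂ + c₃)) * (g * (A₁ * A₂ * E * T + A₂ * D)) := by
    have p1 : 0 ≤ c₁ * (g * (A₂ * D)) := by positivity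
    have p2 : 0 ≤ m * Real.exp 1 * c₂ * (g * (A₂ * D)) := by positivity
    have p3 : 0 ≤ m * c₃ * (g * (A₁ * A₂ * E * T)) := by positivity
    nlinarith
  calc _ ≤ C * ((c₁ + m * (Real.exp 1 * c₂ + c₃)) * (g * (A₁ * A₂ * E * T + A₂ * D))) :=
        mul_le_mul_of_nonneg_left (k.trans hr) hC.le
    _ = _ := by ring

end

section

/-! ### Regularity of the transport integral -/

/-- The growth factor `(1 + |v|)^γ`. -/
def growth (γ : ℝ) (v : V3) : ℝ := (1 + ‖v‖) ^ γ

theorem one_le_growth_apply {γ : ℝ} (hγ₀ : 0 ≤ γ) (v : V3) : 1 ≤ growth γ v := one_le_growth hγ₀ v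

theorem growth_le {γ : ℝ} (hγ₁ : γ ≤ 1) (v : V3) : growth γ v ≤ 1 + ‖v‖ := by
  have h : 1 ≤ 1 + ‖v‖ := by linarith [norm_nonneg v]
  simpa [growth] using Real.rpow_le_rpow_of_exponent_le h hγ₁

theorem continuous_growth {γ : ℝ} (hγ₀ : 0 ≤ γ) : Continuous (growth γ) := by
  unfold growth
  exact (continuous_const.add continuous_norm).rpow_const fun _ => Or.inr hγ₀

/-- Source terms with Gaussian decay whose increments are controlled by the distance to the
boundary and by the increments of a weighted Lipschitz function `k`. -/
structure IsRegularSource (γ : ℝ) (Ω : Set V3) (R α c A : ℝ) (G k : V3 × V3 → ℝ) : Prop where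
  measurable : Measurable G
  lipschitz : IsWeightedLipschitz Ω α A k
  nonneg : 0 ≤ c
  abs_le : ∀ z, |G z| ≤ c * growth γ z.2 * (A * Real.exp (-α * ‖z.2‖ ^ 2))
  abs_sub_le : ∀ {x y v w : V3}, x ∈ Ω → y ∈ Ω → ‖v - w‖ * (1 + ‖v‖) ≤ 1 →
    |G (x, v) - G (y, w)| ≤ c * growth γ v * (A * Real.exp (-α * ‖v‖ ^ 2) *
      ((boundaryFactor Ω R x + boundaryFactor Ω R y) * (‖x - y‖ + ‖v - w‖)) +
      |k (x, v) - k (y, w)|)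

theorem IsWeightedLipschitz.const_mul {Ω : Set V3} {α A : ℝ} {h : V3 × V3 → ℝ}
    (H : IsWeightedLipschitz Ω α A h) {a : ℝ} (ha : 0 ≤ a) :
    IsWeightedLipschitz Ω α (A * a) (fun z => a * h z) := by
  have hA := H.nonneg
  refine ⟨H.measurable.const_mul a, fun z => ?_, fun z₁ z₂ hs m hm => ?_⟩
  · rw [abs_mul, abs_of_nonneg ha]
    calc a * |h z| ≤ a * (A * Real.exp (-α * ‖z.2‖ ^ 2)) :=
          mul_le_mul_of_nonneg_left (H.abs_le z) ha
      _ = _ := by ring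
  · rw [← mul_sub, abs_mul, abs_of_nonneg ha]
    rcases ha.eq_or_lt with rfl | ha
    · have := hm z₁ (left_mem_segment ℝ _ _)
      rw [mul_zero, zero_mul, zero_mul] at this
      rw [zero_mul]
      positivity
    · have h1 := H.abs_sub_le_of_segment z₁ z₂ hs (m / a) fun z hz => by
        rw [le_div_iff₀ ha]
        have := hm z hz
        linarith
      calc a * |h z₁ - h z₂| ≤ a * (m / a * ‖z₁ - z₂‖) := mul_le_mul_of_nonneg_left h1 ha.le
        _ = _ := by field_simp

theorem exists_isRegularSource {C γ : ℝ} (hC : 0 < C) (hγ₀ : 0 ≤ γ) (hγ₁ : γ ≤ 1) :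
    ∃ c : ℝ, 0 ≤ c ∧ ∀ {Ω : Set V3} {R r α A₁ A₂ : ℝ} {h₁ h₂ : V3 × V3 → ℝ},
      IsWeightedLipschitz Ω α A₁ h₁ → IsWeightedLipschitz Ω α A₂ h₂ →
      UniformlyRound Ω (outwardNormal Ω) R r → 0 ≤ α → α ≤ 1 / 2 →
      ∃ k, IsRegularSource γ Ω R α c (A₁ * A₂) (reducedGamma C γ h₁ h₂) k := by
  obtain ⟨c₁, hc₁, h1⟩ := exists_abs_reducedGamma_le hC hγ₀ hγ₁
  obtain ⟨c₂, hc₂, h2⟩ := exists_abs_reducedGamma_sub_le hC hγ₀ hγ₁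
  refine ⟨c₁ + c₂, by positivity, fun {Ω R r α A₁ A₂ h₁ h₂} H₁ H₂ hΩ hα hα' =>
    ⟨fun z => A₂ * h₁ z, measurable_reducedGamma H₁.measurable H₂.measurable,
      H₁.const_mul H₂.nonneg, by positivity, fun z => ?_, fun {x y v w} hx hy ht => ?_⟩⟩
  · have hA₁ := H₁.nonneg
    have hA₂ := H₂.nonneg
    have hg := zero_le_one.trans (one_le_growth_apply hγ₀ z.2)
    refine (h1 H₁ H₂ hα z).trans ?_
    change c₁ * growth γ z.2 * _ ≤ _
    gcongr
    linarith
  · have hA₁ := H₁.nonneg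
    have hA₂ := H₂.nonneg
    have hg := zero_le_one.trans (one_le_growth_apply hγ₀ v)
    have hδx := boundaryFactor_nonneg Ω R x
    have hδy := boundaryFactor_nonneg Ω R y
    refine (h2 H₁ H₂ hΩ hα hα' hx hy ht).trans ?_
    rw [← mul_sub, abs_mul, abs_of_nonneg hA₂]
    change c₂ * growth γ v * _ ≤ _
    gcongr
    linarith

/-- The point `z` is close to `z₀` in the sense needed for local estimates near `z₀`. -/
structure IsComparable (γ : ℝ) (Ω : Set V3) (α : ℝ) (z₀ z : V3 × V3) : Prop where
  mem : z ∈ Ω ×ˢ ({0}ᶜ : Set V3)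
  weight_ge : weight Ω z₀ / 2 ≤ weight Ω z
  growth_le : growth γ z.2 ≤ 2 * growth γ z₀.2
  growth_ge : growth γ z₀.2 ≤ 2 * growth γ z.2
  exp_le : Real.exp (-α * ‖z.2‖ ^ 2) ≤ 2 * Real.exp (-α * ‖z₀.2‖ ^ 2)
  time_le : exitTime Ω z.1 z.2 ≤ exitTime Ω z₀.1 z₀.2 + 1 / 2
  le_time : exitTime Ω z₀.1 z₀.2 ≤ exitTime Ω z.1 z.2 + 1 / 2
  norm_sub_le : ‖z.2 - z₀.2‖ * (2 * (2 + ‖z₀.2‖)) ≤ 1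

variable {Ω : Set V3} {R r α γ : ℝ}

theorem eventually_isComparable (hΩ : UniformlyRound Ω (outwardNormal Ω) R r) (hγ₀ : 0 ≤ γ)
    {z₀ : V3 × V3} (hz₀ : z₀ ∈ Ω ×ˢ ({0}ᶜ : Set V3)) :
    ∀ᶠ z in 𝓝 z₀, IsComparable γ Ω α z₀ z := by
  have hU := hΩ.isOpen_prod.mem_nhds hz₀
  have hw := hΩ.weight_pos hz₀
  have hg := one_le_growth_apply hγ₀ z₀.2
  have c1 : ContinuousAt (weight Ω) z₀ := hΩ.continuousOn_weight.continuousAt hU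
  have c2 : ContinuousAt (fun z : V3 × V3 => growth γ z.2) z₀ :=
    ((continuous_growth hγ₀).comp continuous_snd).continuousAt
  have c3 : ContinuousAt (fun z : V3 × V3 => Real.exp (-α * ‖z.2‖ ^ 2)) z₀ := by fun_prop
  have c4 : ContinuousAt (fun z : V3 × V3 => exitTime Ω z.1 z.2) z₀ :=
    hΩ.continuousOn_exitTime.continuousAt hU
  have c5 : ContinuousAt (fun z : V3 × V3 => ‖z.2 - z₀.2‖ * (2 * (2 + ‖z₀.2‖))) z₀ := by fun_prop
  have hE := Real.exp_pos (-α * ‖z₀.2‖ ^ 2)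
  filter_upwards [hU, c1.eventually_const_lt (half_lt_self hw),
    c2.eventually_lt_const (u := 2 * growth γ z₀.2) (by linarith),
    c2.eventually_const_lt (u := growth γ z₀.2 / 2) (by linarith),
    c3.eventually_lt_const (u := 2 * Real.exp (-α * ‖z₀.2‖ ^ 2)) (by linarith),
    c4.eventually_lt_const (u := exitTime Ω z₀.1 z₀.2 + 1 / 2) (by linarith),
    c4.eventually_const_lt (u := exitTime Ω z₀.1 z₀.2 - 1 / 2) (by linarith),
    c5.eventually_lt_const (u := 1) (by simp)] with z h0 h1 h2 h3 h4 h5 h6 h7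
  exact ⟨h0, h1.le, h2.le, by linarith, h4.le, h5.le, by linarith, h7.le⟩

/-- Half of the decay rate is traded for the factor s. -/
theorem exp_neg_mul_le {l : ℝ} (hl : 0 < l) (s : ℝ) :
    s * Real.exp (-(2 * l) * s) ≤ Real.exp (-l * s) / l := by
  rw [le_div_iff₀ hl, show -(2 * l) * s = -l * s + -l * s by ring, Real.exp_add]
  have h1 : l * s * Real.exp (-l * s) ≤ 1 := by
    have h2 := Real.add_one_le_exp (l * s)
    have h3 : Real.exp (l * s) * Real.exp (-l * s) = 1 := by rw [← Real.exp_add]; simp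
    nlinarith [Real.exp_pos (-l * s)]
  nlinarith [Real.exp_pos (-l * s)]

theorem integral_exp_neg_le {l t : ℝ} (hl : 0 < l) :
    ∫ s in (0 : ℝ)..t, Real.exp (-l * s) ≤ l⁻¹ := by
  have h : ∀ s ∈ uIcc 0 t, HasDerivAt (fun s => -l⁻¹ * Real.exp (-l * s)) (Real.exp (-l * s)) s := by
    intro s _
    have h1 := ((hasDerivAt_id s).const_mul (-l)).exp.const_mul (-l⁻¹)
    simp only [id] at h1
    refine h1.congr_deriv ?_
    linear_combination Real.exp (-l * s) * inv_mul_cancel₀ hl.ne'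
  rw [intervalIntegral.integral_eq_sub_of_hasDerivAt h
    (Continuous.intervalIntegrable (by fun_prop) _ _)]
  have : 0 < l⁻¹ * Real.exp (-l * t) := by positivity
  rw [mul_zero, Real.exp_zero]
  linarith

/-- Explains the factor 2(2+|v₀|) in the definition: two comparable points satisfy the smallness
condition of the increment bounds relative to each other. -/
theorem IsComparable.norm_sub_mul_le {z₀ z₁ z₂ : V3 × V3} (h₁ : IsComparable γ Ω α z₀ z₁)
    (h₂ : IsComparable γ Ω α z₀ z₂) : ‖z₁.2 - z₂.2‖ * (1 + ‖z₁.2‖) ≤ 1 ∧ ‖z₁.2 - z₂.2‖ ≤ 1 := by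
  have a1 := h₁.norm_sub_le
  have a2 := h₂.norm_sub_le
  have t : ‖z₁.2 - z₂.2‖ ≤ ‖z₁.2 - z₀.2‖ + ‖z₂.2 - z₀.2‖ := by
    rw [norm_sub_rev z₂.2]; exact norm_sub_le_norm_sub_add_norm_sub _ _ _
  have n0 := norm_nonneg z₀.2
  have n1 := norm_nonneg (z₁.2 - z₀.2)
  have n2 := norm_nonneg (z₂.2 - z₀.2)
  have n3 := norm_nonneg (z₁.2 - z₂.2)
  have t1 : ‖z₁.2‖ ≤ ‖z₁.2 - z₀.2‖ + ‖z₀.2‖ := by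
    simpa using norm_add_le (z₁.2 - z₀.2) z₀.2
  have t2 : ‖z₁.2 - z₀.2‖ ≤ 1 := by nlinarith
  have t3 : ‖z₁.2 - z₂.2‖ * (2 + ‖z₀.2‖) ≤ 1 := by nlinarith
  constructor <;> nlinarith

/-- The integrands are compared only up to the shorter time; the longer integral leaves a tail of
length t₂ - t₁. -/
theorem abs_integral_sub_le {f₁ f₂ p : ℝ → ℝ} {t₁ t₂ P T : ℝ} (h0 : 0 ≤ t₁) (h1 : t₁ ≤ t₂)
    (i₁ : IntervalIntegrable f₁ volume 0 t₁) (i₂ : IntervalIntegrable f₂ volume 0 t₂)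
    (ip : IntervalIntegrable p volume 0 t₁) (hp : ∫ s in (0 : ℝ)..t₁, p s ≤ P)
    (hd : ∀ s ∈ Ioo 0 t₁, |f₁ s - f₂ s| ≤ p s) (hT : ∀ s, t₁ ≤ s → |f₂ s| ≤ T) :
    |(∫ s in (0 : ℝ)..t₁, f₁ s) - ∫ s in (0 : ℝ)..t₂, f₂ s| ≤ P + T * (t₂ - t₁) := by
  have i₂a : IntervalIntegrable f₂ volume 0 t₁ :=
    i₂.mono_set (by rw [uIcc_of_le h0, uIcc_of_le (h0.trans h1)]; exact Icc_subset_Icc_right h1)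
  have i₂b : IntervalIntegrable f₂ volume t₁ t₂ :=
    i₂.mono_set (by rw [uIcc_of_le h1, uIcc_of_le (h0.trans h1)]; exact Icc_subset_Icc_left h0)
  rw [← intervalIntegral.integral_add_adjacent_intervals i₂a i₂b, ← sub_sub,
    ← intervalIntegral.integral_sub i₁ i₂a]
  refine (abs_sub _ _).trans (add_le_add ?_ ?_)
  · refine le_trans ?_ hp
    rw [← Real.norm_eq_abs]
    refine intervalIntegral.norm_integral_le_of_norm_le h0 ?_ ip
    filter_upwards [Measure.ae_ne volume t₁] with s hs hs'
    exact hd s ⟨hs'.1, lt_of_le_of_ne hs'.2 hs⟩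
  · rw [← Real.norm_eq_abs]
    have := intervalIntegral.norm_integral_le_of_norm_le_const (f := f₂) (a := t₁) (b := t₂) (C := T)
      (fun s hs => by rw [uIoc_of_le h1] at hs; exact hT s hs.1.le)
    rwa [abs_of_nonneg (sub_nonneg.2 h1)] at this

end

/-! ### Increments of the integrand along neighbouring characteristics. -/

section

variable {Ω : Set V3} {R r α γ c A : ℝ} {G k : V3 × V3 → ℝ}

/-- The exit time is quasiconcave: if z had left Ω by time s, its exit point would be a convex
combination of the positions of the two end trajectories at that time, both still in the convex set
Ω. -/
theorem UniformlyRound.lt_exitTime_segment (hΩ : UniformlyRound Ω (outwardNormal Ω) R r)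
    {z₁ z₂ z : V3 × V3} (h₁ : z₁ ∈ Ω ×ˢ ({0}ᶜ : Set V3)) (h₂ : z₂ ∈ Ω ×ˢ ({0}ᶜ : Set V3))
    (hz : z ∈ segment ℝ z₁ z₂) (hzU : z ∈ Ω ×ˢ ({0}ᶜ : Set V3)) {s : ℝ}
    (hs₁ : s < exitTime Ω z₁.1 z₁.2) (hs₂ : s < exitTime Ω z₂.1 z₂.2) :
    s < exitTime Ω z.1 z.2 := by
  by_contra hcon
  rw [not_lt] at hcon
  have hτ := hΩ.exitTime_pos hzU.1 hzU.2
  have hp := hΩ.exitPoint_mem hzU.1 hzU.2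
  rw [hΩ.isOpen.frontier_eq] at hp
  refine hp.2 ?_
  set t := exitTime Ω z.1 z.2 with ht
  have m1 := hΩ.sub_smul_mem h₁.1 h₁.2 hτ.le (hcon.trans_lt hs₁)
  have m2 := hΩ.sub_smul_mem h₂.1 h₂.2 hτ.le (hcon.trans_lt hs₂)
  obtain ⟨a, b, ha, hb, hab, rfl⟩ := hz
  have := hΩ.convex m1 m2 ha hb hab
  rw [exitPoint, ← ht]
  convert this using 1
  simp only [Prod.fst_add, Prod.smul_fst, Prod.snd_add, Prod.smul_snd]
  module

/-- Transport by time s is linear, so it maps the segment to a segment, and it preserves the weight.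
The Lipschitz constant is therefore that at z₀, up to 4 from comparability, and the map stretches
distances by at most 1 + s. -/
theorem IsWeightedLipschitz.abs_transported_sub_le (hk : IsWeightedLipschitz Ω α A k)
    (hΩ : UniformlyRound Ω (outwardNormal Ω) R r) {z₀ z₁ z₂ : V3 × V3} (hz₀ : z₀ ∈ Ω ×ˢ ({0}ᶜ : Set V3))
    (hseg : ∀ z ∈ segment ℝ z₁ z₂, IsComparable γ Ω α z₀ z) {s : ℝ} (hs : 0 ≤ s)
    (hs₁ : s < exitTime Ω z₁.1 z₁.2) (hs₂ : s < exitTime Ω z₂.1 z₂.2) :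
    |k (z₁.1 - s • z₁.2, z₁.2) - k (z₂.1 - s • z₂.2, z₂.2)| ≤
      4 * (A * Real.exp (-α * ‖z₀.2‖ ^ 2)) * (weight Ω z₀)⁻¹ * ((1 + s) * ‖z₁ - z₂‖) := by
  have hA := hk.nonneg
  have h₁ := (hseg z₁ (left_mem_segment ℝ _ _)).mem
  have h₂ := (hseg z₂ (right_mem_segment ℝ _ _)).mem
  have hw := hΩ.weight_pos hz₀
  let T : V3 × V3 →ₗ[ℝ] V3 × V3 :=
    (LinearMap.fst ℝ V3 V3 - s • LinearMap.snd ℝ V3 V3).prod (LinearMap.snd ℝ V3 V3)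
  have hT : ∀ z, T z = (z.1 - s • z.2, z.2) := fun z => rfl
  have himg : segment ℝ (T z₁) (T z₂) = T '' segment ℝ z₁ z₂ :=
    (image_segment ℝ T.toAffineMap z₁ z₂).symm
  have hin : ∀ z ∈ segment ℝ z₁ z₂, s < exitTime Ω z.1 z.2 := fun z hz =>
    hΩ.lt_exitTime_segment h₁ h₂ hz (hseg z hz).mem hs₁ hs₂
  have key := hk.abs_sub_le_of_segment (T z₁) (T z₂) (by
    rw [himg]
    rintro _ ⟨z, hz, rfl⟩
    exact ⟨hΩ.sub_smul_mem (hseg z hz).mem.1 (hseg z hz).mem.2 hs (hin z hz),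
      (hseg z hz).mem.2⟩) (4 * (A * Real.exp (-α * ‖z₀.2‖ ^ 2)) * (weight Ω z₀)⁻¹) (by
    rw [himg]
    rintro _ ⟨z, hz, rfl⟩
    have hc := hseg z hz
    rw [hT, hΩ.weight_sub_smul hc.mem.1 hc.mem.2 hs (hin z hz)]
    have e1 := hc.exp_le
    have e2 : (weight Ω z)⁻¹ ≤ 2 * (weight Ω z₀)⁻¹ := by
      rw [show 2 * (weight Ω z₀)⁻¹ = (weight Ω z₀ / 2)⁻¹ by field_simp]
      exact inv_anti₀ (by positivity) hc.weight_ge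
    calc A * Real.exp (-α * ‖z.2‖ ^ 2) * (weight Ω z)⁻¹
        ≤ A * (2 * Real.exp (-α * ‖z₀.2‖ ^ 2)) * (2 * (weight Ω z₀)⁻¹) :=
          mul_le_mul (mul_le_mul_of_nonneg_left e1 hA) e2
            (inv_pos.2 (hΩ.weight_pos hc.mem)).le (by positivity)
      _ = _ := by ring)
  refine key.trans (mul_le_mul_of_nonneg_left ?_ (by positivity))
  rw [← map_sub, hT, Prod.norm_def]
  have n1 : ‖(z₁ - z₂).1‖ ≤ ‖z₁ - z₂‖ := norm_fst_le _
  have n2 : ‖(z₁ - z₂).2‖ ≤ ‖z₁ - z₂‖ := norm_snd_le _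
  refine max_le ?_ ?_
  · calc ‖(z₁ - z₂).1 - s • (z₁ - z₂).2‖ ≤ ‖(z₁ - z₂).1‖ + ‖s • (z₁ - z₂).2‖ := norm_sub_le _ _
      _ ≤ ‖z₁ - z₂‖ + s * ‖z₁ - z₂‖ := by
          rw [norm_smul, Real.norm_of_nonneg hs]; gcongr
      _ = _ := by ring
  · refine n2.trans ?_
    nlinarith [norm_nonneg (z₁ - z₂)]

variable {ν : V3 → ℝ} {c₀ c₁ : ℝ}

/-- The product rule for exponential times source. The increment of the exponential carries s g²
with decay rate 2l, where l = c₀g/4; trading half the rate for s gives 1/l, which cancels one factor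
g. The decay is kept next to W, which is constant along the characteristic, and dropped next to Δ,
which is integrated by itself. -/
theorem abs_mul_sub_mul_le {c₀ c₁ c A E d g W s Δ e₁ e₂ G₁ G₂ : ℝ} (hc₀ : 0 < c₀) (hc₁ : 0 ≤ c₁)
    (hc : 0 ≤ c) (hA : 0 ≤ A) (hE : 0 ≤ E) (hd : 0 ≤ d) (hg : 1 ≤ g) (hW : 1 ≤ W) (hs : 0 ≤ s)
    (hΔ : 0 ≤ Δ) (he₂ : 0 ≤ e₂)
    (p1 : |e₁ - e₂| ≤ c₁ * (2 * g) * d * s * Real.exp (-(2 * (c₀ * g / 4)) * s))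
    (p2 : |G₁| ≤ c * (2 * g) * (A * (2 * E)))
    (q1 : e₂ ≤ Real.exp (-(2 * (c₀ * g / 4)) * s))
    (q2 : |G₁ - G₂| ≤ c * (2 * g) * (A * (2 * E) * (Δ * (2 * (1 + s) * d)) +
      4 * (A * E) * W * ((1 + s) * d))) :
    |e₁ * G₁ - e₂ * G₂| ≤ (32 * c₁ * c / c₀ + 8 * c * (1 + 4 / c₀)) * (A * E * d) *
      (g * (Real.exp (-(c₀ * g / 4) * s) * W + Δ)) := by
  have hl0 : 0 < c₀ * g / 4 := by positivity
  have hsx := exp_neg_mul_le hl0 s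
  have hl4 : g / (c₀ * g / 4) = 4 / c₀ := by field_simp
  have hYX : Real.exp (-(2 * (c₀ * g / 4)) * s) ≤ Real.exp (-(c₀ * g / 4) * s) :=
    Real.exp_le_exp.2 (by nlinarith)
  have hX1 : Real.exp (-(c₀ * g / 4) * s) ≤ 1 := Real.exp_le_one_iff.2 (by nlinarith)
  have hX0 := Real.exp_pos (-(c₀ * g / 4) * s)
  have hY0 := Real.exp_pos (-(2 * (c₀ * g / 4)) * s)
  generalize Real.exp (-(c₀ * g / 4) * s) = X at *
  generalize Real.exp (-(2 * (c₀ * g / 4)) * s) = Y at *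
  generalize c₀ * g / 4 = l at *
  have t1 : |(e₁ - e₂) * G₁| ≤ (32 * c₁ * c / c₀) * (A * E * d) * (g * (X * W)) := by
    rw [abs_mul]
    calc _ ≤ (c₁ * (2 * g) * d * s * Y) * (c * (2 * g) * (A * (2 * E))) :=
          mul_le_mul p1 p2 (abs_nonneg _) (by positivity)
      _ = (8 * c₁ * c * g) * (A * E * d) * (g * ((s * Y) * 1)) := by ring
      _ ≤ (8 * c₁ * c * g) * (A * E * d) * (g * ((X / l) * W)) := by gcongr
      _ = (8 * c₁ * c * (g / l)) * (A * E * d) * (g * (X * W)) := by ring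
      _ = _ := by rw [hl4]; ring
  have hsY : (1 + s) * Y ≤ (1 + 4 / c₀) * X := by
    have h1 : X / l ≤ 4 / c₀ * X := by
      rw [← hl4, div_mul_eq_mul_div]
      gcongr
      exact le_mul_of_one_le_left hX0.le hg
    linarith
  have hsY' : (1 + s) * Y ≤ (1 + 4 / c₀) * 1 := by
    refine hsY.trans ?_
    gcongr
  have t2 : |e₂ * (G₁ - G₂)| ≤ 8 * c * (1 + 4 / c₀) * (A * E * d) * (g * (X * W + Δ)) := by
    rw [abs_mul, abs_of_nonneg he₂]
    calc _ ≤ Y * (c * (2 * g) * (A * (2 * E) * (Δ * (2 * (1 + s) * d)) +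
          4 * (A * E) * W * ((1 + s) * d))) := mul_le_mul q1 q2 (abs_nonneg _) hY0.le
      _ = 8 * c * (A * E * d) * (g * (((1 + s) * Y) * W + ((1 + s) * Y) * Δ)) := by ring
      _ ≤ 8 * c * (A * E * d) * (g * (((1 + 4 / c₀) * X) * W + ((1 + 4 / c₀) * 1) * Δ)) := by
          gcongr
      _ = _ := by ring
  have hsplit : e₁ * G₁ - e₂ * G₂ = (e₁ - e₂) * G₁ + e₂ * (G₁ - G₂) := by ring
  rw [hsplit]
  refine (abs_add_le _ _).trans ((add_le_add t1 t2).trans ?_)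
  rw [add_mul, add_mul]
  gcongr
  linarith

theorem IsRegularSource.abs_integrand_sub_le (hS : IsRegularSource γ Ω R α c A G k)
    (hΩ : UniformlyRound Ω (outwardNormal Ω) R r) (hγ₀ : 0 ≤ γ) (hc₀ : 0 < c₀)
    (hν₀ : ∀ v, c₀ * growth γ v ≤ ν v) (hc₁ : 0 ≤ c₁)
    (hν₁ : ∀ v w, ‖v - w‖ ≤ 1 → |ν v - ν w| ≤ c₁ * growth γ v * ‖v - w‖)
    {z₀ z₁ z₂ : V3 × V3} (hz₀ : z₀ ∈ Ω ×ˢ ({0}ᶜ : Set V3))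
    (hseg : ∀ z ∈ segment ℝ z₁ z₂, IsComparable γ Ω α z₀ z) {s : ℝ} (hs : 0 ≤ s)
    (hs₁ : s < exitTime Ω z₁.1 z₁.2) (hs₂ : s < exitTime Ω z₂.1 z₂.2) :
    |Real.exp (-ν z₁.2 * s) * G (z₁.1 - s • z₁.2, z₁.2) -
      Real.exp (-ν z₂.2 * s) * G (z₂.1 - s • z₂.2, z₂.2)| ≤
      (32 * c₁ * c / c₀ + 8 * c * (1 + 4 / c₀)) *
        (A * Real.exp (-α * ‖z₀.2‖ ^ 2) * ‖z₁ - z₂‖) *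
        (growth γ z₀.2 * (Real.exp (-(c₀ * growth γ z₀.2 / 4) * s) * (weight Ω z₀)⁻¹ +
          (boundaryFactor Ω R (z₁.1 - s • z₁.2) + boundaryFactor Ω R (z₂.1 - s • z₂.2)))) := by
  have hA := hS.lipschitz.nonneg
  have hc := hS.nonneg
  have C₁ := hseg z₁ (left_mem_segment ℝ _ _)
  have C₂ := hseg z₂ (right_mem_segment ℝ _ _)
  obtain ⟨hd, hd1⟩ := C₁.norm_sub_mul_le C₂
  have n1 : ‖z₁.1 - z₂.1‖ ≤ ‖z₁ - z₂‖ := norm_fst_le (z₁ - z₂)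
  have n2 : ‖z₁.2 - z₂.2‖ ≤ ‖z₁ - z₂‖ := norm_snd_le (z₁ - z₂)
  have m1 := hΩ.sub_smul_mem C₁.mem.1 C₁.mem.2 hs hs₁
  have m2 := hΩ.sub_smul_mem C₂.mem.1 C₂.mem.2 hs hs₂
  have hk := hS.lipschitz.abs_transported_sub_le hΩ hz₀ hseg hs hs₁ hs₂
  have b1 := hS.abs_le (z₁.1 - s • z₁.2, z₁.2)
  have b2 := hS.abs_sub_le m1 m2 hd
  have e1 := C₁.exp_le
  have g1 := C₁.growth_le
  have g1' := C₁.growth_ge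
  have g2' := C₂.growth_ge
  have hνd := hν₁ _ _ hd1
  have hνa := hν₀ z₁.2
  have hνb := hν₀ z₂.2
  have hg0 := one_le_growth_apply hγ₀ z₀.2
  have hg1 := one_le_growth_apply hγ₀ z₁.2
  have hw := hΩ.weight_pos hz₀
  have hw1 : 1 ≤ (weight Ω z₀)⁻¹ := by
    refine (one_le_inv₀ hw).2 ?_
    have h1 := hΩ.exitCosine_le_one hz₀.1 hz₀.2
    have h2 := (hΩ.exitCosine_pos hz₀.1 hz₀.2).le
    have h3 : ‖z₀.2‖ / (‖z₀.2‖ + 1) ≤ 1 := by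
      rw [div_le_one (by positivity)]; linarith
    exact mul_le_one₀ h3 h2 h1
  have hg0' := zero_le_one.trans hg0
  have hδ₁ := boundaryFactor_nonneg Ω R (z₁.1 - s • z₁.2)
  have hδ₂ := boundaryFactor_nonneg Ω R (z₂.1 - s • z₂.2)
  have ν1 : 2 * (c₀ * growth γ z₀.2 / 4) ≤ ν z₁.2 := by
    have : c₀ * growth γ z₀.2 ≤ c₀ * (2 * growth γ z₁.2) := by gcongr
    linarith
  have ν2 : 2 * (c₀ * growth γ z₀.2 / 4) ≤ ν z₂.2 := by
    have : c₀ * growth γ z₀.2 ≤ c₀ * (2 * growth γ z₂.2) := by gcongr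
    linarith
  have n3 : ‖z₁.1 - s • z₁.2 - (z₂.1 - s • z₂.2)‖ + ‖z₁.2 - z₂.2‖ ≤
      2 * (1 + s) * ‖z₁ - z₂‖ := by
    have h1 : z₁.1 - s • z₁.2 - (z₂.1 - s • z₂.2) = (z₁.1 - z₂.1) - s • (z₁.2 - z₂.2) := by module
    have h2 : ‖z₁.1 - s • z₁.2 - (z₂.1 - s • z₂.2)‖ ≤ ‖z₁ - z₂‖ + s * ‖z₁ - z₂‖ := by
      rw [h1]
      refine (norm_sub_le _ _).trans ?_
      rw [norm_smul, Real.norm_of_nonneg hs]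
      gcongr
    have : 0 ≤ s * ‖z₁ - z₂‖ := by positivity
    linarith
  refine abs_mul_sub_mul_le hc₀ hc₁ hc hA (Real.exp_pos _).le (norm_nonneg _) hg0 hw1 hs
    (add_nonneg hδ₁ hδ₂) (Real.exp_pos _).le ?_ ?_ ?_ ?_
  · refine (abs_exp_sub_exp_le _ _).trans (mul_le_mul ?_ ?_ (Real.exp_pos _).le (by positivity))
    · rw [show -ν z₁.2 * s - -ν z₂.2 * s = -((ν z₁.2 - ν z₂.2) * s) by ring, abs_neg, abs_mul,
        abs_of_nonneg hs]
      refine mul_le_mul_of_nonneg_right (hνd.trans ?_) hs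
      gcongr
    · exact Real.exp_le_exp.2 (max_le (by nlinarith) (by nlinarith))
  · refine b1.trans ?_
    gcongr
  · exact Real.exp_le_exp.2 (by nlinarith)
  · refine b2.trans ?_
    gcongr

end

/-! ### Decay and local Lipschitz estimate of the transport integral. -/

section

variable {Ω : Set V3} {R r α γ c A : ℝ} {G k : V3 × V3 → ℝ}
variable {ν : V3 → ℝ} {c₀ c₁ : ℝ}

theorem IsRegularSource.abs_integrand_le (hS : IsRegularSource γ Ω R α c A G k) (hγ₀ : 0 ≤ γ)
    (hν₀ : ∀ v, c₀ * growth γ v ≤ ν v) (x v : V3) {s : ℝ} (hs : 0 ≤ s) :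
    |Real.exp (-ν v * s) * G (x - s • v, v)| ≤
      Real.exp (-(c₀ * growth γ v) * s) * (c * growth γ v * (A * Real.exp (-α * ‖v‖ ^ 2))) := by
  have hg := zero_le_one.trans (one_le_growth_apply hγ₀ v)
  rw [abs_mul, abs_of_pos (Real.exp_pos _)]
  refine mul_le_mul (Real.exp_le_exp.2 ?_) (hS.abs_le (x - s • v, v)) (abs_nonneg _)
    (Real.exp_pos _).le
  have := mul_le_mul_of_nonneg_right (hν₀ v) hs
  linarith

theorem exitTime_nonneg (Ω : Set V3) (x v : V3) : 0 ≤ exitTime Ω x v :=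
  Real.sInf_nonneg fun _ hs => hs.1

theorem IsRegularSource.intervalIntegrable (hS : IsRegularSource γ Ω R α c A G k) (hγ₀ : 0 ≤ γ)
    (hν₀ : ∀ v, c₀ * growth γ v ≤ ν v) (x v : V3) {t : ℝ} (ht : 0 ≤ t) :
    IntervalIntegrable (fun s => Real.exp (-ν v * s) * G (x - s • v, v)) volume 0 t := by
  have hi : IntervalIntegrable (fun s => Real.exp (-(c₀ * growth γ v) * s) *
      (c * growth γ v * (A * Real.exp (-α * ‖v‖ ^ 2)))) volume 0 t :=
    Continuous.intervalIntegrable (by fun_prop) _ _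
  have hm : Measurable fun s : ℝ => Real.exp (-ν v * s) * G (x - s • v, v) :=
    Measurable.mul (by fun_prop) (hS.measurable.comp (by fun_prop))
  refine hi.mono_fun' hm.aestronglyMeasurable ?_
  filter_upwards [ae_restrict_mem measurableSet_uIoc] with s hs
  rw [uIoc_of_le ht] at hs
  exact hS.abs_integrand_le hγ₀ hν₀ x v hs.1.le

/-- The growth of the source is exactly cancelled by the integral of the exponential, whose rate has
the same growth. -/
theorem IsRegularSource.abs_transport_le (hS : IsRegularSource γ Ω R α c A G k) (hγ₀ : 0 ≤ γ)
    (hc₀ : 0 < c₀) (hν₀ : ∀ v, c₀ * growth γ v ≤ ν v) (x v : V3) :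
    |∫ s in (0 : ℝ)..exitTime Ω x v, Real.exp (-ν v * s) * G (x - s • v, v)| ≤
      c / c₀ * (A * Real.exp (-α * ‖v‖ ^ 2)) := by
  have hA := hS.lipschitz.nonneg
  have hc := hS.nonneg
  have hg := one_le_growth_apply hγ₀ v
  have hg0 : 0 < growth γ v := zero_lt_one.trans_le hg
  rw [← Real.norm_eq_abs]
  calc _ ≤ ∫ s in (0 : ℝ)..exitTime Ω x v, Real.exp (-(c₀ * growth γ v) * s) *
      (c * growth γ v * (A * Real.exp (-α * ‖v‖ ^ 2))) :=
        intervalIntegral.norm_integral_le_of_norm_le (exitTime_nonneg _ _ _)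
          (Filter.Eventually.of_forall fun s hs => hS.abs_integrand_le hγ₀ hν₀ x v hs.1.le)
          (Continuous.intervalIntegrable (by fun_prop) _ _)
    _ = (∫ s in (0 : ℝ)..exitTime Ω x v, Real.exp (-(c₀ * growth γ v) * s)) *
      (c * growth γ v * (A * Real.exp (-α * ‖v‖ ^ 2))) := intervalIntegral.integral_mul_const _ _
    _ ≤ (c₀ * growth γ v)⁻¹ * (c * growth γ v * (A * Real.exp (-α * ‖v‖ ^ 2))) :=
        mul_le_mul_of_nonneg_right (integral_exp_neg_le (by positivity)) (by positivity)
    _ = _ := by field_simp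

/-- Since γ ≤ 1 the growth is at most 1 + |v|, and (1 + |v|)/(|v|N) is the inverse weight. The
factor |v|/(1+|v|) of the weight is made for this step. -/
theorem IsComparable.growth_div_le (hΩ : UniformlyRound Ω (outwardNormal Ω) R r) (hγ₁ : γ ≤ 1)
    {z₀ z : V3 × V3} (hz₀ : z₀ ∈ Ω ×ˢ ({0}ᶜ : Set V3)) (hz : IsComparable γ Ω α z₀ z) :
    growth γ z.2 / (‖z.2‖ * exitCosine Ω z.1 z.2) ≤ 2 * (weight Ω z₀)⁻¹ := by
  have hw := hΩ.weight_pos hz₀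
  have hn : 0 < ‖z.2‖ := norm_pos_iff.2 hz.mem.2
  have hN := hΩ.exitCosine_pos hz.mem.1 hz.mem.2
  have h1 : growth γ z.2 / (‖z.2‖ * exitCosine Ω z.1 z.2) ≤ (weight Ω z)⁻¹ := by
    rw [weight, mul_inv, inv_div]
    calc _ ≤ (‖z.2‖ + 1) / (‖z.2‖ * exitCosine Ω z.1 z.2) := by
          gcongr
          have := StationaryBoltzmann.growth_le hγ₁ z.2
          linarith
      _ = _ := by field_simp
  refine h1.trans ?_
  rw [show 2 * (weight Ω z₀)⁻¹ = (weight Ω z₀ / 2)⁻¹ by field_simp]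
  exact inv_anti₀ (by positivity) hz.weight_ge

theorem IsComparable.growth_div_norm_le (hΩ : UniformlyRound Ω (outwardNormal Ω) R r)
    (hγ₀ : 0 ≤ γ) (hγ₁ : γ ≤ 1) {z₀ z : V3 × V3} (hz₀ : z₀ ∈ Ω ×ˢ ({0}ᶜ : Set V3))
    (hz : IsComparable γ Ω α z₀ z) : growth γ z₀.2 / ‖z.2‖ ≤ 4 * (weight Ω z₀)⁻¹ := by
  have hn : 0 < ‖z.2‖ := norm_pos_iff.2 hz.mem.2
  have hN := hΩ.exitCosine_pos hz.mem.1 hz.mem.2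
  have hN1 := hΩ.exitCosine_le_one hz.mem.1 hz.mem.2
  have h1 := hz.growth_div_le hΩ hγ₁ hz₀
  have hg := zero_le_one.trans (one_le_growth_apply hγ₀ z.2)
  calc growth γ z₀.2 / ‖z.2‖ ≤ 2 * growth γ z.2 / (‖z.2‖ * exitCosine Ω z.1 z.2) := by
        gcongr
        · exact hz.growth_ge
        · exact mul_le_of_le_one_right hn.le hN1
    _ = 2 * (growth γ z.2 / (‖z.2‖ * exitCosine Ω z.1 z.2)) := by ring
    _ ≤ _ := by linarith

/-- The Lipschitz constant of the exit time is (2 + τ)/(|v|N) near z₁. The factor e^{-c₀τ} at the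
start of the tail absorbs 2 + τ, so the bound does not depend on the travel time. -/
theorem IsRegularSource.tail_le (hS : IsRegularSource γ Ω R α c A G k)
    (hΩ : UniformlyRound Ω (outwardNormal Ω) R r) (hγ₀ : 0 ≤ γ) (hγ₁ : γ ≤ 1) (hc₀ : 0 < c₀)
    {z₀ z₁ z₂ : V3 × V3} (hz₀ : z₀ ∈ Ω ×ˢ ({0}ᶜ : Set V3)) (C₁ : IsComparable γ Ω α z₀ z₁)
    (C₂ : IsComparable γ Ω α z₀ z₂) :
    Real.exp (-c₀ * exitTime Ω z₁.1 z₁.2) *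
      (c * growth γ z₂.2 * (A * Real.exp (-α * ‖z₂.2‖ ^ 2))) *
      (exitTime Ω z₂.1 z₂.2 - exitTime Ω z₁.1 z₁.2) ≤
      16 * (2 + c₀⁻¹) * c * (A * Real.exp (-α * ‖z₀.2‖ ^ 2) * (weight Ω z₀)⁻¹) * ‖z₁ - z₂‖ := by
  have hA := hS.lipschitz.nonneg
  have hc := hS.nonneg
  have hn : 0 < ‖z₁.2‖ := norm_pos_iff.2 C₁.mem.2
  have hN := hΩ.exitCosine_pos C₁.mem.1 C₁.mem.2
  have n1 : ‖z₂.1 - z₁.1‖ ≤ ‖z₁ - z₂‖ := by rw [norm_sub_rev]; exact norm_fst_le (z₁ - z₂)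
  have n2 : ‖z₂.2 - z₁.2‖ ≤ ‖z₁ - z₂‖ := by rw [norm_sub_rev]; exact norm_snd_le (z₁ - z₂)
  have hτ := hΩ.exitTime_sub_le C₁.mem.1 C₁.mem.2 C₂.mem.1 C₂.mem.2
  have τ1 := exitTime_nonneg Ω z₁.1 z₁.2
  have τ2 := exitTime_nonneg Ω z₂.1 z₂.2
  have hτ12 : exitTime Ω z₂.1 z₂.2 ≤ exitTime Ω z₁.1 z₁.2 + 1 := by
    linarith [C₂.time_le, C₁.le_time]
  have hg := C₁.growth_div_le hΩ hγ₁ hz₀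
  have hg2 : growth γ z₂.2 ≤ 4 * growth γ z₁.2 := by linarith [C₂.growth_le, C₁.growth_ge]
  have hg2' := zero_le_one.trans (one_le_growth_apply hγ₀ z₂.2)
  have hE := C₂.exp_le
  have hw := hΩ.weight_pos hz₀
  have hW : 0 < (weight Ω z₀)⁻¹ := inv_pos.2 hw
  have hd := norm_nonneg (z₁ - z₂)
  have hE0 := Real.exp_pos (-α * ‖z₀.2‖ ^ 2)
  have hE2 := Real.exp_pos (-α * ‖z₂.2‖ ^ 2)
  set P := ‖z₁.2‖ * exitCosine Ω z₁.1 z₁.2 with hP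
  have hP0 : 0 < P := by positivity
  generalize exitTime Ω z₁.1 z₁.2 = a at *
  generalize exitTime Ω z₂.1 z₂.2 = b at *
  have h1 : b - a ≤ (2 + a) * ‖z₁ - z₂‖ / P := by
    rw [le_div_iff₀ hP0]
    refine hτ.trans ?_
    have : b * ‖z₂.2 - z₁.2‖ ≤ (a + 1) * ‖z₁ - z₂‖ := by gcongr
    linarith
  have h2 : Real.exp (-c₀ * a) * (2 + a) ≤ 2 + c₀⁻¹ := by
    have h3 := Real.add_one_le_exp (c₀ * a)
    have h4 : Real.exp (c₀ * a) * Real.exp (-c₀ * a) = 1 := by rw [← Real.exp_add]; simp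
    have h5 : Real.exp (-c₀ * a) ≤ 1 := Real.exp_le_one_iff.2 (by nlinarith)
    have h6 : c₀ * (Real.exp (-c₀ * a) * a) ≤ 1 := by
      nlinarith [Real.exp_pos (-c₀ * a)]
    have h7 : Real.exp (-c₀ * a) * a ≤ c₀⁻¹ := by
      rw [← one_div, le_div_iff₀ hc₀]; linarith
    linarith
  have h3 : growth γ z₂.2 / P ≤ 8 * (weight Ω z₀)⁻¹ := by
    calc growth γ z₂.2 / P ≤ 4 * growth γ z₁.2 / P := by gcongr
      _ = 4 * (growth γ z₁.2 / P) := by ring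
      _ ≤ _ := by linarith
  generalize Real.exp (-α * ‖z₀.2‖ ^ 2) = E at *
  generalize Real.exp (-α * ‖z₂.2‖ ^ 2) = E₂ at *
  generalize (weight Ω z₀)⁻¹ = W at *
  generalize ‖z₁ - z₂‖ = d at *
  generalize growth γ z₂.2 = g at *
  have hX := Real.exp_pos (-c₀ * a)
  generalize Real.exp (-c₀ * a) = X at *
  calc X * (c * g * (A * E₂)) * (b - a)
      ≤ X * (c * g * (A * E₂)) * ((2 + a) * d / P) := by gcongr
    _ ≤ X * (c * g * (A * (2 * E))) * ((2 + a) * d / P) := by gcongr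
    _ = (X * (2 + a)) * c * (A * (2 * E) * (g / P)) * d := by ring
    _ ≤ (2 + c₀⁻¹) * c * (A * (2 * E) * (8 * W)) * d := by gcongr
    _ = _ := by ring

theorem integral_boundaryFactor_le (hΩ : UniformlyRound Ω (outwardNormal Ω) R r)
    {x v : V3} (hx : x ∈ Ω) (hv : v ≠ 0) {t : ℝ} (ht₀ : 0 ≤ t) (ht : t ≤ exitTime Ω x v) :
    IntervalIntegrable (fun s => boundaryFactor Ω R (x - s • v)) volume 0 t ∧
    ∫ s in (0 : ℝ)..t, boundaryFactor Ω R (x - s • v) ≤ 16 * R / ‖v‖ := by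
  obtain ⟨h1, h2⟩ := hΩ.integral_chord_le hx hv
  refine ⟨h1.mono_set ?_, ?_⟩
  · rw [uIcc_of_le ht₀, uIcc_of_le (ht₀.trans ht)]
    exact Icc_subset_Icc_right ht
  · refine le_trans ?_ h2
    exact intervalIntegral.integral_mono_interval le_rfl ht₀ ht
      (Filter.Eventually.of_forall fun s => boundaryFactor_nonneg Ω R (x - s • v)) h1

theorem IsRegularSource.abs_transport_sub_le_of_le (hS : IsRegularSource γ Ω R α c A G k)
    (hΩ : UniformlyRound Ω (outwardNormal Ω) R r) (hγ₀ : 0 ≤ γ) (hγ₁ : γ ≤ 1) (hc₀ : 0 < c₀)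
    (hν₀ : ∀ v, c₀ * growth γ v ≤ ν v) (hc₁ : 0 ≤ c₁)
    (hν₁ : ∀ v w, ‖v - w‖ ≤ 1 → |ν v - ν w| ≤ c₁ * growth γ v * ‖v - w‖)
    {z₀ z₁ z₂ : V3 × V3} (hz₀ : z₀ ∈ Ω ×ˢ ({0}ᶜ : Set V3))
    (hseg : ∀ z ∈ segment ℝ z₁ z₂, IsComparable γ Ω α z₀ z)
    (hle : exitTime Ω z₁.1 z₁.2 ≤ exitTime Ω z₂.1 z₂.2) :
    |(∫ s in (0 : ℝ)..exitTime Ω z₁.1 z₁.2, Real.exp (-ν z₁.2 * s) * G (z₁.1 - s • z₁.2, z₁.2)) -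
      ∫ s in (0 : ℝ)..exitTime Ω z₂.1 z₂.2, Real.exp (-ν z₂.2 * s) * G (z₂.1 - s • z₂.2, z₂.2)| ≤
      ((32 * c₁ * c / c₀ + 8 * c * (1 + 4 / c₀)) * (4 / c₀ + 128) + 16 * (2 + c₀⁻¹) * c) *
        (1 + R) * (A * Real.exp (-α * ‖z₀.2‖ ^ 2) * (weight Ω z₀)⁻¹) * ‖z₁ - z₂‖ := by
  have hA := hS.lipschitz.nonneg
  have hc := hS.nonneg
  have hR := hΩ.pos_R
  have C₁ := hseg z₁ (left_mem_segment ℝ _ _)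
  have C₂ := hseg z₂ (right_mem_segment ℝ _ _)
  have hg := one_le_growth_apply hγ₀ z₀.2
  have hg0 : 0 < growth γ z₀.2 := zero_lt_one.trans_le hg
  have hW : 0 < (weight Ω z₀)⁻¹ := inv_pos.2 (hΩ.weight_pos hz₀)
  have τ1 := exitTime_nonneg Ω z₁.1 z₁.2
  obtain ⟨i₁, d₁⟩ := integral_boundaryFactor_le hΩ C₁.mem.1 C₁.mem.2 τ1 le_rfl
  obtain ⟨i₂, d₂⟩ := integral_boundaryFactor_le hΩ C₂.mem.1 C₂.mem.2 τ1 hle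
  have v₁ := C₁.growth_div_norm_le hΩ hγ₀ hγ₁ hz₀
  have v₂ := C₂.growth_div_norm_le hΩ hγ₀ hγ₁ hz₀
  have ie : IntervalIntegrable (fun s => Real.exp (-(c₀ * growth γ z₀.2 / 4) * s) *
      (weight Ω z₀)⁻¹) volume 0 (exitTime Ω z₁.1 z₁.2) :=
    Continuous.intervalIntegrable (by fun_prop) _ _
  set K := 32 * c₁ * c / c₀ + 8 * c * (1 + 4 / c₀) with hK
  have hK0 : 0 ≤ K := by positivity
  have key := abs_integral_sub_le τ1 hle (hS.intervalIntegrable hγ₀ hν₀ z₁.1 z₁.2 τ1)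
    (hS.intervalIntegrable hγ₀ hν₀ z₂.1 z₂.2 (τ1.trans hle))
    (((ie.add (i₁.add i₂)).const_mul (growth γ z₀.2)).const_mul
      (K * (A * Real.exp (-α * ‖z₀.2‖ ^ 2) * ‖z₁ - z₂‖)))
    (P := K * (A * Real.exp (-α * ‖z₀.2‖ ^ 2) * ‖z₁ - z₂‖) *
      ((4 / c₀ + 128) * (1 + R) * (weight Ω z₀)⁻¹)) ?_
    (fun s hs => hS.abs_integrand_sub_le hΩ hγ₀ hc₀ hν₀ hc₁ hν₁ hz₀ hseg hs.1.le hs.2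
      (hs.2.trans_le hle))
    (T := Real.exp (-c₀ * exitTime Ω z₁.1 z₁.2) *
      (c * growth γ z₂.2 * (A * Real.exp (-α * ‖z₂.2‖ ^ 2)))) ?_
  · refine key.trans ((add_le_add le_rfl (hS.tail_le hΩ hγ₀ hγ₁ hc₀ hz₀ C₁ C₂)).trans ?_)
    have : 0 ≤ 16 * (2 + c₀⁻¹) * c * R *
        (A * Real.exp (-α * ‖z₀.2‖ ^ 2) * (weight Ω z₀)⁻¹) * ‖z₁ - z₂‖ := by positivity
    linarith
  · rw [intervalIntegral.integral_const_mul, intervalIntegral.integral_const_mul,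
      intervalIntegral.integral_add ie (i₁.add i₂), intervalIntegral.integral_add i₁ i₂,
      intervalIntegral.integral_mul_const]
    refine mul_le_mul_of_nonneg_left ?_ (by positivity)
    have h1 := integral_exp_neg_le (t := exitTime Ω z₁.1 z₁.2)
      (by positivity : 0 < c₀ * growth γ z₀.2 / 4)
    -- The growth cancels in the exponential part. In each of the two chord integrals it meets
    -- 16R/|v| and is bounded by 4/w, hence 128 = 2 · 16 · 4.
    calc _ ≤ growth γ z₀.2 * ((c₀ * growth γ z₀.2 / 4)⁻¹ * (weight Ω z₀)⁻¹ +
          (16 * R / ‖z₁.2‖ + 16 * R / ‖z₂.2‖)) := by gcongr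
      _ = 4 / c₀ * (weight Ω z₀)⁻¹ + 16 * R * (growth γ z₀.2 / ‖z₁.2‖) +
          16 * R * (growth γ z₀.2 / ‖z₂.2‖) := by field_simp; ring
      _ ≤ 4 / c₀ * (weight Ω z₀)⁻¹ + 16 * R * (4 * (weight Ω z₀)⁻¹) +
          16 * R * (4 * (weight Ω z₀)⁻¹) := by gcongr
      _ ≤ _ := by
          have : 0 ≤ (4 / c₀ * R + 128) * (weight Ω z₀)⁻¹ := by positivity
          linarith
  · intro s hs
    have hs0 := τ1.trans hs
    refine (hS.abs_integrand_le hγ₀ hν₀ z₂.1 z₂.2 hs0).trans ?_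
    have hg2 := one_le_growth_apply hγ₀ z₂.2
    have hg2' := zero_le_one.trans hg2
    refine mul_le_mul_of_nonneg_right (Real.exp_le_exp.2 ?_) (by positivity)
    have h1 : c₀ * exitTime Ω z₁.1 z₁.2 ≤ c₀ * s := by gcongr
    have h2 : c₀ * 1 * s ≤ c₀ * growth γ z₂.2 * s := by gcongr
    linarith

theorem IsRegularSource.exists_nhds_abs_transport_sub_le (hS : IsRegularSource γ Ω R α c A G k)
    (hΩ : UniformlyRound Ω (outwardNormal Ω) R r) (hγ₀ : 0 ≤ γ) (hγ₁ : γ ≤ 1) (hc₀ : 0 < c₀)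
    (hν₀ : ∀ v, c₀ * growth γ v ≤ ν v) (hc₁ : 0 ≤ c₁)
    (hν₁ : ∀ v w, ‖v - w‖ ≤ 1 → |ν v - ν w| ≤ c₁ * growth γ v * ‖v - w‖)
    {z₀ : V3 × V3} (hz₀ : z₀ ∈ Ω ×ˢ ({0}ᶜ : Set V3)) :
    ∃ N ∈ 𝓝 z₀, ∀ z₁ ∈ N, ∀ z₂ ∈ N,
    |(∫ s in (0 : ℝ)..exitTime Ω z₁.1 z₁.2, Real.exp (-ν z₁.2 * s) * G (z₁.1 - s • z₁.2, z₁.2)) -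
      ∫ s in (0 : ℝ)..exitTime Ω z₂.1 z₂.2, Real.exp (-ν z₂.2 * s) * G (z₂.1 - s • z₂.2, z₂.2)| ≤
      ((32 * c₁ * c / c₀ + 8 * c * (1 + 4 / c₀)) * (4 / c₀ + 128) + 16 * (2 + c₀⁻¹) * c) *
        (1 + R) * (A * Real.exp (-α * ‖z₀.2‖ ^ 2) * (weight Ω z₀)⁻¹) * ‖z₁ - z₂‖ := by
  obtain ⟨ε, hε, hb⟩ := Metric.eventually_nhds_iff_ball.1
    (eventually_isComparable (α := α) hΩ hγ₀ hz₀)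
  refine ⟨Metric.ball z₀ ε, Metric.ball_mem_nhds _ hε, fun z₁ h₁ z₂ h₂ => ?_⟩
  have hconv := convex_ball z₀ ε
  rcases le_total (exitTime Ω z₁.1 z₁.2) (exitTime Ω z₂.1 z₂.2) with hle | hle
  · exact hS.abs_transport_sub_le_of_le hΩ hγ₀ hγ₁ hc₀ hν₀ hc₁ hν₁ hz₀
      (fun z hz => hb z (hconv.segment_subset h₁ h₂ hz)) hle
  · rw [abs_sub_comm, norm_sub_rev z₁]
    exact hS.abs_transport_sub_le_of_le hΩ hγ₀ hγ₁ hc₀ hν₀ hc₁ hν₁ hz₀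
      (fun z hz => hb z (hconv.segment_subset h₂ h₁ hz)) hle

end

section

/-! ### Weak gradients of locally Lipschitz functions -/

theorem locallyIntegrableOn_congr_ae {E : Type*} [NormedAddCommGroup E] {s : Set (V3 × V3)}
    {f g : V3 × V3 → E} (hf : LocallyIntegrableOn f s volume) (h : f =ᵐ[volume.restrict s] g) :
    LocallyIntegrableOn g s volume := by
  intro z hz
  obtain ⟨t, ht, hi⟩ := hf z hz
  refine ⟨t ∩ s, Filter.inter_mem ht self_mem_nhdsWithin, ?_⟩
  exact (hi.mono_set inter_subset_left).congr_fun_ae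
    (ae_restrict_of_ae_restrict_of_subset inter_subset_right h)

theorem IsWeakGradX.congr_ae {Ω : Set V3} {f g : V3 × V3 → ℝ} {G : V3 × V3 → V3}
    (hf : IsWeakGradX Ω f G) (h : f =ᵐ[volume.restrict (phaseSpace Ω)] g) : IsWeakGradX Ω g G := by
  refine ⟨locallyIntegrableOn_congr_ae hf.locallyIntegrableOn h, hf.locallyIntegrableOn_grad,
    fun ψ hψ e => ?_⟩
  rw [← hf.integral_eq ψ hψ e]
  refine integral_congr_ae ?_
  filter_upwards [h] with z hz
  rw [hz]

theorem IsWeakGradV.congr_ae {Ω : Set V3} {f g : V3 × V3 → ℝ} {G : V3 × V3 → V3}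
    (hf : IsWeakGradV Ω f G) (h : f =ᵐ[volume.restrict (phaseSpace Ω)] g) : IsWeakGradV Ω g G := by
  refine ⟨locallyIntegrableOn_congr_ae hf.locallyIntegrableOn h, hf.locallyIntegrableOn_grad,
    fun ψ hψ e => ?_⟩
  rw [← hf.integral_eq ψ hψ e]
  refine integral_congr_ae ?_
  filter_upwards [h] with z hz
  rw [hz]

theorem hatNorm_le_of_isWeakGrad {Ω : Set V3} {α B L : ℝ} {f g : V3 × V3 → ℝ}
    {GX GV : V3 × V3 → V3} (hX : IsWeakGradX Ω f GX) (hV : IsWeakGradV Ω f GV)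
    (h : f =ᵐ[volume.restrict (phaseSpace Ω)] g) (hB : 0 ≤ B) (hL : 0 ≤ L)
    (bf : ∀ᵐ z ∂volume.restrict (phaseSpace Ω), |f z| ≤ B * Real.exp (-α * ‖z.2‖ ^ 2))
    (bX : ∀ᵐ z ∂volume.restrict (phaseSpace Ω),
      ‖weight Ω z • GX z‖ ≤ L * Real.exp (-α * ‖z.2‖ ^ 2))
    (bV : ∀ᵐ z ∂volume.restrict (phaseSpace Ω),
      ‖weight Ω z • GV z‖ ≤ L * Real.exp (-α * ‖z.2‖ ^ 2)) :
    hatNorm Ω α g ≤ ENNReal.ofReal (B + 2 * L) := by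
  have key : ∀ a b y : ℝ, a ≤ b * Real.exp (-α * y) → Real.exp (α * y) * a ≤ b := by
    intro a b y hab
    calc Real.exp (α * y) * a ≤ Real.exp (α * y) * (b * Real.exp (-α * y)) := by gcongr
      _ = b * (Real.exp (α * y) * Real.exp (-α * y)) := by ring
      _ = b := by rw [← Real.exp_add]; simp
  have h1 : supNorm Ω α g ≤ ENNReal.ofReal B := by
    refine essSup_le_of_ae_le _ ?_
    filter_upwards [h, bf] with z hz hb
    rw [← hz, ← ofReal_norm, ← ENNReal.ofReal_mul (by positivity)]
    exact ENNReal.ofReal_le_ofReal (key _ _ _ hb)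
  have h2 : ∀ {G : V3 × V3 → V3}, (∀ᵐ z ∂volume.restrict (phaseSpace Ω),
      ‖weight Ω z • G z‖ ≤ L * Real.exp (-α * ‖z.2‖ ^ 2)) →
      weightedSupNorm Ω α G ≤ ENNReal.ofReal L := by
    intro G bG
    refine essSup_le_of_ae_le _ ?_
    filter_upwards [bG] with z hb
    rw [← ofReal_norm, ← ENNReal.ofReal_mul (by positivity)]
    exact ENNReal.ofReal_le_ofReal (key _ _ _ hb)
  have h3 : gradXNorm Ω α g ≤ ENNReal.ofReal L := (iInf₂_le GX (hX.congr_ae h)).trans (h2 bX)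
  have h4 : gradVNorm Ω α g ≤ ENNReal.ofReal L := (iInf₂_le GV (hV.congr_ae h)).trans (h2 bV)
  calc hatNorm Ω α g ≤ ENNReal.ofReal B + ENNReal.ofReal L + ENNReal.ofReal L :=
        add_le_add (add_le_add h1 h3) h4
    _ = _ := by
        rw [← ENNReal.ofReal_add hB hL, ← ENNReal.ofReal_add (by positivity) hL]
        ring_nf

/-- On a compact neighbourhood of the support F is Lipschitz and extends to a globally Lipschitz
function. Rademacher's theorem and integration by parts for Lipschitz functions apply to the
extension, which agrees with F wherever the test function lives. -/
theorem integral_mul_fderiv_of_locallyLipschitzOn {U : Set (V3 × V3)} (hU : IsOpen U)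
    {F Ψ : V3 × V3 → ℝ} (hF : LocallyLipschitzOn U F) (hΨ : ContDiff ℝ 1 Ψ)
    (hc : HasCompactSupport Ψ) (hs : tsupport Ψ ⊆ U) (w : V3 × V3) :
    ∫ z, F z * fderiv ℝ Ψ z w = -∫ z, fderiv ℝ F z w * Ψ z := by
  obtain ⟨K, hK, hΨK, hKU⟩ := exists_compact_between hc.isCompact hU hs
  obtain ⟨L, hL⟩ := (hF.mono hKU).exists_lipschitzOnWith_of_compact hK
  obtain ⟨f, hf, hfF⟩ := hL.extend_real
  obtain ⟨D, hD⟩ := hΨ.lipschitzWith_of_hasCompactSupport hc one_ne_zero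
  have key := hf.integral_lineDeriv_mul_eq (μ := (volume : Measure (V3 × V3))) hD hc w
  have h1 : ∫ z, lineDeriv ℝ f z w * Ψ z = ∫ z, fderiv ℝ F z w * Ψ z := by
    refine integral_congr_ae ?_
    filter_upwards [hf.ae_differentiableAt (μ := (volume : Measure (V3 × V3)))] with z hz
    by_cases hzs : z ∈ tsupport Ψ
    · have he : F =ᶠ[𝓝 z] f := by
        filter_upwards [mem_interior_iff_mem_nhds.1 (hΨK hzs)] with y hy using hfF hy
      rw [hz.lineDeriv_eq_fderiv, he.fderiv_eq]
    · rw [image_eq_zero_of_notMem_tsupport hzs, mul_zero, mul_zero]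
  have h2 : ∫ z, lineDeriv ℝ Ψ z (-w) * f z = -∫ z, F z * fderiv ℝ Ψ z w := by
    rw [← integral_neg]
    congr 1 with z
    rw [((hΨ.differentiable one_ne_zero) z).lineDeriv_eq_fderiv, map_neg]
    by_cases hzs : z ∈ tsupport Ψ
    · rw [hfF (interior_subset (hΨK hzs))]; ring
    · have : fderiv ℝ Ψ z = 0 := by
        by_contra hne
        exact hzs (support_fderiv_subset ℝ hne)
      rw [this]; simp
  rw [← h1, key, h2, neg_neg]

/-- The dominating function of locally Lipschitz functions with weight `w`. -/
def singularMajorant (Ω : Set V3) (R : ℝ) (z : V3 × V3) : ℝ :=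
  (1 + ‖z.2‖⁻¹) * boundaryFactor Ω R z.1

theorem UniformlyRound.continuousOn_boundaryFactor {Ω : Set V3} {n : V3 → V3} {R r : ℝ}
    (hΩ : UniformlyRound Ω n R r) : ContinuousOn (boundaryFactor Ω R) Ω :=
  (continuousOn_const.div (Metric.continuous_infDist_pt _).continuousOn
    fun _ hx => (hΩ.infDist_pos hx).ne').sqrt

theorem integrableOn_inv_norm_snd {K : Set (V3 × V3)} (hK : IsCompact K) :
    IntegrableOn (fun z : V3 × V3 => 1 + ‖z.2‖⁻¹) K := by
  obtain ⟨ρ, hρ⟩ := hK.isBounded.subset_ball 0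
  have h1 : IntegrableOn (fun z : V3 × V3 => (1 : ℝ) * ‖z.2‖⁻¹)
      (Metric.ball (0 : V3) ρ ×ˢ Metric.ball (0 : V3) ρ) := by
    rw [IntegrableOn, Measure.volume_eq_prod, ← Measure.prod_restrict]
    refine Integrable.mul_prod (f := fun _ : V3 => (1 : ℝ)) ?_ (integrableOn_inv_norm ρ)
    exact integrableOn_const Metric.isBounded_ball.measure_lt_top.ne
  have h2 : K ⊆ Metric.ball (0 : V3) ρ ×ˢ Metric.ball (0 : V3) ρ := by
    rw [ball_prod_same]; exact hρ
  have h3 := h1.mono_set h2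
  simp only [one_mul] at h3
  exact (integrableOn_const hK.measure_lt_top.ne).add h3

theorem UniformlyRound.locallyIntegrableOn_singularMajorant {Ω : Set V3} {n : V3 → V3} {R r : ℝ}
    (hΩ : UniformlyRound Ω n R r) :
    LocallyIntegrableOn (singularMajorant Ω R) (phaseSpace Ω) := by
  have ho : IsOpen (phaseSpace Ω) := hΩ.isOpen.prod isOpen_univ
  rw [locallyIntegrableOn_iff ho.isLocallyClosed]
  intro K hK hKc
  refine (integrableOn_inv_norm_snd hKc).mul_continuousOn ?_ hKc
  exact hΩ.continuousOn_boundaryFactor.comp continuousOn_fst fun z hz => (hK hz).1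

end

/-! ### Removing the set of zero velocity and passing to the weighted norm. -/

section

/-- A bump function at the origin of the velocity space. -/
def velocityBump : ContDiffBump (0 : V3) := ⟨1, 2, one_pos, one_lt_two⟩

/-- A smooth cutoff that vanishes near zero velocity. -/
def velocityCutoff (n : ℕ) (z : V3 × V3) : ℝ :=
  1 - velocityBump (((n : ℝ) + 1) • z.2)

theorem contDiff_velocityCutoff (n : ℕ) : ContDiff ℝ 1 (velocityCutoff n) := by
  unfold velocityCutoff
  exact contDiff_const.sub ((ContDiffBump.contDiff _).comp (contDiff_snd.const_smul _))

theorem abs_velocityCutoff_le (n : ℕ) (z : V3 × V3) : |velocityCutoff n z| ≤ 1 := by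
  unfold velocityCutoff
  have h1 := velocityBump.nonneg
    (x := ((n : ℝ) + 1) • z.2)
  have h2 := velocityBump.le_one
    (x := ((n : ℝ) + 1) • z.2)
  rw [abs_le]
  constructor <;> linarith

theorem velocityCutoff_eventually_eq_zero (n : ℕ) {z : V3 × V3} (hz : z.2 = 0) :
    velocityCutoff n =ᶠ[𝓝 z] 0 := by
  have hcont : Continuous fun y : V3 × V3 => ‖((n : ℝ) + 1) • y.2‖ := by fun_prop
  have := (hcont.tendsto z).eventually_lt_const (u := 1) (by simp [hz])
  filter_upwards [this] with y hy
  simp only [velocityCutoff, Pi.zero_apply]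
  rw [ContDiffBump.one_of_mem_closedBall _ (by simpa [velocityBump] using hy.le), sub_self]

theorem eventually_velocityCutoff_eq_one {z : V3 × V3} (hz : z.2 ≠ 0) :
    ∀ᶠ n : ℕ in Filter.atTop, velocityCutoff n =ᶠ[𝓝 z] 1 := by
  have hn := norm_pos_iff.2 hz
  obtain ⟨N, hN⟩ := exists_nat_gt (2 / ‖z.2‖)
  filter_upwards [Filter.eventually_ge_atTop N] with n hnN
  have hcont : Continuous fun y : V3 × V3 => ‖((n : ℝ) + 1) • y.2‖ := by fun_prop
  have h2 : 2 < ‖((n : ℝ) + 1) • z.2‖ := by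
    rw [norm_smul, Real.norm_of_nonneg (by positivity)]
    rw [div_lt_iff₀ hn] at hN
    have : (N : ℝ) ≤ n := by exact_mod_cast hnN
    nlinarith
  filter_upwards [hcont.continuousAt.eventually_const_lt h2] with y hy
  simp only [velocityCutoff, Pi.one_apply]
  rw [ContDiffBump.zero_of_le_dist _ (by simpa [velocityBump] using hy.le), sub_zero]

theorem fderiv_velocityCutoff_apply (n : ℕ) (z w : V3 × V3) :
    fderiv ℝ (velocityCutoff n) z w =
      -(((n : ℝ) + 1) * fderiv ℝ velocityBump (((n : ℝ) + 1) • z.2) w.2) := by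
  have h1 : HasFDerivAt (fun z : V3 × V3 => ((n : ℝ) + 1) • z.2)
      (((n : ℝ) + 1) • ContinuousLinearMap.snd ℝ V3 V3) z :=
    (((n : ℝ) + 1) • ContinuousLinearMap.snd ℝ V3 V3).hasFDerivAt
  have h2 : HasFDerivAt velocityBump (fderiv ℝ velocityBump (((n : ℝ) + 1) • z.2))
      (((n : ℝ) + 1) • z.2) :=
    ((velocityBump.contDiff (n := 1)).differentiable one_ne_zero _).hasFDerivAt
  have h3 : HasFDerivAt (velocityCutoff n) _ z := (h2.comp z h1).const_sub 1
  rw [h3.fderiv]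
  simp

theorem exists_norm_fderiv_velocityBump_le :
    ∃ c : ℝ, ∀ y, ‖y‖ * ‖fderiv ℝ velocityBump y‖ ≤ c := by
  have hd : Continuous (fderiv ℝ velocityBump) :=
    (velocityBump.contDiff (n := 1)).continuous_fderiv one_ne_zero
  have hc : HasCompactSupport fun y => ‖y‖ * ‖fderiv ℝ velocityBump y‖ :=
    ((velocityBump.hasCompactSupport.fderiv ℝ).norm).mul_left
  obtain ⟨c, hb⟩ := hc.exists_bound_of_continuous (continuous_norm.mul hd.norm)
  exact ⟨c, fun y => (le_abs_self _).trans (hb y)⟩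

/-- Scaling: y ↦ |y| |∇b(y)| is bounded for the bump b, hence the gradient of every cutoff is at
most c/|v|. This bound is uniform in n and locally integrable, as dominated convergence requires. -/
theorem exists_fderiv_velocityCutoff_le :
    ∃ c : ℝ, 0 ≤ c ∧ ∀ (n : ℕ) (z w : V3 × V3), z.2 ≠ 0 →
      |fderiv ℝ (velocityCutoff n) z w| ≤ c * ‖z.2‖⁻¹ * ‖w‖ := by
  obtain ⟨c, hb⟩ := exists_norm_fderiv_velocityBump_le
  have hc0 : 0 ≤ c := le_trans (by positivity) (hb 0)
  refine ⟨c, hc0, fun n z w hz => ?_⟩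
  have hn := norm_pos_iff.2 hz
  rw [fderiv_velocityCutoff_apply, abs_neg, abs_mul, abs_of_nonneg (by positivity)]
  have ha0 : 0 < (n : ℝ) + 1 := by positivity
  generalize (n : ℝ) + 1 = a at *
  have h3 := hb (a • z.2)
  rw [norm_smul, Real.norm_of_nonneg ha0.le] at h3
  have h5 := (fderiv ℝ velocityBump (a • z.2)).le_opNorm w.2
  rw [Real.norm_eq_abs] at h5
  have h4 : ‖w.2‖ ≤ ‖w‖ := norm_snd_le w
  generalize ‖fderiv ℝ velocityBump (a • z.2)‖ = D at *
  calc a * |fderiv ℝ velocityBump (a • z.2) w.2| ≤ a * (D * ‖w.2‖) := by gcongr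
    _ = (a * ‖z.2‖ * D) * ‖z.2‖⁻¹ * ‖w.2‖ := by field_simp
    _ ≤ _ := by gcongr

variable {Ω : Set V3} {R r α B L : ℝ} {F ψ : V3 × V3 → ℝ}

/-- Integrate by parts against ψ times a cutoff vanishing near v = 0 and let the cutoff tend to 1.
Off v = 0 the cutoff is eventually equal to 1 near each point, so its derivative disappears in the
limit. -/
theorem integral_mul_fderiv_of_singular (hΩ : UniformlyRound Ω (outwardNormal Ω) R r)
    (hm : Measurable F) (hloc : LocallyLipschitzOn (Ω ×ˢ ({0}ᶜ : Set V3)) F)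
    (bF : ∀ z ∈ Ω ×ˢ ({0}ᶜ : Set V3), |F z| ≤ B)
    (bD : ∀ z ∈ Ω ×ˢ ({0}ᶜ : Set V3), ‖fderiv ℝ F z‖ ≤ L * singularMajorant Ω R z)
    (hψ : IsTestFunction Ω ψ) (w : V3 × V3) :
    ∫ z in phaseSpace Ω, F z * fderiv ℝ ψ z w = -∫ z in phaseSpace Ω, fderiv ℝ F z w * ψ z := by
  obtain ⟨c, hc0, hc⟩ := exists_fderiv_velocityCutoff_le
  set K := tsupport ψ with hK
  have hKc : IsCompact K := hψ.hasCompactSupport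
  have hKm : MeasurableSet K := hKc.measurableSet
  have hψ1 : ContDiff ℝ 1 ψ := hψ.contDiff.of_le (by exact_mod_cast le_top)
  have hψd : Continuous (fderiv ℝ ψ) := hψ1.continuous_fderiv one_ne_zero
  have hz0 : ∀ z ∉ K, ψ z = 0 := fun z hz => image_eq_zero_of_notMem_tsupport hz
  have hdz0 : ∀ z ∉ K, fderiv ℝ ψ z = 0 := by
    intro z hz
    by_contra hne
    exact hz (support_fderiv_subset ℝ hne)
  have e1 : ∫ z in phaseSpace Ω, F z * fderiv ℝ ψ z w = ∫ z in K, F z * fderiv ℝ ψ z w :=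
    (setIntegral_eq_of_subset_of_forall_sdiff_eq_zero (hΩ.isOpen.prod isOpen_univ).measurableSet
      hψ.tsupport_subset fun z hz => by rw [hdz0 z hz.2]; simp)
  have e2 : ∫ z in phaseSpace Ω, fderiv ℝ F z w * ψ z = ∫ z in K, fderiv ℝ F z w * ψ z :=
    (setIntegral_eq_of_subset_of_forall_sdiff_eq_zero (hΩ.isOpen.prod isOpen_univ).measurableSet
      hψ.tsupport_subset fun z hz => by rw [hz0 z hz.2]; simp)
  rw [e1, e2]
  have hU : ∀ᵐ z ∂volume.restrict K, z ∈ Ω ×ˢ ({0}ᶜ : Set V3) := by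
    have h1 : ∀ᵐ z ∂volume.restrict K, z ∈ phaseSpace Ω := by
      filter_upwards [ae_restrict_mem hKm] with z hz using hψ.tsupport_subset hz
    filter_upwards [h1, ae_restrict_of_ae (phaseSpace_ae_eq Ω)] with z h2 h3
    exact (eq_iff_iff.1 h3).2 h2
  have hprod : ∀ n z, fderiv ℝ (fun y => ψ y * velocityCutoff n y) z w =
      ψ z * fderiv ℝ (velocityCutoff n) z w + velocityCutoff n z * fderiv ℝ ψ z w := by
    intro n z
    have d1 : DifferentiableAt ℝ ψ z := hψ1.differentiable one_ne_zero z
    have d2 : DifferentiableAt ℝ (velocityCutoff n) z :=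
      (contDiff_velocityCutoff n).differentiable one_ne_zero z
    rw [fderiv_fun_mul d1 d2]
    rfl
  have hid : ∀ n : ℕ, ∫ z in K, F z * (ψ z * fderiv ℝ (velocityCutoff n) z w +
        velocityCutoff n z * fderiv ℝ ψ z w) =
      -∫ z in K, fderiv ℝ F z w * (ψ z * velocityCutoff n z) := by
    intro n
    have hts : tsupport (fun y => ψ y * velocityCutoff n y) ⊆ Ω ×ˢ ({0}ᶜ : Set V3) := by
      intro z hz
      have hzK : z ∈ K := tsupport_mul_subset_left hz
      refine ⟨(hψ.tsupport_subset hzK).1, fun h0 => ?_⟩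
      have h1 : z ∈ tsupport (velocityCutoff n) := tsupport_mul_subset_right hz
      exact (notMem_tsupport_iff_eventuallyEq.2 (velocityCutoff_eventually_eq_zero n h0)) h1
    have h := integral_mul_fderiv_of_locallyLipschitzOn hΩ.isOpen_prod hloc
      (hψ1.mul (contDiff_velocityCutoff n)) hψ.hasCompactSupport.mul_right hts w
    rw [setIntegral_eq_integral_of_forall_compl_eq_zero (fun z hz => by
        rw [hz0 z hz, hdz0 z hz]; simp),
      setIntegral_eq_integral_of_forall_compl_eq_zero (fun z hz => by rw [hz0 z hz]; simp), ← h]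
    congr 1 with z
    exact congrArg _ (hprod n z).symm
  obtain ⟨M, hM⟩ := hψ.hasCompactSupport.exists_bound_of_continuous hψ.contDiff.continuous
  obtain ⟨M', hM'⟩ := (hψ.hasCompactSupport.fderiv ℝ).exists_bound_of_continuous hψd
  have hM0 : 0 ≤ M := (norm_nonneg _).trans (hM 0)
  have hM0' : 0 ≤ M' := (norm_nonneg _).trans (hM' 0)
  have mF := measurable_fderiv_apply_const ℝ F w
  have lim1 : Filter.Tendsto (fun n : ℕ => ∫ z in K, F z * (ψ z * fderiv ℝ (velocityCutoff n) z w +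
        velocityCutoff n z * fderiv ℝ ψ z w)) Filter.atTop
      (𝓝 (∫ z in K, F z * fderiv ℝ ψ z w)) := by
    refine tendsto_integral_of_dominated_convergence
      (fun z => B * (M * c * ‖w‖ + M' * ‖w‖) * (1 + ‖z.2‖⁻¹)) (fun n => ?_)
      ((integrableOn_inv_norm_snd hKc).const_mul _) (fun n => ?_) ?_
    · have a1 : Continuous fun z => fderiv ℝ (velocityCutoff n) z w :=
        ((contDiff_velocityCutoff n).continuous_fderiv one_ne_zero).clm_apply continuous_const
      have a2 : Continuous fun z => fderiv ℝ ψ z w := hψd.clm_apply continuous_const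
      have a3 := (contDiff_velocityCutoff n).continuous
      exact (hm.mul ((hψ1.continuous.mul a1).add (a3.mul a2)).measurable).aestronglyMeasurable
    · filter_upwards [hU] with z hz
      have b1 := bF z hz
      have b2 := hc n z w hz.2
      have b3 : |ψ z| ≤ M := hM z
      have b4 : |fderiv ℝ ψ z w| ≤ M' * ‖w‖ :=
        ((fderiv ℝ ψ z).le_opNorm w).trans (by gcongr; exact hM' z)
      have b5 := abs_velocityCutoff_le n z
      have hB : 0 ≤ B := (abs_nonneg _).trans b1
      have hi : 0 ≤ ‖z.2‖⁻¹ := by positivity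
      rw [Real.norm_eq_abs, abs_mul]
      calc _ ≤ B * (M * (c * ‖z.2‖⁻¹ * ‖w‖) + 1 * (M' * ‖w‖)) := by
            refine mul_le_mul b1 ?_ (abs_nonneg _) hB
            refine (abs_add_le _ _).trans ?_
            rw [abs_mul, abs_mul]
            gcongr
        _ ≤ _ := by
            have p1 : 0 ≤ B * (M * c * ‖w‖) := by positivity
            have p2 : 0 ≤ B * (M' * ‖w‖) * ‖z.2‖⁻¹ := by positivity
            linarith
    · filter_upwards [hU] with z hz
      refine Filter.Tendsto.congr' ?_ tendsto_const_nhds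
      filter_upwards [eventually_velocityCutoff_eq_one hz.2] with n hn
      have h1 : fderiv ℝ (velocityCutoff n) z = 0 := by
        rw [hn.fderiv_eq]; exact fderiv_const_apply 1
      rw [h1, hn.eq_of_nhds]
      simp
  have lim2 : Filter.Tendsto (fun n : ℕ => ∫ z in K, fderiv ℝ F z w * (ψ z * velocityCutoff n z))
      Filter.atTop (𝓝 (∫ z in K, fderiv ℝ F z w * ψ z)) := by
    refine tendsto_integral_of_dominated_convergence
      (fun z => L * ‖w‖ * M * singularMajorant Ω R z) (fun n => ?_)
      ((hΩ.locallyIntegrableOn_singularMajorant.integrableOn_compact_subset hψ.tsupport_subset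
        hKc).const_mul _) (fun n => ?_) ?_
    · exact (mF.mul (hψ1.continuous.mul
        (contDiff_velocityCutoff n).continuous).measurable).aestronglyMeasurable
    · filter_upwards [hU] with z hz
      have b1 := bD z hz
      have b3 : |ψ z| ≤ M := hM z
      have b5 := abs_velocityCutoff_le n z
      rw [Real.norm_eq_abs, abs_mul, abs_mul]
      have b2 : |fderiv ℝ F z w| ≤ L * singularMajorant Ω R z * ‖w‖ :=
        ((fderiv ℝ F z).le_opNorm w).trans (mul_le_mul_of_nonneg_right b1 (norm_nonneg _))
      calc _ ≤ L * singularMajorant Ω R z * ‖w‖ * (M * 1) :=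
            mul_le_mul b2 (mul_le_mul b3 b5 (abs_nonneg _) hM0) (by positivity)
              ((abs_nonneg _).trans b2)
        _ = _ := by ring
    · filter_upwards [hU] with z hz
      refine Filter.Tendsto.congr' ?_ tendsto_const_nhds
      filter_upwards [eventually_velocityCutoff_eq_one hz.2] with n hn
      rw [hn.eq_of_nhds]
      simp
  have := tendsto_nhds_unique (lim1.congr hid) lim2.neg
  exact this

/-- The gradient along the image of `ι`, represented by the inner product. -/
def partialGradient (ι : V3 →L[ℝ] V3 × V3) (F : V3 × V3 → ℝ) (z : V3 × V3) : V3 :=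
  (InnerProductSpace.toDual ℝ V3).symm ((fderiv ℝ F z).comp ι)

theorem inner_partialGradient (ι : V3 →L[ℝ] V3 × V3) (F : V3 × V3 → ℝ) (z : V3 × V3) (e : V3) :
    inner ℝ (partialGradient ι F z) e = fderiv ℝ F z (ι e) := by
  rw [partialGradient, InnerProductSpace.toDual_symm_apply]
  rfl

theorem measurable_partialGradient (ι : V3 →L[ℝ] V3 × V3) (F : V3 × V3 → ℝ) :
    Measurable (partialGradient ι F) := by
  have h : Continuous fun T : V3 × V3 →L[ℝ] ℝ => (InnerProductSpace.toDual ℝ V3).symm (T.comp ι) :=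
    (InnerProductSpace.toDual ℝ V3).symm.continuous.comp (continuous_id.clm_comp continuous_const)
  exact h.measurable.comp (measurable_fderiv ℝ F)

theorem norm_partialGradient_le {ι : V3 →L[ℝ] V3 × V3} (hι : ‖ι‖ ≤ 1) (F : V3 × V3 → ℝ)
    (z : V3 × V3) : ‖partialGradient ι F z‖ ≤ ‖fderiv ℝ F z‖ := by
  rw [partialGradient, LinearIsometryEquiv.norm_map]
  refine (ContinuousLinearMap.opNorm_comp_le _ _).trans ?_
  exact mul_le_of_le_one_right (norm_nonneg _) hι

/-- Functions that are locally Lipschitz away from zero velocity, with local Lipschitz constants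
bounded by `e^{-α|v|²} / w`, belong to the weighted space. -/
theorem hatNorm_le_of_locallyLipschitz (hΩ : UniformlyRound Ω (outwardNormal Ω) R r)
    (hα : 0 ≤ α) (hB : 0 ≤ B) (hL : 0 ≤ L) (hm : Measurable F) {g : V3 × V3 → ℝ}
    (hFg : F =ᵐ[volume.restrict (phaseSpace Ω)] g)
    (bF : ∀ z ∈ Ω ×ˢ ({0}ᶜ : Set V3), |F z| ≤ B * Real.exp (-α * ‖z.2‖ ^ 2))
    (hloc : ∀ z₀ ∈ Ω ×ˢ ({0}ᶜ : Set V3), ∃ N ∈ 𝓝 z₀, ∀ z₁ ∈ N, ∀ z₂ ∈ N, |F z₁ - F z₂| ≤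
      L * (Real.exp (-α * ‖z₀.2‖ ^ 2) * (weight Ω z₀)⁻¹) * ‖z₁ - z₂‖) :
    hatNorm Ω α g ≤ ENNReal.ofReal (B + 2 * L) := by
  have hexp : ∀ v : V3, Real.exp (-α * ‖v‖ ^ 2) ≤ 1 := fun v =>
    Real.exp_le_one_iff.2 (by nlinarith [sq_nonneg ‖v‖])
  have hLL : LocallyLipschitzOn (Ω ×ˢ ({0}ᶜ : Set V3)) F := by
    intro z hz
    obtain ⟨N, hN, h⟩ := hloc z hz
    have hw := hΩ.weight_pos hz
    refine ⟨⟨L * (Real.exp (-α * ‖z.2‖ ^ 2) * (weight Ω z)⁻¹), by positivity⟩, N,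
      nhdsWithin_le_nhds hN, ?_⟩
    refine LipschitzOnWith.of_dist_le_mul fun x hx y hy => ?_
    rw [Real.dist_eq, dist_eq_norm]
    exact h x hx y hy
  have bW : ∀ z ∈ Ω ×ˢ ({0}ᶜ : Set V3),
      ‖fderiv ℝ F z‖ ≤ L * (Real.exp (-α * ‖z.2‖ ^ 2) * (weight Ω z)⁻¹) := by
    intro z hz
    obtain ⟨N, hN, h⟩ := hloc z hz
    have hw := hΩ.weight_pos hz
    refine norm_fderiv_le_of_lip' ℝ (by positivity) ?_
    filter_upwards [hN] with y hy
    exact h y hy z (mem_of_mem_nhds hN)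
  -- The inverse weight is replaced by a majorant that is a product of a function of x and a
  -- function of v, each locally integrable.
  have bD : ∀ z ∈ Ω ×ˢ ({0}ᶜ : Set V3), ‖fderiv ℝ F z‖ ≤ L * singularMajorant Ω R z := by
    intro z hz
    refine (bW z hz).trans (mul_le_mul_of_nonneg_left ?_ hL)
    have hw := inv_pos.2 (hΩ.weight_pos hz)
    exact (mul_le_of_le_one_left hw.le (hexp z.2)).trans (hΩ.inv_weight_le hz)
  have bF1 : ∀ z ∈ Ω ×ˢ ({0}ᶜ : Set V3), |F z| ≤ B := fun z hz =>
    (bF z hz).trans (mul_le_of_le_one_right hB (hexp z.2))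
  have hU : ∀ᵐ z ∂volume.restrict (phaseSpace Ω), z ∈ Ω ×ˢ ({0}ᶜ : Set V3) := by
    rw [← Measure.restrict_congr_set (phaseSpace_ae_eq Ω)]
    exact ae_restrict_mem hΩ.isOpen_prod.measurableSet
  have hcongr : ∀ {E : Type} [NormedAddCommGroup E] (f : V3 × V3 → E) (c : ℝ),
      AEStronglyMeasurable f volume → (∀ z ∈ Ω ×ˢ ({0}ᶜ : Set V3), ‖f z‖ ≤
      c * singularMajorant Ω R z) → LocallyIntegrableOn f (phaseSpace Ω) volume := by
    intro E _ f c hf hb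
    have h1 := hΩ.locallyIntegrableOn_singularMajorant.smul c
    intro z hz
    obtain ⟨t, ht, hi⟩ := h1 z hz
    refine ⟨t ∩ phaseSpace Ω, Filter.inter_mem ht self_mem_nhdsWithin, ?_⟩
    refine (hi.mono_set inter_subset_left).mono' hf.restrict ?_
    filter_upwards [ae_restrict_of_ae_restrict_of_subset inter_subset_right hU] with y hy
    exact hb y hy
  have liF : LocallyIntegrableOn F (phaseSpace Ω) volume := by
    refine hcongr F B hm.aestronglyMeasurable fun z hz => (bF1 z hz).trans ?_
    refine le_mul_of_one_le_right hB ?_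
    have h1 : 1 ≤ boundaryFactor Ω R z.1 := hΩ.one_le_sqrt hz.1
    have h2 : 0 ≤ ‖z.2‖⁻¹ := by positivity
    unfold singularMajorant
    nlinarith
  have liG : ∀ ι : V3 →L[ℝ] V3 × V3, ‖ι‖ ≤ 1 →
      LocallyIntegrableOn (partialGradient ι F) (phaseSpace Ω) volume := fun ι hι =>
    hcongr _ L (measurable_partialGradient ι F).aestronglyMeasurable fun z hz =>
      (norm_partialGradient_le hι F z).trans (bD z hz)
  have bG : ∀ ι : V3 →L[ℝ] V3 × V3, ‖ι‖ ≤ 1 → ∀ᵐ z ∂volume.restrict (phaseSpace Ω),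
      ‖weight Ω z • partialGradient ι F z‖ ≤ L * Real.exp (-α * ‖z.2‖ ^ 2) := by
    intro ι hι
    filter_upwards [hU] with z hz
    have hw := hΩ.weight_pos hz
    rw [norm_smul, Real.norm_of_nonneg hw.le]
    calc _ ≤ weight Ω z * (L * (Real.exp (-α * ‖z.2‖ ^ 2) * (weight Ω z)⁻¹)) := by
          gcongr; exact (norm_partialGradient_le hι F z).trans (bW z hz)
      _ = _ := by field_simp
  have nl : ‖ContinuousLinearMap.inl ℝ V3 V3‖ ≤ 1 := ContinuousLinearMap.norm_inl_le_one ℝ V3 V3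
  have nr : ‖ContinuousLinearMap.inr ℝ V3 V3‖ ≤ 1 := ContinuousLinearMap.norm_inr_le_one ℝ V3 V3
  refine hatNorm_le_of_isWeakGrad (GX := partialGradient (ContinuousLinearMap.inl ℝ V3 V3) F)
    (GV := partialGradient (ContinuousLinearMap.inr ℝ V3 V3) F) ⟨liF, liG _ nl, fun ψ hψ e => ?_⟩
    ⟨liF, liG _ nr, fun ψ hψ e => ?_⟩ hFg hB hL (hU.mono bF) (bG _ nl) (bG _ nr)
  · simp only [inner_partialGradient]
    exact integral_mul_fderiv_of_singular hΩ hm hLL bF1 bD hψ (e, 0)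
  · simp only [inner_partialGradient]
    exact integral_mul_fderiv_of_singular hΩ hm hLL bF1 bD hψ (0, e)

end

section

/-! ### The collision operator in reduced variables -/

theorem integral_angleMeasure {f : ℝ × ℝ → ℝ} (hf : Integrable f angleMeasure) :
    ∫ ϕ in (0 : ℝ)..(2 * Real.pi), ∫ θ in (0 : ℝ)..(Real.pi / 2),
      f (ϕ, θ) * (Real.sin θ * Real.cos θ) = ∫ p, f p ∂angleMeasure := by
  have hm : Measurable fun p : ℝ × ℝ => ENNReal.ofReal (Real.sin p.2 * Real.cos p.2) := by fun_prop
  have hlt : ∀ᵐ p ∂((volume.restrict (Ioc 0 (2 * Real.pi))).prod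
    (volume.restrict (Ioc 0 (Real.pi / 2)))),
      ENNReal.ofReal (Real.sin p.2 * Real.cos p.2) < ∞ :=
    Filter.Eventually.of_forall fun _ => ENNReal.ofReal_lt_top
  rw [angleMeasure] at hf ⊢
  rw [integrable_withDensity_iff_integrable_smul' hm hlt] at hf
  rw [integral_withDensity_eq_integral_toReal_smul hm hlt, integral_prod _ hf,
    intervalIntegral.integral_of_le (by positivity)]
  congr 1 with ϕ
  rw [intervalIntegral.integral_of_le (by positivity)]
  refine setIntegral_congr_fun measurableSet_Ioc fun θ hθ => ?_
  have h1 : 0 ≤ Real.sin θ := Real.sin_nonneg_of_nonneg_of_le_pi hθ.1.le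
    (by linarith [hθ.2, Real.pi_pos])
  have h2 : 0 ≤ Real.cos θ := Real.cos_nonneg_of_neg_pi_div_two_le_of_le
    (by linarith [hθ.1, Real.pi_pos]) hθ.2
  simp only [smul_eq_mul, ENNReal.toReal_ofReal (mul_nonneg h1 h2)]
  ring

/-- Since u·ω = |u| cos θ, the double-angle formulas give (u·ω)ω = (u + |u|σ)/2, where σ has polar
angle 2θ and the azimuth of ω. -/
theorem collision_velocities {e : V3 → OrthonormalBasis (Fin 3) ℝ V3} (he : IsCollisionFrame e)
    (v : V3) {u : V3} (hu : u ≠ 0) (ϕ θ : ℝ) :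
    postVelocity v (v + u) (collisionDirection e v (v + u) ϕ θ) =
      postV v (u, sphereVec (e u) (ϕ, θ)) ∧
    postVelocityStar v (v + u) (collisionDirection e v (v + u) ϕ θ) =
      postVS v (u, sphereVec (e u) (ϕ, θ)) := by
  have hn : ‖u‖ ≠ 0 := norm_ne_zero_iff.2 hu
  have h0 : e u 0 = ‖u‖⁻¹ • u := he u hu
  have hu0 : u = ‖u‖ • e u 0 := by rw [h0, smul_smul, mul_inv_cancel₀ hn, one_smul]
  have o := (e u).orthonormal
  have hω : collisionDirection e v (v + u) ϕ θ = Real.cos θ • e u 0 +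
      (Real.sin θ * Real.cos ϕ) • e u 1 + (Real.sin θ * Real.sin ϕ) • e u 2 := by
    rw [collisionDirection, add_sub_cancel_left, h0]
  have hin : inner ℝ u (collisionDirection e v (v + u) ϕ θ) = ‖u‖ * Real.cos θ := by
    rw [hω]
    nth_rewrite 1 [hu0]
    have i00 : inner ℝ (e u 0) (e u 0) = (1 : ℝ) := by
      rw [real_inner_self_eq_norm_sq, o.1 0]; norm_num
    have i01 : inner ℝ (e u 0) (e u 1) = (0 : ℝ) := o.2 (by decide)
    have i02 : inner ℝ (e u 0) (e u 2) = (0 : ℝ) := o.2 (by decide)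
    simp only [inner_add_right, inner_smul_left, inner_smul_right, i00, i01, i02]
    simp [mul_comm]
  have key : inner ℝ u (collisionDirection e v (v + u) ϕ θ) • collisionDirection e v (v + u) ϕ θ =
      (2⁻¹ : ℝ) • (u + ‖u‖ • sphereVec (e u) (ϕ, θ)) := by
    rw [show u + ‖u‖ • sphereVec (e u) (ϕ, θ) = ‖u‖ • e u 0 + ‖u‖ • sphereVec (e u) (ϕ, θ) by
      rw [← hu0], hin, hω, sphereVec]
    simp only [Real.cos_two_mul, Real.sin_two_mul]
    module
  constructor
  · rw [postVelocity, postV, add_sub_cancel_left, key]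
  · rw [postVelocityStar, postVS, add_sub_cancel_left, key]
    module

theorem sqrt_maxwellian_mul (v : V3) {q : V3 × V3} (hq : ‖q.2‖ = 1) :
    √(maxwellian (postV v q)) * √(maxwellian (postVS v q)) =
      √(maxwellian v) * √(maxwellian (v + q.1)) := by
  have h := norm_sq_postV_add v hq
  simp only [sqrt_maxwellian]
  have : Real.exp (-(1 / 2) * ‖postV v q‖ ^ 2) * Real.exp (-(1 / 2) * ‖postVS v q‖ ^ 2) =
      Real.exp (-(1 / 2) * ‖v‖ ^ 2) * Real.exp (-(1 / 2) * ‖v + q.1‖ ^ 2) := by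
    rw [← Real.exp_add, ← Real.exp_add]
    congr 1
    linear_combination (-(1 / 2) : ℝ) * h
  linear_combination √(Real.pi ^ (-(3 / 2) : ℝ)) ^ 2 * this

/-- For almost every fixed u the angular integral in the frame at u becomes an integral over the
sphere that does not involve the frame. By energy conservation the Maxwellian factors of the gain
term reduce to √M(v) √M(v⋆), and √M(v) cancels the prefactor. -/
theorem collisionGamma_eq_reducedGamma {C γ : ℝ} (hγ₀ : 0 ≤ γ) (hγ₁ : γ ≤ 1)
    {e : V3 → OrthonormalBasis (Fin 3) ℝ V3} (he : IsCollisionFrame e) {Ω : Set V3} {α A₁ A₂ : ℝ}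
    (hα : 0 ≤ α) {h₁ h₂ H₁ H₂ : V3 × V3 → ℝ} (L₁ : IsWeightedLipschitz Ω α A₁ H₁)
    (L₂ : IsWeightedLipschitz Ω α A₂ H₂) {z : V3 × V3} (hz : h₁ z = H₁ z)
    (hl : ∀ᵐ u : V3, h₂ (z.1, z.2 + u) = H₂ (z.1, z.2 + u))
    (hg : ∀ᵐ q ∂((volume : Measure V3).prod scatterMeasure),
      h₁ (z.1, postV z.2 q) = H₁ (z.1, postV z.2 q) ∧
      h₂ (z.1, postVS z.2 q) = H₂ (z.1, postVS z.2 q)) :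
    collisionGamma C γ e h₁ h₂ z = reducedGamma C γ H₁ H₂ z := by
  obtain ⟨x, v⟩ := z
  simp only at hl hg
  have igain := integrable_gain_integrand L₁ L₂ hα hγ₀ hγ₁ (x, v)
  have iloss := integrable_loss_integrand L₂ hα hγ₀ hγ₁ (x, v)
  simp only at igain iloss
  have hMv : √(maxwellian v) ≠ 0 := (Real.sqrt_pos.2 (maxwellian_pos v)).ne'
  have hg' := Measure.ae_ae_of_ae_prod hg
  have step : ∀ᵐ u : V3, (∫ ϕ in (0 : ℝ)..(2 * Real.pi), ∫ θ in (0 : ℝ)..(Real.pi / 2),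
      ((fun p => √(maxwellian p) * h₁ (x, p))
          (postVelocity v (v + u) (collisionDirection e v (v + u) ϕ θ)) *
        (fun p => √(maxwellian p) * h₂ (x, p))
          (postVelocityStar v (v + u) (collisionDirection e v (v + u) ϕ θ)) -
        (fun p => √(maxwellian p) * h₁ (x, p)) v * (fun p => √(maxwellian p) * h₂ (x, p)) (v + u)) *
        crossSection C γ ‖v - (v + u)‖ θ) =
      √(maxwellian v) * C * ((∫ σ, √(maxwellian (v + u)) * ‖u‖ ^ γ *
        (H₁ (x, postV v (u, σ)) * H₂ (x, postVS v (u, σ))) ∂scatterMeasure) -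
        scatterMeasure.real univ * (H₁ (x, v) *
          (√(maxwellian (v + u)) * ‖u‖ ^ γ * H₂ (x, v + u)))) := by
    filter_upwards [hg', hl, Measure.ae_ne volume (0 : V3), igain.prod_right_ae] with u h1 h2 h3 h4
    set k : V3 → ℝ := fun σ => √(maxwellian v) * C * (√(maxwellian (v + u)) * ‖u‖ ^ γ *
        (H₁ (x, postV v (u, σ)) * H₂ (x, postVS v (u, σ))) -
          H₁ (x, v) * (√(maxwellian (v + u)) * ‖u‖ ^ γ * H₂ (x, v + u))) with hk
    set f : ℝ × ℝ → ℝ := fun p => C * ‖u‖ ^ γ *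
      (√(maxwellian (postV v (u, sphereVec (e u) p))) * h₁ (x, postV v (u, sphereVec (e u) p)) *
        (√(maxwellian (postVS v (u, sphereVec (e u) p))) * h₂ (x, postVS v (u, sphereVec (e u) p)))
        - √(maxwellian v) * h₁ (x, v) * (√(maxwellian (v + u)) * h₂ (x, v + u))) with hf
    have hkint : Integrable k scatterMeasure := (h4.sub (integrable_const _)).const_mul _
    have hfk : f =ᵐ[angleMeasure] fun p => k (sphereVec (e u) p) := by
      rw [← map_sphereVec (e u)] at h1
      filter_upwards [ae_of_ae_map (continuous_sphereVec (e u)).measurable.aemeasurable h1]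
        with p hp
      simp only [hf, hk]
      rw [hp.1, hp.2, h2, hz]
      have := sqrt_maxwellian_mul v (q := (u, sphereVec (e u) p)) (norm_sphereVec _ _)
      simp only at this
      linear_combination C * ‖u‖ ^ γ * H₁ (x, postV v (u, sphereVec (e u) p)) *
        H₂ (x, postVS v (u, sphereVec (e u) p)) * this
    have hkm : AEStronglyMeasurable k (angleMeasure.map (sphereVec (e u))) := by
      rw [map_sphereVec]; exact hkint.aestronglyMeasurable
    have hfint : Integrable f angleMeasure := by
      refine Integrable.congr ?_ hfk.symm
      have := hkint
      rw [← map_sphereVec (e u)] at this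
      exact this.comp_measurable (continuous_sphereVec (e u)).measurable
    have hint : ∀ ϕ θ : ℝ, ((fun p => √(maxwellian p) * h₁ (x, p))
          (postVelocity v (v + u) (collisionDirection e v (v + u) ϕ θ)) *
        (fun p => √(maxwellian p) * h₂ (x, p))
          (postVelocityStar v (v + u) (collisionDirection e v (v + u) ϕ θ)) -
        (fun p => √(maxwellian p) * h₁ (x, p)) v * (fun p => √(maxwellian p) * h₂ (x, p)) (v + u)) *
        crossSection C γ ‖v - (v + u)‖ θ = f (ϕ, θ) * (Real.sin θ * Real.cos θ) := by
      intro ϕ θ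
      obtain ⟨c1, c2⟩ := collision_velocities he v h3 ϕ θ
      rw [c1, c2, crossSection, sub_add_cancel_left, norm_neg]
      simp only [hf]
      ring
    simp only [hint]
    rw [integral_angleMeasure hfint, integral_congr_ae hfk,
      ← integral_map (continuous_sphereVec (e u)).measurable.aemeasurable hkm, map_sphereVec,
      integral_const_mul, integral_sub h4 (integrable_const _), integral_const, smul_eq_mul]
  rw [collisionGamma, collisionQ, ← integral_add_left_eq_self (μ := volume) _ v,
    integral_congr_ae step, integral_const_mul,
    integral_sub igain.integral_prod_left ((iloss.const_mul _).const_mul _), integral_const_mul,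
    integral_const_mul, reducedGamma, gainTerm, lossTerm, ← integral_prod _ igain]
  field_simp

end

section

/-! ### Null sets along collisions and characteristics -/

/-- For each fixed y the shift preserves volume, so the claim holds with the quantifiers exchanged,
and Fubini exchanges them back. It shows that modifying the hᵢ on null sets leaves the collision
integral unchanged for almost every (x,v). -/
theorem ae_ae_shift_notMem {Y : Type*} [MeasurableSpace Y] (μ : Measure Y) [SFinite μ]
    {T : Y → V3} (hT : Measurable T) {Z : Set (V3 × V3)} (hZ : MeasurableSet Z)
    (hZ0 : volume Z = 0) : ∀ᵐ z : V3 × V3, ∀ᵐ y ∂μ, (z.1, z.2 + T y) ∉ Z := by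
  have hm : Measurable fun p : (V3 × V3) × Y => (p.1.1, p.1.2 + T p.2) := by fun_prop
  rw [Measure.ae_ae_comm (p := fun (z : V3 × V3) (y : Y) => (z.1, z.2 + T y) ∉ Z) (hm hZ).compl]
  refine Filter.Eventually.of_forall fun y => ?_
  have hmp : MeasurePreserving (fun z : V3 × V3 => (z.1, z.2 + T y)) :=
    (MeasurePreserving.id volume).prod (measurePreserving_add_right volume (T y))
  exact hmp.quasiMeasurePreserving.ae (measure_eq_zero_iff_ae_notMem.1 hZ0)

theorem measurePreserving_shear (s : ℝ) :
    MeasurePreserving (fun z : V3 × V3 => (z.1 - s • z.2, z.2)) := by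
  have h1 : MeasurePreserving (fun p : V3 × V3 => (p.1, p.2 - s • p.1))
      (volume.prod volume) (volume.prod volume) :=
    (MeasurePreserving.id volume).skew_product (g := fun a b => b - s • a)
      (by unfold Function.uncurry; fun_prop)
      (Filter.Eventually.of_forall fun a => (measurePreserving_sub_right volume (s • a)).map_eq)
  exact (Measure.measurePreserving_swap.comp h1).comp Measure.measurePreserving_swap

/-- The same Fubini argument along characteristics, with the volume-preserving shear at each fixed
time. -/
theorem ae_ae_transport {P : V3 × V3 → Prop} (hP : ∀ᵐ z, P z) :
    ∀ᵐ z : V3 × V3, ∀ᵐ s : ℝ, P (z.1 - s • z.2, z.2) := by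
  obtain ⟨Z, hPZ, hZ, hZ0⟩ := exists_measurable_superset_of_null hP
  have hm : Measurable fun p : (V3 × V3) × ℝ => (p.1.1 - p.2 • p.1.2, p.1.2) := by fun_prop
  have h : ∀ᵐ z : V3 × V3, ∀ᵐ s : ℝ, (z.1 - s • z.2, z.2) ∉ Z := by
    rw [Measure.ae_ae_comm (p := fun (z : V3 × V3) (s : ℝ) => (z.1 - s • z.2, z.2) ∉ Z)
      (hm hZ).compl]
    exact Filter.Eventually.of_forall fun s =>
      (measurePreserving_shear s).quasiMeasurePreserving.ae (measure_eq_zero_iff_ae_notMem.1 hZ0)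
  filter_upwards [h] with z hz
  filter_upwards [hz] with s hs
  by_contra hcon
  exact hs (hPZ hcon)

theorem ae_collisionGamma_eq {C γ : ℝ} (hγ₀ : 0 ≤ γ) (hγ₁ : γ ≤ 1)
    {e : V3 → OrthonormalBasis (Fin 3) ℝ V3} (he : IsCollisionFrame e) {Ω : Set V3}
    (hΩ : MeasurableSet Ω) {α A₁ A₂ : ℝ}
    (hα : 0 ≤ α) {h₁ h₂ H₁ H₂ : V3 × V3 → ℝ} (L₁ : IsWeightedLipschitz Ω α A₁ H₁)
    (L₂ : IsWeightedLipschitz Ω α A₂ H₂)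
    (e₁ : ∀ᵐ z ∂volume.restrict (phaseSpace Ω), H₁ z = h₁ z)
    (e₂ : ∀ᵐ z ∂volume.restrict (phaseSpace Ω), H₂ z = h₂ z) :
    ∀ᵐ z : V3 × V3, z.1 ∈ Ω → collisionGamma C γ e h₁ h₂ z = reducedGamma C γ H₁ H₂ z := by
  have hΩm : MeasurableSet (phaseSpace Ω) := hΩ.prod MeasurableSet.univ
  rw [ae_restrict_iff' hΩm] at e₁ e₂
  obtain ⟨Z, hPZ, hZ, hZ0⟩ := exists_measurable_superset_of_null (e₁.and e₂)
  have key : ∀ z : V3 × V3, z.1 ∈ Ω → z ∉ Z → h₁ z = H₁ z ∧ h₂ z = H₂ z := by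
    intro z hz hzZ
    have h : (z ∈ phaseSpace Ω → H₁ z = h₁ z) ∧ (z ∈ phaseSpace Ω → H₂ z = h₂ z) := by
      by_contra hcon
      exact hzZ (hPZ hcon)
    exact ⟨(h.1 ⟨hz, mem_univ _⟩).symm, (h.2 ⟨hz, mem_univ _⟩).symm⟩
  have a1 := ae_ae_shift_notMem (volume : Measure V3) measurable_id hZ hZ0
  have a2 := ae_ae_shift_notMem ((volume : Measure V3).prod scatterMeasure)
    (T := fun q => (2⁻¹ : ℝ) • (q.1 + ‖q.1‖ • q.2)) (by fun_prop) hZ hZ0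
  have a3 := ae_ae_shift_notMem ((volume : Measure V3).prod scatterMeasure)
    (T := fun q => (2⁻¹ : ℝ) • (q.1 - ‖q.1‖ • q.2)) (by fun_prop) hZ hZ0
  filter_upwards [measure_eq_zero_iff_ae_notMem.1 hZ0, a1, a2, a3] with z b0 b1 b2 b3 hz
  refine collisionGamma_eq_reducedGamma hγ₀ hγ₁ he hα L₁ L₂ (key z hz b0).1 ?_ ?_
  · filter_upwards [b1] with u hu
    exact (key (z.1, z.2 + u) hz hu).2
  · filter_upwards [b2, b3] with q h2 h3
    exact ⟨(key (z.1, postV z.2 q) hz h2).1, (key (z.1, postVS z.2 q) hz h3).2⟩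

theorem ae_transportS_eq {C γ : ℝ} {Ω : Set V3} {R r : ℝ}
    (hΩ : UniformlyRound Ω (outwardNormal Ω) R r) {f g : V3 × V3 → ℝ}
    (h : ∀ᵐ z : V3 × V3, z.1 ∈ Ω → f z = g z) :
    ∀ᵐ z ∂volume.restrict (phaseSpace Ω), transportS C γ Ω f z = transportS C γ Ω g z := by
  rw [← Measure.restrict_congr_set (phaseSpace_ae_eq Ω)]
  filter_upwards [ae_restrict_of_ae (ae_ae_transport h),
    ae_restrict_mem hΩ.isOpen_prod.measurableSet] with z hz hzU
  rw [transportS, transportS, intervalIntegral.integral_of_le (exitTime_nonneg _ _ _),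
    intervalIntegral.integral_of_le (exitTime_nonneg _ _ _)]
  refine setIntegral_congr_ae measurableSet_Ioc ?_
  filter_upwards [hz, Measure.ae_ne volume (exitTime Ω z.1 z.2)] with s h1 h2 h3
  rw [h1 (hΩ.sub_smul_mem hzU.1 hzU.2 h3.1.le (lt_of_le_of_ne h3.2 h2))]

/-! ### The main estimate -/

/-- The estimates are carried out for Lipschitz representatives and the reduced operator, then
transferred through almost everywhere equality. The factor 4 comes from the constants 2A₁ and 2A₂ of
the representatives. -/
theorem exists_hatNorm_transportS_le {C γ : ℝ} (hC : 0 < C) (hγ₀ : 0 ≤ γ) (hγ₁ : γ ≤ 1) :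
    ∃ K : ℝ, 0 ≤ K ∧ ∀ {e : V3 → OrthonormalBasis (Fin 3) ℝ V3}, IsCollisionFrame e →
      ∀ {Ω : Set V3} {R r α : ℝ}, UniformlyRound Ω (outwardNormal Ω) R r → 0 ≤ α → α ≤ 1 / 2 →
      ∀ {h₁ h₂ : V3 × V3 → ℝ} {A₁ A₂ : ℝ}, hatNorm Ω α h₁ < ENNReal.ofReal A₁ →
        hatNorm Ω α h₂ < ENNReal.ofReal A₂ →
        hatNorm Ω α (transportS C γ Ω (collisionGamma C γ e h₁ h₂)) ≤
          ENNReal.ofReal (K * (1 + R) * (A₁ * A₂)) := by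
  obtain ⟨c, hc, hsrc⟩ := exists_isRegularSource hC hγ₀ hγ₁
  obtain ⟨c₀, hc₀, hν₀⟩ := exists_collisionFrequency_ge hC hγ₀ hγ₁
  obtain ⟨c₁, hc₁, hν₁⟩ := exists_collisionFrequency_sub_le hC hγ₀ hγ₁
  set D := (32 * c₁ * c / c₀ + 8 * c * (1 + 4 / c₀)) * (4 / c₀ + 128) + 16 * (2 + c₀⁻¹) * c with hD
  have hD0 : 0 ≤ D := by positivity
  refine ⟨4 * (c / c₀ + 2 * D), by positivity,
    fun {e} he {Ω R r α} hΩ hα hα' {h₁ h₂ A₁ A₂} hA₁ hA₂ => ?_⟩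
  obtain ⟨H₁, L₁, e₁⟩ := exists_isWeightedLipschitz hΩ hα hA₁
  obtain ⟨H₂, L₂, e₂⟩ := exists_isWeightedLipschitz hΩ hα hA₂
  obtain ⟨k, hS⟩ := hsrc L₁ L₂ hΩ hα hα'
  have hR := hΩ.pos_R
  set A := 2 * A₁ * (2 * A₂) with hA
  have hA0 : 0 ≤ A := hS.lipschitz.nonneg
  set F := transportS C γ Ω (reducedGamma C γ H₁ H₂) with hF
  have bF : ∀ z : V3 × V3, |F z| ≤ c / c₀ * A * Real.exp (-α * ‖z.2‖ ^ 2) := fun z => by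
    rw [mul_assoc]
    exact hS.abs_transport_le hγ₀ hc₀ hν₀ z.1 z.2
  have hloc : ∀ z₀ ∈ Ω ×ˢ ({0}ᶜ : Set V3), ∃ N ∈ 𝓝 z₀, ∀ z₁ ∈ N, ∀ z₂ ∈ N, |F z₁ - F z₂| ≤
      D * (1 + R) * A * (Real.exp (-α * ‖z₀.2‖ ^ 2) * (weight Ω z₀)⁻¹) * ‖z₁ - z₂‖ := by
    intro z₀ hz₀
    obtain ⟨N, hN, h⟩ := hS.exists_nhds_abs_transport_sub_le hΩ hγ₀ hγ₁ hc₀ hν₀ hc₁ hν₁ hz₀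
    refine ⟨N, hN, fun z₁ h₁ z₂ h₂ => (h z₁ h₁ z₂ h₂).trans_eq ?_⟩
    ring
  set U : Set (V3 × V3) := Ω ×ˢ ({0}ᶜ : Set V3) with hU
  have hUo : IsOpen U := hΩ.isOpen_prod
  have hcont : ContinuousOn F U := by
    intro z hz
    obtain ⟨N, hN, h⟩ := hloc z hz
    have hw := hΩ.weight_pos hz
    have hl : LipschitzOnWith ⟨D * (1 + R) * A * (Real.exp (-α * ‖z.2‖ ^ 2) * (weight Ω z)⁻¹),
        by positivity⟩ F N := by
      refine LipschitzOnWith.of_dist_le_mul fun x hx y hy => ?_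
      rw [Real.dist_eq, dist_eq_norm]
      exact h x hx y hy
    exact (hl.continuousOn.continuousAt hN).continuousWithinAt
  -- Continuity of F is known only on U, so measurability is obtained after cutting off outside U, a
  -- change on a null set of the phase space.
  have hmeas : Measurable (U.indicator F) := by
    classical
    have h1 := hcont.measurable_piecewise (continuousOn_const (c := (0 : ℝ)) (s := Uᶜ))
      hUo.measurableSet
    change Measurable (U.piecewise F 0) at h1
    rwa [piecewise_eq_indicator] at h1
  have hae : U.indicator F =ᵐ[volume.restrict (phaseSpace Ω)]
      transportS C γ Ω (collisionGamma C γ e h₁ h₂) := by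
    have h1 := ae_transportS_eq (C := C) (γ := γ) hΩ (ae_collisionGamma_eq (C := C) hγ₀ hγ₁ he
      hΩ.isOpen.measurableSet hα L₁ L₂ e₁ e₂)
    have h2 : ∀ᵐ z ∂volume.restrict (phaseSpace Ω), z ∈ U := by
      rw [← Measure.restrict_congr_set (phaseSpace_ae_eq Ω)]
      exact ae_restrict_mem hUo.measurableSet
    filter_upwards [h1, h2] with z h3 h4
    rw [indicator_of_mem h4, h3]
  refine (hatNorm_le_of_locallyLipschitz hΩ hα (B := c / c₀ * A) (L := D * (1 + R) * A)
    (by positivity) (by positivity) hmeas hae (fun z hz => ?_) (fun z hz => ?_)).trans ?_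
  · rw [indicator_of_mem hz]
    exact bF z
  · obtain ⟨N, hN, h⟩ := hloc z hz
    refine ⟨N ∩ U, Filter.inter_mem hN (hUo.mem_nhds hz), fun z₁ h₁ z₂ h₂ => ?_⟩
    rw [indicator_of_mem h₁.2, indicator_of_mem h₂.2]
    exact h z₁ h₁.1 z₂ h₂.1
  · refine ENNReal.ofReal_le_ofReal ?_
    have h1 : c / c₀ * A ≤ c / c₀ * (1 + R) * A := by
      have : 0 ≤ c / c₀ * R * A := by positivity
      linarith
    calc c / c₀ * A + 2 * (D * (1 + R) * A) ≤ c / c₀ * (1 + R) * A + 2 * (D * (1 + R) * A) := by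
          linarith
      _ = _ := by rw [hA]; ring

/-- The norms contain infima over weak gradients, so the estimate is available for strict upper
bounds A and B only; letting these decrease to the norms also covers norms equal to zero. -/
theorem le_ofReal_mul_mul_of_forall_lt {x a b : ℝ≥0∞} {κ : ℝ} (hκ : 0 ≤ κ) (ha : a ≠ ∞)
    (hb : b ≠ ∞) (h : ∀ A B : ℝ, a < ENNReal.ofReal A → b < ENNReal.ofReal B →
      x ≤ ENNReal.ofReal (κ * (A * B))) : x ≤ ENNReal.ofReal κ * a * b := by
  have hlim : Filter.Tendsto (fun ε : ℝ => ENNReal.ofReal (κ * ((a.toReal + ε) * (b.toReal + ε))))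
      (𝓝[>] 0) (𝓝 (ENNReal.ofReal (κ * ((a.toReal + 0) * (b.toReal + 0))))) := by
    refine (ENNReal.continuous_ofReal.comp (?_ : Continuous fun ε : ℝ =>
      κ * ((a.toReal + ε) * (b.toReal + ε)))).continuousAt.tendsto.mono_left nhdsWithin_le_nhds
    fun_prop
  have hle : x ≤ ENNReal.ofReal (κ * ((a.toReal + 0) * (b.toReal + 0))) := by
    refine ge_of_tendsto hlim ?_
    filter_upwards [self_mem_nhdsWithin] with ε hε
    have hε : 0 < ε := hε
    refine h _ _ ?_ ?_
    · exact (ENNReal.lt_ofReal_iff_toReal_lt ha).2 (by linarith)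
    · exact (ENNReal.lt_ofReal_iff_toReal_lt hb).2 (by linarith)
  rw [add_zero, add_zero, ENNReal.ofReal_mul hκ, ENNReal.ofReal_mul ENNReal.toReal_nonneg,
    ENNReal.ofReal_toReal ha, ENNReal.ofReal_toReal hb, ← mul_assoc] at hle
  exact hle

end

end

end StationaryBoltzmann

theorem mainTheorem3 (C γ : ℝ) (hC : 0 < C) (hγ₀ : 0 ≤ γ) (hγ₁ : γ ≤ 1)
    (ρ : ℝ) (hρ₀ : 0 ≤ ρ) (hρ₁ : ρ < 1) (α : ℝ) (hα₀ : 0 ≤ α) (hα₁ : α < (1 - ρ) / 2) :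
    ∃ K : ℝ, 0 ≤ K ∧
      ∀ e : V3 → OrthonormalBasis (Fin 3) ℝ V3, IsCollisionFrame e →
      ∀ (Ω : Set V3) (R r : ℝ), AssumptionOmega Ω →
        IsCircumscribedRadius Ω R → IsInteriorRadius Ω r →
      ∀ h₁ ∈ hatL Ω α, ∀ h₂ ∈ hatL Ω α,
        hatNorm Ω α (transportS C γ Ω (collisionGamma C γ e h₁ h₂)) ≤
          ENNReal.ofReal (K * (1 + Metric.diam Ω + Real.sqrt (R * r) * (1 + R / r)))
            * hatNorm Ω α h₁ * hatNorm Ω α h₂ := by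
  obtain ⟨K, hK, h⟩ := exists_hatNorm_transportS_le hC hγ₀ hγ₁
  refine ⟨K, hK, fun e he Ω R r hΩ hR hr h₁ hh₁ h₂ hh₂ => ?_⟩
  have hround := hΩ.uniformlyRound hR hr
  have hR0 := hround.pos_R
  -- The proved constant 1 + R is dominated by the geometric factor of the statement.
  have hle : 1 + R ≤ 1 + Metric.diam Ω + Real.sqrt (R * r) * (1 + R / r) := by
    linarith [hround.radius_le, Metric.diam_nonneg (s := Ω)]
  refine le_ofReal_mul_mul_of_forall_lt
    (mul_nonneg hK (le_trans (by positivity) hle)) hh₁.ne hh₂.ne fun A₁ A₂ hA₁ hA₂ => ?_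
  refine (h he hround hα₀ (by linarith) hA₁ hA₂).trans (ENNReal.ofReal_le_ofReal ?_)
  have p₁ : 0 < A₁ := ENNReal.ofReal_pos.1 (bot_le.trans_lt hA₁)
  have p₂ : 0 < A₂ := ENNReal.ofReal_pos.1 (bot_le.trans_lt hA₂)
  gcongr
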